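/- Let $\mathbb M=\mathbb R^2$ be $2$-dimensional Minkowski spacetime with light-cone coordinates $x^\pm=t\pm x$, metric $g=\tfrac12(\mathrm dx^+\otimes \mathrm dx^-+\mathrm dx^-\otimes\mathrm dx^+)$, orientation $\mathrm dx^-\wedge\mathrm dx^+$ and time-orientation $\mathrm dx^++\mathrm dx^-$, and let $\mathbb M/\mathbb Z$ be the flat cylinder, the quotient by $(n,x^\pm)\mapsto x^\pm\pm n$. Let $\mathbf C$ be the category with these two objects whose morphisms are the orientation and time-orientation preserving conformal embeddings with causally convex image; these are the maps induced by $(x^+,x^-)\mapsto(f^+(x^+),f^-(x^-))$ with smooth $f^\pm:\mathbb R\to\mathbb R$ of positive derivative, where moreover for $\mathbb M\to\mathbb M/\mathbb Z$ the images $f^\pm(\mathbb R)$ have length at most $1$, for $\mathbb M/\mathbb Z\to\mathbb M/\mathbb Z$ one has $f^\pm(t+1)=f^\pm(t)+1$, and there are no morphisms $\mathbb M/\mathbb Z\to\mathbb M$. Let $\mathbf{Man}$ be the category with the two objects $\mathbb R$ and $\mathbb T=\mathbb R/\mathbb Z$ and orientation preserving embeddings as morphisms, and let $\pi_\pm:\mathbf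 C\to\mathbf{Man}$ be the functors with $\pi_\pm(\mathbb M)=\mathbb R$, $\pi_\pm(\mathbb M/\mathbb Z)=\mathbb T$ that send the morphism given by $(f^+,f^-)$ to the one given by $f^\pm$. For $M\in\mathbf C$ let $\Omega^1_{\mathrm c}(M)$ be the real compactly supported smooth $1$-forms, $\ast$ the Hodge operator ($\ast\,\mathrm dx^\pm=\pm\mathrm dx^\pm$), $$\mathfrak L(M)=\frac{\Omega^1_{\mathrm c}(M)}{\mathrm d C^\infty_{\mathrm c}(M)+{\ast\mathrm d} C^\infty_{\mathrm c}(M)},\qquad \tau_M([\alpha],[\beta])=\int_M(\mathrm d\alpha)\,G_M(\mathrm d\beta),$$ where $G_M=G_M^+-G_M^-$ is the causal propagator (retarded minus advanced) of $P_M=\mathrm d{\ast}\mathrm d:C^\infty(M)\to\Omega^2(M)$. For a real vector space $V$ with skew-symmetric bilinear form $\tau$ let $\mathrm{CCR}(V,\tau)$ be the unital $\ast$-algebra over $\mathbb C$ generated by symbols $\Phi(v)$, $v\in V$, that are $\mathbb R$-linear in $v$, with $\Phi(v)^*=\Phi(v)$ and $[\Phi(v),\Phi(w)]=\mathrm i\,\tau(v,w)\mathbf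 1$. The Abelian current is the functor $\mathfrak A:\mathbf C\to{}^\ast\mathbf{Alg}_{\mathbb C}$, $\mathfrak A(M)=\mathrm{CCR}(\mathfrak L(M),\tau_M)$, acting on morphisms by pushforward of compactly supported forms. Its chiral components are the right Kan extensions ${\pi_\pm}_*(\mathfrak A)=\mathrm{Ran}_{\pi_\pm}(\mathfrak A):\mathbf{Man}\to{}^\ast\mathbf{Alg}_{\mathbb C}$. Put $\mathrm d^\pm=\tfrac12(\mathrm{id}\pm\ast)\mathrm d$, and let $\mathfrak L^+(\mathbb M)\subseteq\mathfrak L(\mathbb M)$, resp. $\mathfrak L^-(\mathbb M)\subseteq\mathfrak L(\mathbb M)$, be the subspace of classes of anti-self-dual $1$-forms $\alpha\in\Omega^{1,-}_{\mathrm c}(\mathbb M)$, $\ast\alpha=-\alpha$, resp. self-dual $1$-forms $\alpha\in\Omega^{1,+}_{\mathrm c}(\mathbb M)$, $\ast\alpha=\alpha$. **Proposition.** $\mathfrak L(\mathbb M)=\mathfrak L^+(\mathbb M)\oplus\mathfrak L^-(\mathbb M)$ with $\mathfrak L^{\pm}(\mathbb M)=\Omega^{1,\mp}_{\mathrm c}(\mathbb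 M)/\mathrm d^{\mp}C^\infty_{\mathrm c}(\mathbb M)$, and for each of the two signs the following hold. 1. The inclusion $\mathfrak L^\pm(\mathbb M)\subseteq\mathfrak L(\mathbb M)$ induces an injective homomorphism $\mathrm{CCR}(\mathfrak L^\pm(\mathbb M),\tau_{\mathbb M})\to\mathfrak A(\mathbb M)$. The right Kan extension ${\pi_\pm}_*(\mathfrak A)$ exists and is pointwise, and the component ${\pi_\pm}_*(\mathfrak A)(\mathbb R)\to\mathfrak A(\mathbb M)$ at $\mathbb M$ of its counit is injective with image $\mathrm{CCR}(\mathfrak L^\pm(\mathbb M),\tau_{\mathbb M})$, i.e. with image the unital $\ast$-subalgebra generated by $\Phi(u)$, $u\in\mathfrak L^\pm(\mathbb M)$: $${\pi_\pm}_*(\mathfrak A)(\mathbb R)=\mathrm{CCR}(\mathfrak L^\pm(\mathbb M),\tau_{\mathbb M})\subseteq\mathfrak A(\mathbb M).$$ 2. Fibre integration, $[\varphi\,\mathrm dx^-]\mapsto\int_{\mathbb R}\varphi(\,\cdot\,,x^-)\,\mathrm dx^-$ for $+$ and $[\varphi\,\mathrm dx^+]\mapsto\int_{\mathbb R}\varphi(x^+,\,\cdot\,)\,\mathrm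 dx^+$ for $-$ (with $\varphi=\varphi(x^+,x^-)$), is a well-defined linear isomorphism $p_\pm:\mathfrak L^\pm(\mathbb M)\to C^\infty_{\mathrm c}(\mathbb R)$ which carries $\tau_{\mathbb M}$ to $\tau_{\mathbb R}(\varphi,\psi)=-\tfrac12\int_{\mathbb R}\varphi\,\mathrm d\psi$, and there is an isomorphism of unital $\ast$-algebras $${\pi_\pm}_*(\mathfrak A)(\mathbb R)\cong\mathrm{CCR}(C^\infty_{\mathrm c}(\mathbb R),\tau_{\mathbb R})$$ under which the element of ${\pi_\pm}_*(\mathfrak A)(\mathbb R)$ with image $\Phi(u)\in\mathfrak A(\mathbb M)$ corresponds to $\Phi(p_\pm(u))$, for all $u\in\mathfrak L^\pm(\mathbb M)$. -/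

import Mathlib

open CategoryTheory MeasureTheory
open scoped ContDiff Topology

namespace ChiralCurrent

/-! ### Unital star-algebras and canonical commutation relations -/

/-- Unital associative star-algebras over `ℂ`. -/
structure StarAlg where
  /-- the underlying set -/
  carrier : Type
  [ring : Ring carrier]
  [starRing : StarRing carrier]
  [algebra : Algebra ℂ carrier]
  [starModule : StarModule ℂ carrier]

attribute [instance] StarAlg.ring StarAlg.starRing StarAlg.algebra StarAlg.starModule

/-- The category of unital star-algebras and unital star-homomorphisms. -/
instance : Category StarAlg where
  Hom A B := A.carrier →⋆ₐ[ℂ] B.carrier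
  id A := StarAlgHom.id ℂ A.carrier
  comp f g := StarAlgHom.comp g f

section CCR

variable {V W : Type} [AddCommGroup V] [Module ℝ V] [AddCommGroup W] [Module ℝ W]

/-- The defining relations of the algebra of canonical commutation relations: the generators depend
real-linearly on `v`, and `[v, w] = i τ(v, w)`. -/
inductive CCRRel (τ : V →ₗ[ℝ] V →ₗ[ℝ] ℝ) : FreeAlgebra ℂ V → FreeAlgebra ℂ V → Prop
  | add (v w : V) :
      CCRRel τ (FreeAlgebra.ι ℂ (v + w)) (FreeAlgebra.ι ℂ v + FreeAlgebra.ι ℂ w)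
  | smul (r : ℝ) (v : V) :
      CCRRel τ (FreeAlgebra.ι ℂ (r • v)) ((r : ℂ) • FreeAlgebra.ι ℂ v)
  | comm (v w : V) :
      CCRRel τ (FreeAlgebra.ι ℂ v * FreeAlgebra.ι ℂ w)
        (FreeAlgebra.ι ℂ w * FreeAlgebra.ι ℂ v +
          algebraMap ℂ (FreeAlgebra ℂ V) (Complex.I * (τ v w : ℂ)))

/-- The (polynomial) CCR algebra of a real vector space `V` with Poisson structure `τ`: the unital
complex algebra generated by `V` subject to the canonical commutation relations. The involution is
defined below; it fixes the generators. -/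
def CCR (τ : V →ₗ[ℝ] V →ₗ[ℝ] ℝ) : Type := RingQuot (CCRRel τ)

namespace CCR

noncomputable instance (τ : V →ₗ[ℝ] V →ₗ[ℝ] ℝ) : Ring (CCR τ) :=
  inferInstanceAs (Ring (RingQuot (CCRRel τ)))

noncomputable instance (τ : V →ₗ[ℝ] V →ₗ[ℝ] ℝ) : Algebra ℂ (CCR τ) :=
  inferInstanceAs (Algebra ℂ (RingQuot (CCRRel τ)))

variable (τ : V →ₗ[ℝ] V →ₗ[ℝ] ℝ) (σ : W →ₗ[ℝ] W →ₗ[ℝ] ℝ)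

/-- The generator of the CCR algebra labelled by `v` (the linear observable `v`). -/
noncomputable def gen (v : V) : CCR τ :=
  RingQuot.mkAlgHom ℂ (CCRRel τ) (FreeAlgebra.ι ℂ v)

theorem gen_add (v w : V) : gen τ (v + w) = gen τ v + gen τ w := by
  have h := RingQuot.mkAlgHom_rel ℂ (CCRRel.add (τ := τ) v w)
  rw [map_add] at h
  exact h

theorem gen_smul (r : ℝ) (v : V) : gen τ (r • v) = (r : ℂ) • gen τ v := by
  have h := RingQuot.mkAlgHom_rel ℂ (CCRRel.smul (τ := τ) r v)
  rw [map_smul] at h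
  exact h

theorem gen_comm (v w : V) :
    gen τ v * gen τ w = gen τ w * gen τ v + algebraMap ℂ (CCR τ) (Complex.I * (τ v w : ℂ)) := by
  have h := RingQuot.mkAlgHom_rel ℂ (CCRRel.comm (τ := τ) v w)
  rw [map_add, map_mul, map_mul, AlgHom.commutes] at h
  exact h

variable {τ}

/-- The universal property of the CCR algebra. -/
noncomputable def lift {A : Type} [Ring A] [Algebra ℂ A] (f : V → A)
    (hadd : ∀ v w, f (v + w) = f v + f w) (hsmul : ∀ (r : ℝ) v, f (r • v) = (r : ℂ) • f v)
    (hcomm : ∀ v w, f v * f w = f w * f v + algebraMap ℂ A (Complex.I * (τ v w : ℂ))) :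
    CCR τ →ₐ[ℂ] A :=
  RingQuot.liftAlgHom ℂ ⟨FreeAlgebra.lift ℂ f, by
    intro x y h
    induction h with
    | add v w => simp [hadd]
    | smul r v => rw [map_smul, FreeAlgebra.lift_ι_apply, FreeAlgebra.lift_ι_apply, hsmul]
    | comm v w => simp only [map_mul, map_add, FreeAlgebra.lift_ι_apply, AlgHom.commutes, hcomm v w]⟩

theorem lift_gen {A : Type} [Ring A] [Algebra ℂ A] (f : V → A)
    (hadd : ∀ v w, f (v + w) = f v + f w) (hsmul : ∀ (r : ℝ) v, f (r • v) = (r : ℂ) • f v)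
    (hcomm : ∀ v w, f v * f w = f w * f v + algebraMap ℂ A (Complex.I * (τ v w : ℂ))) (v : V) :
    lift (τ := τ) f hadd hsmul hcomm (gen τ v) = f v := by
  change RingQuot.liftAlgHom ℂ _ (RingQuot.mkAlgHom ℂ (CCRRel τ) (FreeAlgebra.ι ℂ v)) = f v
  rw [RingQuot.liftAlgHom_mkAlgHom_apply, FreeAlgebra.lift_ι_apply]

theorem induction {p : CCR τ → Prop} (halg : ∀ c, p (algebraMap ℂ (CCR τ) c))
    (hgen : ∀ v, p (gen τ v)) (hadd : ∀ a b, p a → p b → p (a + b))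
    (hmul : ∀ a b, p a → p b → p (a * b)) (a : CCR τ) : p a := by
  obtain ⟨x, rfl⟩ := RingQuot.mkAlgHom_surjective ℂ (CCRRel τ) a
  induction x using FreeAlgebra.induction with
  | grade0 r => rw [AlgHom.commutes]; exact halg r
  | grade1 v => exact hgen v
  | add x y hx hy => rw [map_add]; exact hadd _ _ hx hy
  | mul x y hx hy => rw [map_mul]; exact hmul _ _ hx hy

/-- The opposite algebra of the complex conjugate of the CCR algebra: the target of the involution
seen as a homomorphism of complex algebras. -/
def ConjOp (τ : V →ₗ[ℝ] V →ₗ[ℝ] ℝ) : Type := (CCR τ)ᵐᵒᵖ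

noncomputable instance : Ring (ConjOp τ) := inferInstanceAs (Ring (CCR τ)ᵐᵒᵖ)

noncomputable instance : Algebra ℂ (ConjOp τ) :=
  RingHom.toAlgebra' ((algebraMap ℂ (CCR τ)ᵐᵒᵖ).comp (starRingEnd ℂ))
    (fun c x => Algebra.commutes (A := (CCR τ)ᵐᵒᵖ) (starRingEnd ℂ c) x)

/-- The identity map to the conjugate opposite algebra. -/
def toConj (a : CCR τ) : ConjOp τ := MulOpposite.op a

/-- The identity map from the conjugate opposite algebra. -/
def ofConj (a : ConjOp τ) : CCR τ := MulOpposite.unop (α := CCR τ) a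

theorem toConj_add (a b : CCR τ) : toConj a + toConj b = toConj (a + b) := rfl

theorem toConj_mul (a b : CCR τ) : toConj a * toConj b = toConj (b * a) := rfl

theorem algebraMap_conjOp (c : ℂ) : algebraMap ℂ (ConjOp τ) c =
    toConj (algebraMap ℂ (CCR τ) (starRingEnd ℂ c)) := rfl

/-- The involution as a homomorphism to the conjugate opposite algebra. -/
noncomputable def conjHom : CCR τ →ₐ[ℂ] ConjOp τ :=
  lift (τ := τ) (A := ConjOp τ) (fun v => toConj (gen τ v))
    (fun v w => by rw [toConj_add, gen_add])
    (fun r v => by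
      rw [Algebra.smul_def, algebraMap_conjOp, toConj_mul, gen_smul, Complex.conj_ofReal,
        ← Algebra.commutes, ← Algebra.smul_def])
    (fun v w => by
      rw [algebraMap_conjOp, toConj_mul, toConj_mul, toConj_add, gen_comm τ v w]
      congr 1
      have hc : (starRingEnd ℂ) (Complex.I * (τ v w : ℂ)) = -(Complex.I * (τ v w : ℂ)) := by
        rw [map_mul, Complex.conj_I, Complex.conj_ofReal, neg_mul]
      rw [hc, map_neg]
      abel)

noncomputable instance : Star (CCR τ) where
  star a := ofConj (conjHom a)

theorem star_def (a : CCR τ) :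
    star a = ofConj (conjHom a) := rfl

theorem star_gen (v : V) : star (gen τ v) = gen τ v := by
  rw [star_def, conjHom, lift_gen]
  rfl

theorem star_algebraMap (c : ℂ) :
    star (algebraMap ℂ (CCR τ) c) = algebraMap ℂ (CCR τ) (star c) := by
  rw [star_def, AlgHom.commutes, algebraMap_conjOp]
  rfl

theorem star_mul' (a b : CCR τ) : star (a * b) = star b * star a := by
  rw [star_def, map_mul]
  rfl

theorem star_add' (a b : CCR τ) : star (a + b) = star a + star b := by
  rw [star_def, map_add]
  rfl

noncomputable instance : StarRing (CCR τ) where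
  star_involutive a := by
    induction a using induction with
    | halg c => rw [star_algebraMap, star_algebraMap, star_star]
    | hgen v => rw [star_gen, star_gen]
    | hadd a b ha hb => rw [star_add', star_add', ha, hb]
    | hmul a b ha hb => rw [star_mul', star_mul', ha, hb]
  star_mul := star_mul'
  star_add := star_add'

instance : StarModule ℂ (CCR τ) where
  star_smul c a := by
    rw [Algebra.smul_def, star_mul', star_algebraMap, Algebra.smul_def, Algebra.commutes]

variable {σ}

/-- Functoriality of the CCR algebra with respect to Poisson maps. -/
noncomputable def map (f : V →ₗ[ℝ] W) (hf : ∀ v w, σ (f v) (f w) = τ v w) :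
    CCR τ →⋆ₐ[ℂ] CCR σ :=
  { lift (τ := τ) (A := CCR σ) (fun v => gen σ (f v))
      (fun v w => by rw [map_add, gen_add]) (fun r v => by rw [map_smul, gen_smul])
      (fun v w => by rw [gen_comm, hf]) with
    map_star' := fun a => by
      change lift (τ := τ) (A := CCR σ) _ _ _ _ (star a) =
        star (lift (τ := τ) (A := CCR σ) _ _ _ _ a)
      induction a using induction with
      | halg c => rw [star_algebraMap, AlgHom.commutes, AlgHom.commutes, star_algebraMap]
      | hgen v => rw [star_gen, lift_gen, star_gen]
      | hadd a b ha hb => rw [star_add, map_add, ha, hb, map_add, star_add]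
      | hmul a b ha hb => rw [star_mul, map_mul, ha, hb, map_mul, star_mul] }

theorem map_gen (f : V →ₗ[ℝ] W) (hf : ∀ v w, σ (f v) (f w) = τ v w) (v : V) :
    map f hf (gen τ v) = gen σ (f v) :=
  lift_gen (τ := τ) (A := CCR σ) (fun v => gen σ (f v))
    (fun v w => by rw [map_add, gen_add]) (fun r v => by rw [map_smul, gen_smul])
    (fun v w => by rw [gen_comm, hf]) v

theorem hom_ext {A : Type} [Ring A] [StarRing A] [Algebra ℂ A] {f g : CCR τ →⋆ₐ[ℂ] A}
    (h : ∀ v, f (gen τ v) = g (gen τ v)) : f = g := by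
  ext a
  induction a using induction with
  | halg c => rw [AlgHomClass.commutes, AlgHomClass.commutes]
  | hgen v => exact h v
  | hadd a b ha hb => rw [map_add, map_add, ha, hb]
  | hmul a b ha hb => rw [map_mul, map_mul, ha, hb]

/-- The CCR algebra as an object of the category of star-algebras. -/
noncomputable def obj (τ : V →ₗ[ℝ] V →ₗ[ℝ] ℝ) : StarAlg := ⟨CCR τ⟩

end CCR

end CCR

/-! ### Skeletal categories of one-dimensional manifolds and of conformal spacetimes -/

/-- The two light-cone directions. -/
inductive Chirality
  | plus
  | minus

/-- The two connected oriented `1`-manifolds (up to isomorphism): the line `ℝ` and the circle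
`ℝ / ℤ`. -/
inductive Curve
  | line
  | circle

/-- The lattice `Λ ⊆ ℝ` such that the curve is `ℝ / Λ`. -/
def Curve.lattice : Curve → AddSubgroup ℝ
  | .line => ⊥
  | .circle => AddSubgroup.zmultiples 1

/-- The points of the line, resp. of the circle. -/
abbrev Curve.Pt (N : Curve) : Type := ℝ ⧸ N.lattice

/-- The two objects: Minkowski spacetime and the flat cylinder. Both are quotients of `ℝ × ℝ`, where
`x : ℝ × ℝ` has the light-cone coordinates `x⁺ = x.1` and `x⁻ = x.2`; the metric is
`(dx⁺ ⊗ dx⁻ + dx⁻ ⊗ dx⁺) / 2`, the orientation is `dx⁻ ∧ dx⁺` and the time-orientation is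
`dx⁺ + dx⁻`. -/
inductive Spacetime
  | mink
  | cyl

/-- The deck group: trivial for Minkowski spacetime, generated by `(x⁺, x⁻) ↦ (x⁺ + 1, x⁻ - 1)` for
the cylinder. -/
def Spacetime.deck : Spacetime → AddSubgroup (ℝ × ℝ)
  | .mink => ⊥
  | .cyl => AddSubgroup.zmultiples (1, -1)

/-- The points of the spacetime. -/
abbrev Spacetime.Pt (X : Spacetime) : Type := (ℝ × ℝ) ⧸ X.deck

/-- The leaf space of either light-cone foliation (`ℝ` for Minkowski spacetime, `ℝ / ℤ` for the
cylinder). -/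
def Spacetime.curve : Spacetime → Curve
  | .mink => .line
  | .cyl => .circle

/-- `h : ℝ → ℝ` is a lift, to the universal covers, of an orientation preserving embedding of curves:
it is smooth with positive derivative and
* from the line to the line there is no further condition;
* from the line to the circle, the image of `h` is an interval of length at most `1`;
* there is no embedding of the circle into the line;
* from the circle to the circle, `h (t + 1) = h t + 1`. -/
structure IsEmbLift (N N' : Curve) (h : ℝ → ℝ) : Prop where
  smooth : ContDiff ℝ ∞ h
  deriv_pos : ∀ t, 0 < deriv h t
  compat : match N, N' with
    | .line, .line => True
    | .line, .circle => ∀ t u, h t - h u ≤ 1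
    | .circle, .line => False
    | .circle, .circle => ∀ t, h (t + 1) = h t + 1

theorem IsEmbLift.strictMono {N N' : Curve} {h : ℝ → ℝ} (H : IsEmbLift N N' h) : StrictMono h :=
  strictMono_of_deriv_pos H.deriv_pos

theorem IsEmbLift.hasDerivAt {N N' : Curve} {h : ℝ → ℝ} (H : IsEmbLift N N' h) (t : ℝ) :
    HasDerivAt h (deriv h t) t :=
  (H.smooth.differentiable (by simp) t).hasDerivAt

theorem IsEmbLift.lt_one {h : ℝ → ℝ} (H : IsEmbLift .line .circle h) (t u : ℝ) :
    h t - h u < 1 := by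
  have h1 := H.strictMono (lt_add_one t)
  have h2 := H.compat (t + 1) u
  linarith

theorem IsEmbLift.add_int {h : ℝ → ℝ} (H : IsEmbLift .circle .circle h) (t : ℝ) (n : ℤ) :
    h (t + n) = h t + n := by
  have hN : ∀ (k : ℕ) (t : ℝ), h (t + k) = h t + k := by
    intro k
    induction k with
    | zero => intro t; simp
    | succ k ih =>
      intro t
      have h1 : h (t + k + 1) = h (t + k) + 1 := H.compat (t + k)
      push_cast
      rw [← add_assoc, h1, ih, add_assoc]
  obtain ⟨k, rfl | rfl⟩ := n.eq_nat_or_neg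
  · exact_mod_cast hN k t
  · have h2 := hN k (t - k)
    rw [sub_add_cancel] at h2
    push_cast
    rw [← sub_eq_add_neg]
    linarith

theorem IsEmbLift.id (N : Curve) : IsEmbLift N N (fun t => t) where
  smooth := contDiff_id
  deriv_pos t := by simp
  compat := by cases N <;> simp

theorem IsEmbLift.deriv_comp {N₁ N₂ N₃ : Curve} {h k : ℝ → ℝ} (K : IsEmbLift N₂ N₃ k)
    (H : IsEmbLift N₁ N₂ h) (t : ℝ) :
    deriv (fun t => k (h t)) t = deriv k (h t) * deriv h t :=
  ((K.hasDerivAt (h t)).comp t (H.hasDerivAt t)).deriv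

theorem IsEmbLift.comp {N₁ N₂ N₃ : Curve} {h k : ℝ → ℝ} (K : IsEmbLift N₂ N₃ k)
    (H : IsEmbLift N₁ N₂ h) : IsEmbLift N₁ N₃ (fun t => k (h t)) where
  smooth := K.smooth.comp H.smooth
  deriv_pos t := by
    rw [K.deriv_comp H]
    exact mul_pos (K.deriv_pos _) (H.deriv_pos _)
  compat := by
    cases N₁ <;> cases N₂ <;> cases N₃ <;> simp only
    · exact fun t u => K.compat _ _
    · intro t u
      have h1 := (K.strictMono.monotone (by linarith [H.compat t u] : h t ≤ h u + 1))
      have h2 := K.compat (h u)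
      linarith
    · exact H.compat.elim
    · exact H.compat.elim
    · exact K.compat.elim
    · intro t
      have h1 := H.compat t
      have h2 := K.compat (h t)
      rw [h1, h2]

/-- An orientation preserving embedding between curves. -/
def Curve.IsEmb {N N' : Curve} (f : N.Pt → N'.Pt) : Prop :=
  ∃ h, IsEmbLift N N' h ∧ ∀ t : ℝ, f (t : N.Pt) = (h t : N'.Pt)

/-- The skeletal category of connected oriented `1`-manifolds and orientation preserving
embeddings. -/
instance : Category Curve where
  Hom N N' := {f : N.Pt → N'.Pt // Curve.IsEmb f}
  id N := ⟨fun p => p, fun t => t, IsEmbLift.id N, fun _ => rfl⟩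
  comp f g := ⟨fun p => g.1 (f.1 p), by
    obtain ⟨h, H, hf⟩ := f.2
    obtain ⟨k, K, kg⟩ := g.2
    exact ⟨fun t => k (h t), K.comp H, fun t => by
      change g.1 (f.1 t) = _
      rw [hf, kg]⟩⟩

/-- The pair `(h⁺, h⁻)` is a lift of the map of spacetimes `f` to the universal covers; it exhibits
`f` as an orientation and time-orientation preserving conformal embedding with causally convex
image. -/
structure IsLift {X Y : Spacetime} (f : X.Pt → Y.Pt) (hp hm : ℝ → ℝ) : Prop where
  embPlus : IsEmbLift X.curve Y.curve hp
  embMinus : IsEmbLift X.curve Y.curve hm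
  map_coe : ∀ x : ℝ × ℝ, f (x : X.Pt) = ((hp x.1, hm x.2) : ℝ × ℝ)

/-- The skeletal category of the Minkowski spacetime and the flat cylinder, with the orientation and
time-orientation preserving conformal embeddings with causally convex image as morphisms. In
light-cone coordinates these are the maps `(x⁺, x⁻) ↦ (h⁺ x⁺, h⁻ x⁻)` for a lift `(h⁺, h⁻)`; two
lifts define the same morphism if and only if they differ by a deck transformation. -/
instance : Category Spacetime where
  Hom X Y := {f : X.Pt → Y.Pt // ∃ hp hm, IsLift f hp hm}
  id X := ⟨fun p => p, fun t => t, fun t => t, IsEmbLift.id _, IsEmbLift.id _, fun _ => rfl⟩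
  comp f g := ⟨fun p => g.1 (f.1 p), by
    obtain ⟨hp, hm, H⟩ := f.2
    obtain ⟨kp, km, K⟩ := g.2
    exact ⟨fun t => kp (hp t), fun t => km (hm t), K.embPlus.comp H.embPlus,
      K.embMinus.comp H.embMinus, fun x => by rw [H.map_coe, K.map_coe]⟩⟩

theorem Spacetime.hom_ext {X Y : Spacetime} {f g : X ⟶ Y} (h : ∀ x : ℝ × ℝ, f.1 x = g.1 x) :
    f = g :=
  Subtype.ext (funext fun p => QuotientAddGroup.induction_on p h)

theorem Curve.hom_ext {N N' : Curve} {f g : N ⟶ N'} (h : ∀ t : ℝ, f.1 t = g.1 t) : f = g :=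
  Subtype.ext (funext fun p => QuotientAddGroup.induction_on p h)

/-- The light-cone coordinate `x⁺` or `x⁻`. -/
def Chirality.coord : Chirality → ℝ × ℝ →+ ℝ
  | .plus => AddMonoidHom.fst ℝ ℝ
  | .minus => AddMonoidHom.snd ℝ ℝ

theorem Spacetime.deck_le (X : Spacetime) (s : Chirality) :
    X.deck ≤ X.curve.lattice.comap s.coord := by
  cases X
  · exact bot_le
  · rw [Spacetime.deck, AddSubgroup.zmultiples_le]
    cases s
    · exact AddSubgroup.mem_zmultiples (1 : ℝ)
    · exact neg_mem (AddSubgroup.mem_zmultiples (1 : ℝ))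

/-- The projection of a spacetime onto the leaf space, `[x⁺, x⁻] ↦ [x⁺]`, resp. `[x⁻]`. -/
def Spacetime.proj (X : Spacetime) (s : Chirality) : X.Pt → X.curve.Pt :=
  QuotientAddGroup.map X.deck X.curve.lattice s.coord (X.deck_le s)

/-- A section of both projections onto the leaf space. -/
noncomputable def Spacetime.section (X : Spacetime) (p : X.curve.Pt) : X.Pt :=
  ((p.out, p.out) : ℝ × ℝ)

theorem Spacetime.proj_coe (X : Spacetime) (s : Chirality) (x : ℝ × ℝ) :
    X.proj s (x : X.Pt) = (s.coord x : X.curve.Pt) := rfl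

theorem IsEmbLift.coe_eq {N N' : Curve} {h : ℝ → ℝ} (H : IsEmbLift N N' h) {t u : ℝ}
    (htu : (t : N.Pt) = (u : N.Pt)) : (h t : N'.Pt) = (h u : N'.Pt) := by
  rw [QuotientAddGroup.eq] at htu ⊢
  cases N
  · have h1 : -t + u = 0 := htu
    have h2 : t = u := by linarith
    rw [h2, neg_add_cancel]
    exact zero_mem _
  · cases N'
    · exact H.compat.elim
    · obtain ⟨n, hn⟩ := AddSubgroup.mem_zmultiples_iff.1 htu
      refine AddSubgroup.mem_zmultiples_iff.2 ⟨n, ?_⟩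
      have h2 : u = t + n := by
        simp only [zsmul_eq_mul, mul_one] at hn
        linarith
      rw [h2, H.add_int]
      simp

theorem Spacetime.proj_hom {X Y : Spacetime} (s : Chirality) (f : X ⟶ Y) {hp hm : ℝ → ℝ}
    (H : IsLift f.1 hp hm) (t : ℝ) :
    Y.proj s (f.1 (X.section (t : X.curve.Pt))) =
      (match s with | .plus => hp t | .minus => hm t : ℝ) := by
  have h1 : ((t : X.curve.Pt).out : X.curve.Pt) = (t : X.curve.Pt) := Quotient.out_eq' _
  rw [Spacetime.section, H.map_coe, proj_coe]
  cases s
  · exact H.embPlus.coe_eq h1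
  · exact H.embMinus.coe_eq h1

/-- The functor projecting onto one of the two chiralities: it sends Minkowski spacetime to the line,
the cylinder to the circle, and the morphism `(h⁺, h⁻)` to `h⁺`, resp. `h⁻`. -/
noncomputable def chiralProj (s : Chirality) : Spacetime ⥤ Curve where
  obj X := X.curve
  map {X Y} f := ⟨fun p => Y.proj s (f.1 (X.section p)), by
    obtain ⟨hp, hm, H⟩ := f.2
    refine ⟨match s with | .plus => hp | .minus => hm, ?_, fun t => ?_⟩
    · cases s
      · exact H.embPlus
      · exact H.embMinus
    · refine (Spacetime.proj_hom s f H t).trans ?_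
      cases s <;> rfl⟩
  map_id X := Curve.hom_ext fun t => by
    have H : IsLift (𝟙 X : X ⟶ X).1 (fun t => t) (fun t => t) :=
      ⟨IsEmbLift.id _, IsEmbLift.id _, fun _ => rfl⟩
    refine (Spacetime.proj_hom s (𝟙 X) H t).trans ?_
    cases s <;> rfl
  map_comp {X Y Z} f g := Curve.hom_ext fun t => by
    obtain ⟨hp, hm, H⟩ := f.2
    obtain ⟨kp, km, K⟩ := g.2
    have HK : IsLift (f ≫ g).1 (fun t => kp (hp t)) (fun t => km (hm t)) :=
      ⟨K.embPlus.comp H.embPlus, K.embMinus.comp H.embMinus, fun x => by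
        change g.1 (f.1 _) = _
        rw [H.map_coe, K.map_coe]⟩
    refine (Spacetime.proj_hom s (f ≫ g) HK t).trans ?_
    change _ = Z.proj s (g.1 (Y.section (Y.proj s (f.1 (X.section (t : X.curve.Pt))))))
    rw [Spacetime.proj_hom s f H, Spacetime.proj_hom s g K]
    cases s <;> rfl

/-! ### Compactly supported forms on the spacetimes -/

/-- `φ`, a function of the light-cone coordinates, is a compactly supported smooth function on the
spacetime `X`: it is smooth, invariant under the deck group, and its support is contained in the
translates of a compact set. -/
structure IsTest (X : Spacetime) (φ : ℝ × ℝ → ℝ) : Prop where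
  smooth : ContDiff ℝ ∞ φ
  periodic : ∀ γ ∈ X.deck, ∀ x, φ (x + γ) = φ x
  compact : ∃ K : Set (ℝ × ℝ), IsCompact K ∧ ∀ x, φ x ≠ 0 → ∃ γ ∈ X.deck, x + γ ∈ K

/-- The space of compactly supported smooth functions on a spacetime. -/
def Test (X : Spacetime) : Submodule ℝ (ℝ × ℝ → ℝ) where
  carrier := {φ | IsTest X φ}
  zero_mem' := ⟨contDiff_const, fun _ _ _ => rfl, ∅, isCompact_empty, fun _ h => (h rfl).elim⟩
  add_mem' := by
    rintro φ ψ ⟨h1, h2, K, hK, h3⟩ ⟨k1, k2, K', hK', k3⟩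
    refine ⟨h1.add k1, fun γ hγ x => ?_, K ∪ K', hK.union hK', fun x hx => ?_⟩
    · rw [Pi.add_apply, Pi.add_apply, h2 γ hγ, k2 γ hγ]
    · by_cases h : φ x = 0
      · obtain ⟨γ, hγ, hx'⟩ := k3 x (fun h' => hx (by rw [Pi.add_apply, h, h', add_zero]))
        exact ⟨γ, hγ, Or.inr hx'⟩
      · obtain ⟨γ, hγ, hx'⟩ := h3 x h
        exact ⟨γ, hγ, Or.inl hx'⟩
  smul_mem' := by
    rintro c φ ⟨h1, h2, K, hK, h3⟩
    refine ⟨contDiff_const.smul h1, fun γ hγ x => ?_, K, hK, fun x hx => h3 x fun h => hx ?_⟩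
    · rw [Pi.smul_apply, Pi.smul_apply, h2 γ hγ]
    · rw [Pi.smul_apply, h, smul_zero]

theorem IsTest.mul {X : Spacetime} {φ w : ℝ × ℝ → ℝ} (h : IsTest X φ) (hw : ContDiff ℝ ∞ w)
    (hp : ∀ γ ∈ X.deck, ∀ x, w (x + γ) = w x) : IsTest X (fun x => φ x * w x) := by
  obtain ⟨h1, h2, K, hK, h3⟩ := h
  refine ⟨h1.mul hw, fun γ hγ x => by rw [h2 γ hγ, hp γ hγ], K, hK, fun x hx => h3 x fun h => hx ?_⟩
  rw [h, zero_mul]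

/-- The direction of the coordinate vector field `∂₊`, resp. `∂₋`. -/
def Chirality.dir : Chirality → ℝ × ℝ
  | .plus => (1, 0)
  | .minus => (0, 1)

theorem Spacetime.isClosed_deck (X : Spacetime) : IsClosed (X.deck : Set (ℝ × ℝ)) := by
  cases X
  · exact isClosed_singleton
  · have h : ((AddSubgroup.zmultiples ((1, -1) : ℝ × ℝ) : AddSubgroup (ℝ × ℝ)) : Set (ℝ × ℝ)) =
        {x | x.1 ∈ Set.range ((↑) : ℤ → ℝ)} ∩ {x | x.2 = -x.1} := by
      ext ⟨x, y⟩
      simp only [SetLike.mem_coe, AddSubgroup.mem_zmultiples_iff, Set.mem_inter_iff,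
        Set.mem_ofPred_eq, Set.mem_range, Prod.smul_mk, Prod.mk.injEq, zsmul_eq_mul, mul_one,
        mul_neg]
      constructor
      · rintro ⟨n, rfl, rfl⟩
        exact ⟨⟨n, rfl⟩, rfl⟩
      · rintro ⟨⟨n, rfl⟩, rfl⟩
        exact ⟨n, rfl, rfl⟩
    change IsClosed ((AddSubgroup.zmultiples ((1, -1) : ℝ × ℝ) : AddSubgroup (ℝ × ℝ)) :
      Set (ℝ × ℝ))
    rw [h]
    exact (Int.isClosedEmbedding_coe_real.isClosed_range.preimage continuous_fst).inter
      (isClosed_eq continuous_snd continuous_fst.neg)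

open scoped Pointwise in
theorem Spacetime.isClosed_translates (X : Spacetime) {K : Set (ℝ × ℝ)} (hK : IsCompact K) :
    IsClosed {x : ℝ × ℝ | ∃ γ ∈ X.deck, x + γ ∈ K} := by
  have h : {x : ℝ × ℝ | ∃ γ ∈ X.deck, x + γ ∈ K} = K + (X.deck : Set (ℝ × ℝ)) := by
    ext x
    rw [Set.mem_add]
    constructor
    · rintro ⟨γ, hγ, hx⟩
      exact ⟨x + γ, hx, -γ, neg_mem hγ, add_neg_cancel_right _ _⟩
    · rintro ⟨k, hk, γ, hγ, rfl⟩
      exact ⟨-γ, neg_mem hγ, by rwa [add_neg_cancel_right]⟩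
  rw [h]
  exact X.isClosed_deck.add_left_of_isCompact hK

theorem IsTest.pd {X : Spacetime} {φ : ℝ × ℝ → ℝ} (h : IsTest X φ) (v : ℝ × ℝ) :
    IsTest X (fun x => fderiv ℝ φ x v) := by
  have hp : ∀ γ ∈ X.deck, ∀ x, fderiv ℝ φ (x + γ) = fderiv ℝ φ x := by
    intro γ hγ x
    rw [← fderiv_comp_add_right]
    congr 1
    exact funext fun y => h.periodic γ hγ y
  obtain ⟨K, hK, h3⟩ := h.compact
  refine ⟨(h.smooth.fderiv_right (m := ∞) (by simp)).clm_apply contDiff_const,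
    fun γ hγ x => by rw [hp γ hγ], K, hK, fun x hx => ?_⟩
  by_contra hc
  have h4 : φ =ᶠ[𝓝 x] fun _ => 0 := by
    filter_upwards [(X.isClosed_translates hK).isOpen_compl.mem_nhds hc] with y hy
    by_contra hy'
    exact hy (h3 y hy')
  rw [h4.fderiv_eq] at hx
  simp at hx

/-- The partial derivative `∂₊`, resp. `∂₋`. -/
noncomputable def pd {X : Spacetime} (s : Chirality) : Test X →ₗ[ℝ] Test X where
  toFun φ := ⟨fun x => fderiv ℝ φ.1 x s.dir, IsTest.pd φ.2 s.dir⟩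
  map_add' φ ψ := Subtype.ext (funext fun x => by
    change fderiv ℝ (φ.1 + ψ.1) x s.dir = fderiv ℝ φ.1 x s.dir + fderiv ℝ ψ.1 x s.dir
    rw [fderiv_add (φ.2.smooth.differentiable (by simp) x)
      (ψ.2.smooth.differentiable (by simp) x)]
    rfl)
  map_smul' c φ := Subtype.ext (funext fun x => by
    change fderiv ℝ (c • φ.1) x s.dir = c * fderiv ℝ φ.1 x s.dir
    rw [fderiv_const_smul (φ.2.smooth.differentiable (by simp) x)]
    rfl)

theorem pd_apply {X : Spacetime} (s : Chirality) (φ : Test X) (x : ℝ × ℝ) :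
    (pd s φ).1 x = fderiv ℝ φ.1 x s.dir := rfl

/-- Compactly supported `1`-forms: `(a, b)` stands for `a dx⁺ + b dx⁻`. -/
abbrev OneForm (X : Spacetime) : Type := Test X × Test X

/-- Compactly supported `2`-forms: `ρ` stands for `ρ dx⁻ ∧ dx⁺`. -/
abbrev TwoForm (X : Spacetime) : Type := Test X

/-- The differential of functions, `dφ = ∂₊φ dx⁺ + ∂₋φ dx⁻`. -/
noncomputable def dZero {X : Spacetime} : Test X →ₗ[ℝ] OneForm X :=
  (pd .plus).prod (pd .minus)

/-- The differential of `1`-forms, `d(a dx⁺ + b dx⁻) = (∂₋a - ∂₊b) dx⁻ ∧ dx⁺`. -/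
noncomputable def dOne {X : Spacetime} : OneForm X →ₗ[ℝ] TwoForm X :=
  (pd .minus).comp (LinearMap.fst ℝ _ _) - (pd .plus).comp (LinearMap.snd ℝ _ _)

/-- The Hodge operator on `1`-forms, `∗(a dx⁺ + b dx⁻) = a dx⁺ - b dx⁻`. -/
noncomputable def hodge {X : Spacetime} : OneForm X →ₗ[ℝ] OneForm X :=
  LinearMap.prodMap LinearMap.id (-LinearMap.id)

theorem dOne_apply {X : Spacetime} (α : OneForm X) (x : ℝ × ℝ) :
    (dOne α).1 x = fderiv ℝ α.1.1 x (0, 1) - fderiv ℝ α.2.1 x (1, 0) := rfl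

theorem pd_comm {X : Spacetime} (φ : Test X) : pd .minus (pd .plus φ) = pd .plus (pd .minus φ) := by
  refine Subtype.ext (funext fun x => ?_)
  have h1 : ContDiff ℝ ∞ φ.1 := φ.2.smooth
  have hd : DifferentiableAt ℝ (fderiv ℝ φ.1) x :=
    (h1.fderiv_right (m := ∞) (by simp)).differentiable (by simp) x
  have h2 : ∀ v w : ℝ × ℝ, fderiv ℝ (fun y => fderiv ℝ φ.1 y v) x w =
      fderiv ℝ (fderiv ℝ φ.1) x w v := by
    intro v w
    rw [fderiv_clm_apply hd (differentiableAt_const v)]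
    simp
  change fderiv ℝ (fun y => fderiv ℝ φ.1 y (1, 0)) x (0, 1) =
    fderiv ℝ (fun y => fderiv ℝ φ.1 y (0, 1)) x (1, 0)
  rw [h2, h2]
  have hs : IsSymmSndFDerivAt ℝ φ.1 x := h1.contDiffAt.isSymmSndFDerivAt (by
    simp only [minSmoothness_of_isRCLikeNormedField]
    exact WithTop.coe_le_coe.2 (le_top : (2 : ℕ∞) ≤ ⊤))
  exact hs.eq _ _

theorem dOne_dZero {X : Spacetime} (φ : Test X) : dOne (dZero φ) = 0 := by
  change pd .minus (pd .plus φ) - pd .plus (pd .minus φ) = 0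
  rw [pd_comm, sub_self]

/-- The wave operator on functions, `P φ = d ∗ d φ`. -/
noncomputable def wave {X : Spacetime} : Test X →ₗ[ℝ] TwoForm X :=
  dOne.comp (hodge.comp dZero)

theorem wave_eq {X : Spacetime} (φ : Test X) : wave φ = (2 : ℝ) • pd .minus (pd .plus φ) := by
  change pd .minus (pd .plus φ) - pd .plus (-(pd .minus φ)) = _
  rw [map_neg, sub_neg_eq_add, pd_comm, two_smul]

/-- The subspace `d C_c^∞(X) + ∗ d C_c^∞(X)` of trivial linear observables. -/
noncomputable def trivialForms (X : Spacetime) : Submodule ℝ (OneForm X) :=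
  LinearMap.range (dZero (X := X)) ⊔ LinearMap.range (hodge.comp (dZero (X := X)))

/-- The vector space of linear observables of the Abelian current on `X`. -/
abbrev LinObs (X : Spacetime) : Type := OneForm X ⧸ trivialForms X

/-! ### Pushforward of forms along morphisms -/

/-- The pushforward of a function along an embedding of spacetimes, extended by zero. -/
noncomputable def pushFun {X Y : Spacetime} (f : X.Pt → Y.Pt) (φ : ℝ × ℝ → ℝ) : ℝ × ℝ → ℝ :=
  fun y => Function.extend (fun x : ℝ × ℝ => f (x : X.Pt)) φ 0 (y : Y.Pt)

namespace IsLift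

variable {X Y : Spacetime} {f : X.Pt → Y.Pt} {hp hm : ℝ → ℝ}

theorem deck_cases {Z : Spacetime} {γ : ℝ × ℝ} (hγ : γ ∈ Z.deck) :
    (Z = .mink ∧ γ = 0) ∨ (Z = .cyl ∧ ∃ n : ℤ, γ = ((n : ℝ), -(n : ℝ))) := by
  cases Z
  · exact Or.inl ⟨rfl, hγ⟩
  · obtain ⟨n, rfl⟩ := AddSubgroup.mem_zmultiples_iff.1 hγ
    exact Or.inr ⟨rfl, n, by simp⟩

theorem deck_mem_cyl (n : ℤ) : ((n : ℝ), -(n : ℝ)) ∈ Spacetime.deck .cyl :=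
  AddSubgroup.mem_zmultiples_iff.2 ⟨n, by simp⟩

/-- A deck transformation relating two image points comes from a deck transformation. -/
theorem inj (H : IsLift f hp hm) {x x' γ : ℝ × ℝ} (hγ : γ ∈ Y.deck)
    (h : (hp x.1, hm x.2) = (hp x'.1, hm x'.2) + γ) : γ = 0 ∧ x = x' ∨ x - x' = γ ∧ γ ∈ X.deck := by
  obtain ⟨x1, x2⟩ := x
  obtain ⟨y1, y2⟩ := x'
  have hP := H.embPlus
  have hM := H.embMinus
  rcases deck_cases hγ with ⟨rfl, rfl⟩ | ⟨rfl, n, rfl⟩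
  · rw [add_zero, Prod.mk.injEq] at h
    exact Or.inl ⟨rfl, Prod.ext (hP.strictMono.injective h.1) (hM.strictMono.injective h.2)⟩
  · rw [Prod.mk_add_mk, Prod.mk.injEq] at h
    obtain ⟨h1, h2⟩ := h
    cases X
    · left
      have h3 := hP.lt_one x1 y1
      have h4 := hP.lt_one y1 x1
      simp only at h1 h2
      have hn : n = 0 := by
        have h5 : (n : ℝ) < 1 := by linarith
        have h6 : (-1 : ℝ) < n := by linarith
        have h7 : n < 1 := by exact_mod_cast h5
        have h8 : -1 < n := by exact_mod_cast h6
        omega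
      subst hn
      simp only [Int.cast_zero, add_zero, neg_zero] at h1 h2
      exact ⟨by simp, Prod.ext (hP.strictMono.injective h1) (hM.strictMono.injective h2)⟩
    · right
      simp only at h1 h2
      rw [← hP.add_int] at h1
      have h3 := hP.strictMono.injective h1
      have h4 : hm x2 = hm (y2 + ((-n : ℤ) : ℝ)) := by
        rw [hM.add_int, h2]
        push_cast
        ring
      have h5 := hM.strictMono.injective h4
      refine ⟨?_, deck_mem_cyl n⟩
      rw [Prod.mk_sub_mk, h3, h5]
      push_cast
      ext <;> simp

/-- Causal convexity: a point in a translate of the image that is causally related to the image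
lies in the image. -/
theorem causal (H : IsLift f hp hm) {x x' γ : ℝ × ℝ} (hγ : γ ∈ Y.deck)
    (h : (hp x'.1, hm x'.2) + γ ≤ (hp x.1, hm x.2) ∨ (hp x.1, hm x.2) ≤ (hp x'.1, hm x'.2) + γ) :
    ∃ z : ℝ × ℝ, (hp x'.1, hm x'.2) + γ = (hp z.1, hm z.2) := by
  obtain ⟨x1, x2⟩ := x
  obtain ⟨y1, y2⟩ := x'
  have hP := H.embPlus
  have hM := H.embMinus
  rcases deck_cases hγ with ⟨rfl, rfl⟩ | ⟨rfl, n, rfl⟩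
  · exact ⟨(y1, y2), add_zero _⟩
  · cases X
    · have h1 := hP.lt_one x1 y1
      have h2 := hP.lt_one y1 x1
      have h3 := hM.lt_one x2 y2
      have h4 := hM.lt_one y2 x2
      simp only [Prod.mk_add_mk, Prod.mk_le_mk] at h
      have hn : n = 0 := by
        have h5 : (n : ℝ) < 1 := by rcases h with ⟨h5, h6⟩ | ⟨h5, h6⟩ <;> linarith
        have h6 : (-1 : ℝ) < n := by rcases h with ⟨h5, h6⟩ | ⟨h5, h6⟩ <;> linarith
        have h7 : n < 1 := by exact_mod_cast h5
        have h8 : -1 < n := by exact_mod_cast h6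
        omega
      subst hn
      exact ⟨(y1, y2), by simp⟩
    · refine ⟨(y1 + n, y2 + ((-n : ℤ) : ℝ)), ?_⟩
      rw [hP.add_int, hM.add_int]
      push_cast
      rfl

theorem coe_inj (H : IsLift f hp hm) {x x' : ℝ × ℝ} (h : f (x : X.Pt) = f (x' : X.Pt)) :
    x - x' ∈ X.deck := by
  rw [H.map_coe, H.map_coe, eq_comm, QuotientAddGroup.eq] at h
  rcases H.inj h (x := x) (x' := x') (by abel) with ⟨_, rfl⟩ | ⟨h2, h3⟩
  · rw [sub_self]
    exact zero_mem _
  · rwa [h2]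

theorem push_apply (H : IsLift f hp hm) {φ : ℝ × ℝ → ℝ}
    (hφ : ∀ γ ∈ X.deck, ∀ x, φ (x + γ) = φ x) (x : ℝ × ℝ) {γ : ℝ × ℝ} (hγ : γ ∈ Y.deck) :
    pushFun f φ ((hp x.1, hm x.2) + γ) = φ x := by
  have h1 : (((hp x.1, hm x.2) + γ : ℝ × ℝ) : Y.Pt) = f (x : X.Pt) := by
    rw [H.map_coe, eq_comm, QuotientAddGroup.eq, neg_add_cancel_left]
    exact hγ
  have h2 : Function.FactorsThrough φ (fun x : ℝ × ℝ => f (x : X.Pt)) := by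
    intro a b hab
    have h3 := hφ _ (H.coe_inj hab) b
    rwa [add_sub_cancel] at h3
  rw [pushFun, h1]
  exact h2.extend_apply 0 x

theorem push_eq_zero (H : IsLift f hp hm) (φ : ℝ × ℝ → ℝ) {y : ℝ × ℝ}
    (hy : ¬ ∃ x : ℝ × ℝ, ∃ γ ∈ Y.deck, y = (hp x.1, hm x.2) + γ) : pushFun f φ y = 0 := by
  rw [pushFun, Function.extend_apply', Pi.zero_apply]
  rintro ⟨x, hx⟩
  rw [H.map_coe, QuotientAddGroup.eq] at hx
  exact hy ⟨x, _, hx, by abel⟩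

theorem push_ne_zero (H : IsLift f hp hm) {φ : ℝ × ℝ → ℝ}
    (hφ : ∀ γ ∈ X.deck, ∀ x, φ (x + γ) = φ x) {y : ℝ × ℝ} (hy : pushFun f φ y ≠ 0) :
    ∃ x : ℝ × ℝ, ∃ γ ∈ Y.deck, y = (hp x.1, hm x.2) + γ ∧ φ x ≠ 0 := by
  by_contra hc
  by_cases h : ∃ x : ℝ × ℝ, ∃ γ ∈ Y.deck, y = (hp x.1, hm x.2) + γ
  · obtain ⟨x, γ, hγ, rfl⟩ := h
    rw [H.push_apply hφ x hγ] at hy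
    exact hc ⟨x, γ, hγ, rfl, hy⟩
  · exact hy (H.push_eq_zero φ h)

theorem push_periodic (f : X.Pt → Y.Pt) (φ : ℝ × ℝ → ℝ) {γ : ℝ × ℝ} (hγ : γ ∈ Y.deck) (y : ℝ × ℝ) :
    pushFun f φ (y + γ) = pushFun f φ y := by
  have h : ((y + γ : ℝ × ℝ) : Y.Pt) = (y : Y.Pt) := by
    rw [eq_comm, QuotientAddGroup.eq]
    simpa using hγ
  rw [pushFun, pushFun, h]

theorem continuous (H : IsLift f hp hm) : Continuous fun x : ℝ × ℝ => (hp x.1, hm x.2) :=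
  (H.embPlus.smooth.continuous.comp continuous_fst).prodMk
    (H.embMinus.smooth.continuous.comp continuous_snd)

/-- The compact set over which the support of a pushforward is contained. -/
theorem push_support (H : IsLift f hp hm) {φ : ℝ × ℝ → ℝ} (hφ : IsTest X φ) :
    ∃ K : Set (ℝ × ℝ), IsCompact K ∧ (∀ y, pushFun f φ y ≠ 0 → ∃ γ ∈ Y.deck, y + γ ∈ K) ∧
      ∀ y ∈ K, ∃ x : ℝ × ℝ, y = (hp x.1, hm x.2) := by
  obtain ⟨K, hK, h⟩ := hφ.compact
  refine ⟨(fun x : ℝ × ℝ => (hp x.1, hm x.2)) '' K, hK.image H.continuous, fun y hy => ?_, ?_⟩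
  · obtain ⟨x, γ, hγ, rfl, hx⟩ := H.push_ne_zero hφ.periodic hy
    obtain ⟨δ, hδ, hxδ⟩ := h x hx
    have h1 : f ((x + δ : ℝ × ℝ) : X.Pt) = f (x : X.Pt) := by
      congr 1
      rw [eq_comm, QuotientAddGroup.eq]
      simpa using hδ
    rw [H.map_coe, H.map_coe, eq_comm, QuotientAddGroup.eq] at h1
    refine ⟨-γ + (-(hp x.1, hm x.2) + (hp (x + δ).1, hm (x + δ).2)),
      add_mem (neg_mem hγ) h1, x + δ, hxδ, ?_⟩
    abel
  · rintro _ ⟨x, _, rfl⟩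
    exact ⟨x, rfl⟩

theorem push_eventually_zero (H : IsLift f hp hm) {φ : ℝ × ℝ → ℝ} (hφ : IsTest X φ) {y : ℝ × ℝ}
    (hy : ¬ ∃ x : ℝ × ℝ, ∃ γ ∈ Y.deck, y = (hp x.1, hm x.2) + γ) : pushFun f φ =ᶠ[𝓝 y] fun _ => 0 := by
  obtain ⟨K, hK, h1, h2⟩ := H.push_support hφ
  have h3 : y ∈ {x : ℝ × ℝ | ∃ γ ∈ Y.deck, x + γ ∈ K}ᶜ := by
    rintro ⟨γ, hγ, hyγ⟩
    obtain ⟨x, hx⟩ := h2 _ hyγ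
    exact hy ⟨x, -γ, neg_mem hγ, by rw [← hx, add_neg_cancel_right]⟩
  filter_upwards [(Y.isClosed_translates hK).isOpen_compl.mem_nhds h3] with z hz
  by_contra hz'
  exact hz (h1 z hz')

theorem local_inverse {N N' : Curve} {h : ℝ → ℝ} (H : IsEmbLift N N' h) (t : ℝ) :
    ∃ g : ℝ → ℝ, ContDiffAt ℝ ∞ g (h t) ∧ ∀ᶠ u in 𝓝 (h t), h (g u) = u := by
  have hc : ContDiffAt ℝ ∞ h t := H.smooth.contDiffAt
  have h2 : HasFDerivAt h ((ContinuousLinearEquiv.unitsEquivAut ℝ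
      (Units.mk0 (deriv h t) (H.deriv_pos t).ne') : ℝ ≃L[ℝ] ℝ) : ℝ →L[ℝ] ℝ) t := 
    (H.hasDerivAt t).hasFDerivAt_equiv (H.deriv_pos t).ne'
  exact ⟨hc.localInverse h2 (by simp), hc.to_localInverse h2 (by simp),
    (hc.hasStrictFDerivAt' h2 (by simp)).eventually_right_inverse⟩

theorem isTest_push (H : IsLift f hp hm) {φ : ℝ × ℝ → ℝ} (hφ : IsTest X φ) :
    IsTest Y (pushFun f φ) := by
  refine ⟨?_, fun γ hγ y => push_periodic f φ hγ y, ?_⟩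
  · rw [contDiff_iff_contDiffAt]
    intro y
    by_cases hy : ∃ x : ℝ × ℝ, ∃ γ ∈ Y.deck, y = (hp x.1, hm x.2) + γ
    · obtain ⟨x, γ, hγ, rfl⟩ := hy
      obtain ⟨g, hg, hg'⟩ := local_inverse H.embPlus x.1
      obtain ⟨k, hk, hk'⟩ := local_inverse H.embMinus x.2
      set y : ℝ × ℝ := (hp x.1, hm x.2) + γ with hy
      have e1 : (y - γ).1 = hp x.1 := by simp [hy]
      have e2 : (y - γ).2 = hm x.2 := by simp [hy]
      have c1 : ContDiffAt ℝ ∞ (fun z : ℝ × ℝ => (z - γ).1) y :=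
        (contDiff_fst.comp (contDiff_id.sub contDiff_const)).contDiffAt
      have c2 : ContDiffAt ℝ ∞ (fun z : ℝ × ℝ => (z - γ).2) y :=
        (contDiff_snd.comp (contDiff_id.sub contDiff_const)).contDiffAt
      have d1 : ContDiffAt ℝ ∞ (fun z : ℝ × ℝ => g (z - γ).1) y := by
        refine ContDiffAt.comp y ?_ c1
        rwa [e1]
      have d2 : ContDiffAt ℝ ∞ (fun z : ℝ × ℝ => k (z - γ).2) y := by
        refine ContDiffAt.comp y ?_ c2
        rwa [e2]
      have d3 : ContDiffAt ℝ ∞ (fun z : ℝ × ℝ => φ (g (z - γ).1, k (z - γ).2)) y :=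
        hφ.smooth.contDiffAt.comp y (d1.prodMk d2)
      refine d3.congr_of_eventuallyEq ?_
      have t1 := c1.continuousAt.tendsto
      have t2 := c2.continuousAt.tendsto
      rw [e1] at t1
      rw [e2] at t2
      filter_upwards [t1.eventually hg', t2.eventually hk'] with z hz1 hz2
      have h5 := H.push_apply hφ.periodic (g (z - γ).1, k (z - γ).2) hγ
      simp only [hz1, hz2] at h5
      rw [← h5]
      congr 1
      rw [Prod.mk.eta, sub_add_cancel]
    · exact contDiffAt_const.congr_of_eventuallyEq (H.push_eventually_zero hφ hy)
  · obtain ⟨K, hK, h1, _⟩ := H.push_support hφ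
    exact ⟨K, hK, h1⟩

end IsLift

/-- The factor `1 / (h⁺)'`, resp. `1 / (h⁻)'`, by which the coefficient of `dx⁺`, resp. `dx⁻`, is
multiplied under pushforward along `(h⁺, h⁻)`. -/
noncomputable def weight (hp hm : ℝ → ℝ) : Chirality → ℝ × ℝ → ℝ
  | .plus => fun x => (deriv hp x.1)⁻¹
  | .minus => fun x => (deriv hm x.2)⁻¹

theorem IsEmbLift.contDiff_deriv {N N' : Curve} {h : ℝ → ℝ} (H : IsEmbLift N N' h) :
    ContDiff ℝ ∞ (deriv h) :=
  (contDiff_infty_iff_deriv.1 H.smooth).2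

theorem IsEmbLift.deriv_add_int {N : Curve} {h : ℝ → ℝ} (H : IsEmbLift .circle N h) (t : ℝ)
    (n : ℤ) : deriv h (t + n) = deriv h t := by
  cases N
  · exact H.compat.elim
  · rw [← deriv_comp_add_const]
    have h1 : (fun x => h (x + n)) = fun x => h x + n := funext fun x => H.add_int x n
    rw [h1, deriv_add_const]

namespace IsLift

variable {X Y Z : Spacetime} {f : X.Pt → Y.Pt} {hp hm kp km : ℝ → ℝ} {g : Y.Pt → Z.Pt}

theorem weight_smooth (H : IsLift f hp hm) (s : Chirality) : ContDiff ℝ ∞ (weight hp hm s) := by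
  cases s
  · exact (H.embPlus.contDiff_deriv.comp contDiff_fst).inv fun x => (H.embPlus.deriv_pos _).ne'
  · exact (H.embMinus.contDiff_deriv.comp contDiff_snd).inv fun x => (H.embMinus.deriv_pos _).ne'

theorem weight_periodic (H : IsLift f hp hm) (s : Chirality) :
    ∀ γ ∈ X.deck, ∀ x, weight hp hm s (x + γ) = weight hp hm s x := by
  intro γ hγ x
  rcases deck_cases hγ with ⟨rfl, rfl⟩ | ⟨rfl, n, rfl⟩
  · rw [add_zero]
  · cases s
    · exact congrArg (·⁻¹) (H.embPlus.deriv_add_int x.1 n)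
    · have h1 := H.embMinus.deriv_add_int x.2 (-n)
      rw [Int.cast_neg] at h1
      exact congrArg (·⁻¹) h1

theorem pushFun_add (H : IsLift f hp hm) {φ ψ : ℝ × ℝ → ℝ}
    (hφ : ∀ γ ∈ X.deck, ∀ x, φ (x + γ) = φ x) (hψ : ∀ γ ∈ X.deck, ∀ x, ψ (x + γ) = ψ x) :
    pushFun f (fun x => φ x + ψ x) = fun y => pushFun f φ y + pushFun f ψ y := by
  funext y
  by_cases hy : ∃ x : ℝ × ℝ, ∃ γ ∈ Y.deck, y = (hp x.1, hm x.2) + γ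
  · obtain ⟨x, γ, hγ, rfl⟩ := hy
    rw [H.push_apply hφ x hγ, H.push_apply hψ x hγ,
      H.push_apply (fun γ hγ x => by rw [hφ γ hγ, hψ γ hγ]) x hγ]
  · rw [H.push_eq_zero _ hy, H.push_eq_zero _ hy, H.push_eq_zero _ hy, add_zero]

theorem pushFun_smul (H : IsLift f hp hm) {φ : ℝ × ℝ → ℝ} (c : ℝ)
    (hφ : ∀ γ ∈ X.deck, ∀ x, φ (x + γ) = φ x) :
    pushFun f (fun x => c * φ x) = fun y => c * pushFun f φ y := by
  funext y
  by_cases hy : ∃ x : ℝ × ℝ, ∃ γ ∈ Y.deck, y = (hp x.1, hm x.2) + γ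
  · obtain ⟨x, γ, hγ, rfl⟩ := hy
    rw [H.push_apply hφ x hγ, H.push_apply (fun γ hγ x => by rw [hφ γ hγ]) x hγ]
  · rw [H.push_eq_zero _ hy, H.push_eq_zero _ hy, mul_zero]

/-- Pushforward of test functions after multiplication by a smooth function `w`. -/
noncomputable def pushTest (H : IsLift f hp hm) (w : ℝ × ℝ → ℝ) (hw : ContDiff ℝ ∞ w)
    (hp' : ∀ γ ∈ X.deck, ∀ x, w (x + γ) = w x) : Test X →ₗ[ℝ] Test Y where
  toFun φ := ⟨pushFun f fun x => φ.1 x * w x, H.isTest_push (IsTest.mul φ.2 hw hp')⟩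
  map_add' φ ψ := Subtype.ext (by
    have h := H.pushFun_add (φ := fun x => φ.1 x * w x) (ψ := fun x => ψ.1 x * w x)
      (IsTest.mul φ.2 hw hp').periodic (IsTest.mul ψ.2 hw hp').periodic
    refine Eq.trans ?_ h
    change pushFun f (fun x => (φ.1 x + ψ.1 x) * w x) = _
    refine congrArg (pushFun f) (funext fun x => ?_)
    exact add_mul (φ.1 x) (ψ.1 x) (w x))
  map_smul' c φ := Subtype.ext (by
    have h := H.pushFun_smul (φ := fun x => φ.1 x * w x) c (IsTest.mul φ.2 hw hp').periodic
    refine Eq.trans ?_ h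
    change pushFun f (fun x => (c * φ.1 x) * w x) = _
    refine congrArg (pushFun f) (funext fun x => ?_)
    exact mul_assoc c (φ.1 x) (w x))

theorem test_ext (_ : IsLift f hp hm) {φ ψ : Test Y}
    (h0 : ∀ y, (¬ ∃ x : ℝ × ℝ, ∃ γ ∈ Y.deck, y = (hp x.1, hm x.2) + γ) → φ.1 y = ψ.1 y)
    (h1 : ∀ x : ℝ × ℝ, φ.1 (hp x.1, hm x.2) = ψ.1 (hp x.1, hm x.2)) : φ = ψ := by
  refine Subtype.ext (funext fun y => ?_)
  by_cases hy : ∃ x : ℝ × ℝ, ∃ γ ∈ Y.deck, y = (hp x.1, hm x.2) + γ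
  · obtain ⟨x, γ, hγ, rfl⟩ := hy
    rw [IsTest.periodic φ.2 γ hγ, IsTest.periodic ψ.2 γ hγ, h1]
  · exact h0 y hy

theorem pushTest_apply (H : IsLift f hp hm) {w : ℝ × ℝ → ℝ} (hw : ContDiff ℝ ∞ w)
    (hp' : ∀ γ ∈ X.deck, ∀ x, w (x + γ) = w x) (φ : Test X) (x : ℝ × ℝ) :
    (H.pushTest w hw hp' φ).1 (hp x.1, hm x.2) = φ.1 x * w x := by
  have h := H.push_apply (φ := fun x => φ.1 x * w x) (IsTest.mul φ.2 hw hp').periodic x (zero_mem Y.deck)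
  rwa [add_zero] at h

theorem pushTest_eventually (H : IsLift f hp hm) {w : ℝ × ℝ → ℝ} (hw : ContDiff ℝ ∞ w)
    (hp' : ∀ γ ∈ X.deck, ∀ x, w (x + γ) = w x) (φ : Test X) {y : ℝ × ℝ}
    (hy : ¬ ∃ x : ℝ × ℝ, ∃ γ ∈ Y.deck, y = (hp x.1, hm x.2) + γ) :
    (H.pushTest w hw hp' φ).1 =ᶠ[𝓝 y] fun _ => 0 :=
  H.push_eventually_zero (IsTest.mul φ.2 hw hp') hy

/-- Pushforward of functions. -/
noncomputable def pushZero (H : IsLift f hp hm) : Test X →ₗ[ℝ] Test Y :=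
  H.pushTest (fun _ => 1) contDiff_const fun _ _ _ => rfl

/-- Pushforward of the coefficient of `dx⁺`, resp. `dx⁻`. -/
noncomputable def pushCoeff (H : IsLift f hp hm) (s : Chirality) : Test X →ₗ[ℝ] Test Y :=
  H.pushTest (weight hp hm s) (H.weight_smooth s) (H.weight_periodic s)

/-- Pushforward of `1`-forms along the embedding with lift `(h⁺, h⁻)`, extended by zero. -/
noncomputable def pushOne (H : IsLift f hp hm) : OneForm X →ₗ[ℝ] OneForm Y :=
  LinearMap.prodMap (H.pushCoeff .plus) (H.pushCoeff .minus)

/-- Pushforward of `2`-forms. -/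
noncomputable def pushTwo (H : IsLift f hp hm) : TwoForm X →ₗ[ℝ] TwoForm Y :=
  H.pushTest (fun x => weight hp hm .plus x * weight hp hm .minus x)
    ((H.weight_smooth .plus).mul (H.weight_smooth .minus)) fun γ hγ x => by
      rw [H.weight_periodic .plus γ hγ, H.weight_periodic .minus γ hγ]

theorem hasFDerivAt (H : IsLift f hp hm) (x : ℝ × ℝ) :
    HasFDerivAt (fun x : ℝ × ℝ => (hp x.1, hm x.2))
      ((deriv hp x.1 • ContinuousLinearMap.fst ℝ ℝ ℝ).prod
        (deriv hm x.2 • ContinuousLinearMap.snd ℝ ℝ ℝ)) x :=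
  ((H.embPlus.hasDerivAt x.1).comp_hasFDerivAt x hasFDerivAt_fst).prodMk
    ((H.embMinus.hasDerivAt x.2).comp_hasFDerivAt x hasFDerivAt_snd)

/-- The chain rule for pushforwards. -/
theorem pd_pushTest (H : IsLift f hp hm) {w : ℝ × ℝ → ℝ} (hw : ContDiff ℝ ∞ w)
    (hp' : ∀ γ ∈ X.deck, ∀ x, w (x + γ) = w x) (φ : Test X) (s : Chirality) (x : ℝ × ℝ) :
    (pd s (H.pushTest w hw hp' φ)).1 (hp x.1, hm x.2) =
      fderiv ℝ (fun z => φ.1 z * w z) x s.dir * weight hp hm s x := by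
  set ψ := H.pushTest w hw hp' φ with hψ
  have h1 : (fun z : ℝ × ℝ => φ.1 z * w z) = ψ.1 ∘ fun z : ℝ × ℝ => (hp z.1, hm z.2) :=
    funext fun z => (H.pushTest_apply hw hp' φ z).symm
  have h2 : DifferentiableAt ℝ ψ.1 (hp x.1, hm x.2) :=
    (IsTest.smooth ψ.2).differentiable (by simp) _
  rw [pd_apply, h1, (h2.hasFDerivAt.comp x (H.hasFDerivAt x)).fderiv,
    ContinuousLinearMap.comp_apply]
  cases s
  · have h3 : ((deriv hp x.1 • ContinuousLinearMap.fst ℝ ℝ ℝ).prod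
        (deriv hm x.2 • ContinuousLinearMap.snd ℝ ℝ ℝ)) (Chirality.dir .plus) =
        deriv hp x.1 • Chirality.dir .plus := by
      simp [Chirality.dir]
    rw [h3, map_smul, weight, smul_eq_mul]
    have := (H.embPlus.deriv_pos x.1).ne'
    field_simp
  · have h3 : ((deriv hp x.1 • ContinuousLinearMap.fst ℝ ℝ ℝ).prod
        (deriv hm x.2 • ContinuousLinearMap.snd ℝ ℝ ℝ)) (Chirality.dir .minus) =
        deriv hm x.2 • Chirality.dir .minus := by
      simp [Chirality.dir]
    rw [h3, map_smul, weight, smul_eq_mul]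
    have := (H.embMinus.deriv_pos x.2).ne'
    field_simp

theorem pd_pushTest_zero (H : IsLift f hp hm) {w : ℝ × ℝ → ℝ} (hw : ContDiff ℝ ∞ w)
    (hp' : ∀ γ ∈ X.deck, ∀ x, w (x + γ) = w x) (φ : Test X) (s : Chirality) {y : ℝ × ℝ}
    (hy : ¬ ∃ x : ℝ × ℝ, ∃ γ ∈ Y.deck, y = (hp x.1, hm x.2) + γ) :
    (pd s (H.pushTest w hw hp' φ)).1 y = 0 := by
  rw [pd_apply, (H.pushTest_eventually hw hp' φ hy).fderiv_eq]
  simp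

theorem dZero_push (H : IsLift f hp hm) (φ : Test X) :
    dZero (H.pushZero φ) = H.pushOne (dZero φ) := by
  have key : ∀ s, pd s (H.pushZero φ) =
      H.pushTest (weight hp hm s) (H.weight_smooth s) (H.weight_periodic s) (pd s φ) := by
    intro s
    refine H.test_ext (fun y hy => ?_) fun x => ?_
    · rw [pushZero, H.pd_pushTest_zero _ _ φ s hy]
      exact ((H.pushTest_eventually _ _ (pd s φ) hy).eq_of_nhds).symm
    · rw [pushZero, H.pd_pushTest, H.pushTest_apply, pd_apply]
      simp only [mul_one]
  exact Prod.ext (key .plus) (key .minus)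

theorem hodge_push (H : IsLift f hp hm) (α : OneForm X) :
    hodge (H.pushOne α) = H.pushOne (hodge α) := by
  refine Prod.ext rfl ?_
  change -(H.pushCoeff .minus α.2) = H.pushCoeff .minus (-α.2)
  rw [map_neg]

theorem fderiv_mul_weight (H : IsLift f hp hm) (φ : Test X) (x : ℝ × ℝ) :
    fderiv ℝ (fun z => φ.1 z * weight hp hm .plus z) x (0, 1) =
        fderiv ℝ φ.1 x (0, 1) * weight hp hm .plus x ∧
      fderiv ℝ (fun z => φ.1 z * weight hp hm .minus z) x (1, 0) =
        fderiv ℝ φ.1 x (1, 0) * weight hp hm .minus x := by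
  have h1 : DifferentiableAt ℝ φ.1 x := (IsTest.smooth φ.2).differentiable (by simp) _
  have h2 : ∀ s, DifferentiableAt ℝ (weight hp hm s) x := fun s =>
    (H.weight_smooth s).differentiable (by simp) _
  have h3 : fderiv ℝ (weight hp hm .plus) x (0, 1) = 0 := by
    have d := (((contDiff_infty_iff_deriv.1 H.embPlus.smooth).2.inv
      fun t => (H.embPlus.deriv_pos t).ne').differentiable (by simp) x.1).hasDerivAt
    have e := d.comp_hasFDerivAt x (hasFDerivAt_fst (𝕜 := ℝ) (E := ℝ) (F := ℝ))
    have e' : fderiv ℝ (weight hp hm .plus) x = _ := e.fderiv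
    rw [e']
    simp
  have h4 : fderiv ℝ (weight hp hm .minus) x (1, 0) = 0 := by
    have d := (((contDiff_infty_iff_deriv.1 H.embMinus.smooth).2.inv
      fun t => (H.embMinus.deriv_pos t).ne').differentiable (by simp) x.2).hasDerivAt
    have e := d.comp_hasFDerivAt x (hasFDerivAt_snd (𝕜 := ℝ) (E := ℝ) (F := ℝ))
    have e' : fderiv ℝ (weight hp hm .minus) x = _ := e.fderiv
    rw [e']
    simp
  constructor
  · rw [fderiv_fun_mul h1 (h2 .plus)]
    simp [h3, mul_comm]
  · rw [fderiv_fun_mul h1 (h2 .minus)]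
    simp [h4, mul_comm]

theorem dOne_push (H : IsLift f hp hm) (α : OneForm X) :
    dOne (H.pushOne α) = H.pushTwo (dOne α) := by
  refine H.test_ext (fun y hy => ?_) fun x => ?_
  · have h1 := H.pd_pushTest_zero (H.weight_smooth .plus) (H.weight_periodic .plus) α.1 .minus hy
    have h2 := H.pd_pushTest_zero (H.weight_smooth .minus) (H.weight_periodic .minus) α.2 .plus hy
    have h3 : (H.pushTwo (dOne α)).1 y = 0 := (H.pushTest_eventually _ _ (dOne α) hy).eq_of_nhds
    rw [h3]
    change (pd .minus (H.pushCoeff .plus α.1)).1 y - (pd .plus (H.pushCoeff .minus α.2)).1 y = 0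
    rw [pushCoeff, pushCoeff, h1, h2, sub_zero]
  · have h1 := H.pd_pushTest (H.weight_smooth .plus) (H.weight_periodic .plus) α.1 .minus x
    have h2 := H.pd_pushTest (H.weight_smooth .minus) (H.weight_periodic .minus) α.2 .plus x
    rw [pushTwo, H.pushTest_apply, dOne_apply]
    change (pd .minus (H.pushCoeff .plus α.1)).1 _ - (pd .plus (H.pushCoeff .minus α.2)).1 _ = _
    rw [pushCoeff, pushCoeff, h1, h2]
    change fderiv ℝ (fun z => α.1.1 z * weight hp hm .plus z) x (0, 1) * _ -
      fderiv ℝ (fun z => α.2.1 z * weight hp hm .minus z) x (1, 0) * _ = _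
    rw [(H.fderiv_mul_weight α.1 x).1, (H.fderiv_mul_weight α.2 x).2, dOne_apply]
    ring

theorem pushOne_trivial (H : IsLift f hp hm) :
    trivialForms X ≤ (trivialForms Y).comap H.pushOne := by
  refine sup_le ?_ ?_
  · rintro _ ⟨φ, rfl⟩
    exact Submodule.mem_sup_left ⟨H.pushZero φ, H.dZero_push φ⟩
  · rintro _ ⟨φ, rfl⟩
    refine Submodule.mem_sup_right ⟨H.pushZero φ, ?_⟩
    change hodge (dZero (H.pushZero φ)) = H.pushOne (hodge (dZero φ))
    rw [H.dZero_push, H.hodge_push]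

theorem deriv_eq_of_int {h k : ℝ → ℝ} (hh : Differentiable ℝ h) (hk : Differentiable ℝ k)
    (hi : ∀ t, ∃ n : ℤ, k t - h t = n) : deriv h = deriv k := by
  funext t
  have hc : Continuous fun u => k u - h u := hk.continuous.sub hh.continuous
  have he : ∀ᶠ u in 𝓝 t, dist (k u - h u) (k t - h t) < 1 :=
    hc.continuousAt.eventually (Metric.ball_mem_nhds _ one_pos)
  have he' : h =ᶠ[𝓝 t] fun u => k u - (k t - h t) := by
    filter_upwards [he] with u hu
    obtain ⟨m, hm⟩ := hi u
    obtain ⟨n, hn⟩ := hi t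
    rw [hm, hn, Real.dist_eq] at hu
    have h1 : |m - n| < 1 := by exact_mod_cast hu
    have h2 : m = n := by
      have := Int.abs_lt_one_iff.1 h1
      omega
    rw [hn, ← h2, ← hm]
    ring
  rw [he'.deriv_eq, deriv_sub_const]

/-- The weights, hence the pushforward of forms, do not depend on the lift. -/
theorem weight_unique (H : IsLift f hp hm) (K : IsLift f kp km) :
    weight hp hm = weight kp km := by
  have h : ∀ x : ℝ × ℝ, ∃ n m : ℤ, kp x.1 - hp x.1 = n ∧ km x.2 - hm x.2 = m := by
    intro x
    have h1 : (((hp x.1, hm x.2) : ℝ × ℝ) : Y.Pt) = ((kp x.1, km x.2) : ℝ × ℝ) := by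
      rw [← H.map_coe, ← K.map_coe]
    rw [QuotientAddGroup.eq] at h1
    rcases deck_cases h1 with ⟨-, h2⟩ | ⟨-, n, h2⟩
    · refine ⟨0, 0, ?_⟩
      simp only [Prod.neg_mk, Prod.mk_add_mk, Prod.mk_eq_zero] at h2
      push_cast
      constructor <;> linarith [h2.1, h2.2]
    · refine ⟨n, -n, ?_⟩
      simp only [Prod.neg_mk, Prod.mk_add_mk, Prod.mk.injEq] at h2
      push_cast
      constructor <;> linarith [h2.1, h2.2]
  have hP : deriv hp = deriv kp :=
    deriv_eq_of_int (H.embPlus.smooth.differentiable (by simp))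
      (K.embPlus.smooth.differentiable (by simp)) fun t => by
        obtain ⟨n, _, hn, _⟩ := h (t, t)
        exact ⟨n, hn⟩
  have hM : deriv hm = deriv km :=
    deriv_eq_of_int (H.embMinus.smooth.differentiable (by simp))
      (K.embMinus.smooth.differentiable (by simp)) fun t => by
        obtain ⟨_, n, _, hn⟩ := h (t, t)
        exact ⟨n, hn⟩
  funext s x
  cases s
  · simp only [weight, hP]
  · simp only [weight, hM]

theorem pushOne_unique (H : IsLift f hp hm) (K : IsLift f kp km) : H.pushOne = K.pushOne := by
  have h := H.weight_unique K
  refine LinearMap.ext fun α => Prod.ext (Subtype.ext ?_) (Subtype.ext ?_)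
  · change pushFun f (fun x => α.1.1 x * weight hp hm .plus x) =
      pushFun f (fun x => α.1.1 x * weight kp km .plus x)
    rw [h]
  · change pushFun f (fun x => α.2.1 x * weight hp hm .minus x) =
      pushFun f (fun x => α.2.1 x * weight kp km .minus x)
    rw [h]

theorem comp (K : IsLift g kp km) (H : IsLift f hp hm) :
    IsLift (fun p => g (f p)) (fun t => kp (hp t)) (fun t => km (hm t)) :=
  ⟨K.embPlus.comp H.embPlus, K.embMinus.comp H.embMinus, fun x => by rw [H.map_coe, K.map_coe]⟩

theorem weight_comp (K : IsLift g kp km) (H : IsLift f hp hm) (s : Chirality) (x : ℝ × ℝ) :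
    weight (fun t => kp (hp t)) (fun t => km (hm t)) s x =
      weight hp hm s x * weight kp km s (hp x.1, hm x.2) := by
  cases s
  · simp only [weight]
    rw [K.embPlus.deriv_comp H.embPlus, mul_inv, mul_comm]
  · simp only [weight]
    rw [K.embMinus.deriv_comp H.embMinus, mul_inv, mul_comm]

theorem pushTest_comp (K : IsLift g kp km) (H : IsLift f hp hm) (s : Chirality) (φ : Test X) :
    (K.comp H).pushTest (weight (fun t => kp (hp t)) (fun t => km (hm t)) s)
        ((K.comp H).weight_smooth s) ((K.comp H).weight_periodic s) φ =
      K.pushTest (weight kp km s) (K.weight_smooth s) (K.weight_periodic s)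
        (H.pushTest (weight hp hm s) (H.weight_smooth s) (H.weight_periodic s) φ) := by
  refine K.test_ext (fun y hy => ?_) fun z => ?_
  · rw [(K.pushTest_eventually _ _ _ hy).eq_of_nhds]
    refine ((K.comp H).pushTest_eventually _ _ φ ?_).eq_of_nhds
    rintro ⟨x, γ, hγ, rfl⟩
    exact hy ⟨(hp x.1, hm x.2), γ, hγ, rfl⟩
  · rw [K.pushTest_apply]
    by_cases hz : ∃ x : ℝ × ℝ, ∃ γ ∈ Y.deck, z = (hp x.1, hm x.2) + γ
    · obtain ⟨x, γ, hγ, rfl⟩ := hz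
      have h1 := K.weight_periodic s γ hγ (hp x.1, hm x.2)
      have h2 := IsTest.periodic (H.pushTest (weight hp hm s) (H.weight_smooth s)
        (H.weight_periodic s) φ).2 γ hγ (hp x.1, hm x.2)
      have h4 : g (((hp x.1, hm x.2) + γ : ℝ × ℝ) : Y.Pt) =
          g (((hp x.1, hm x.2) : ℝ × ℝ) : Y.Pt) := by
        congr 1
        rw [eq_comm, QuotientAddGroup.eq, neg_add_cancel_left]
        exact hγ
      rw [K.map_coe, K.map_coe, eq_comm, QuotientAddGroup.eq] at h4
      have h5 := IsTest.periodic ((K.comp H).pushTest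
        (weight (fun t => kp (hp t)) (fun t => km (hm t)) s)
        ((K.comp H).weight_smooth s) ((K.comp H).weight_periodic s) φ).2 _ h4
        (kp (hp x.1), km (hm x.2))
      rw [add_neg_cancel_left] at h5
      rw [h1, h2, h5, H.pushTest_apply, (K.comp H).pushTest_apply, K.weight_comp H, mul_assoc]
    · rw [(H.pushTest_eventually _ _ _ hz).eq_of_nhds, zero_mul]
      by_cases hz' : ∃ x : ℝ × ℝ, ∃ γ ∈ Z.deck,
          ((kp z.1, km z.2) : ℝ × ℝ) = (kp (hp x.1), km (hm x.2)) + γ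
      · obtain ⟨x, γ, hγ, h1⟩ := hz'
        exfalso
        rcases K.inj (x := z) (x' := (hp x.1, hm x.2)) hγ h1 with ⟨-, h2⟩ | ⟨h2, h3⟩
        · exact hz ⟨x, 0, zero_mem _, by rw [h2, add_zero]⟩
        · exact hz ⟨x, γ, h3, by rw [← h2, add_sub_cancel]⟩
      · exact ((K.comp H).pushTest_eventually _ _ φ hz').eq_of_nhds

theorem pushOne_comp (K : IsLift g kp km) (H : IsLift f hp hm) (α : OneForm X) :
    (K.comp H).pushOne α = K.pushOne (H.pushOne α) :=
  Prod.ext (K.pushTest_comp H .plus α.1) (K.pushTest_comp H .minus α.2)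

theorem refl (X : Spacetime) : IsLift (fun p : X.Pt => p) (fun t => t) (fun t => t) :=
  ⟨IsEmbLift.id _, IsEmbLift.id _, fun _ => rfl⟩

theorem pushOne_refl (α : OneForm X) : (refl X).pushOne α = α := by
  have key : ∀ s (φ : Test X), (refl X).pushTest (weight (fun t => t) (fun t => t) s)
      ((refl X).weight_smooth s) ((refl X).weight_periodic s) φ = φ := by
    intro s φ
    refine (refl X).test_ext (fun y hy => (hy ⟨y, 0, zero_mem _, by simp⟩).elim) fun x => ?_
    rw [(refl X).pushTest_apply]
    cases s <;> simp [weight]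
  exact Prod.ext (key .plus α.1) (key .minus α.2)

end IsLift

/-- The linear map of linear observables induced by a morphism of spacetimes: the pushforward of
forms. -/
noncomputable def linObsMap {X Y : Spacetime} (f : X ⟶ Y) : LinObs X →ₗ[ℝ] LinObs Y :=
  Submodule.mapQ _ _ (IsLift.pushOne f.2.choose_spec.choose_spec)
    (IsLift.pushOne_trivial f.2.choose_spec.choose_spec)

theorem linObsMap_mk {X Y : Spacetime} (f : X ⟶ Y) {hp hm : ℝ → ℝ} (H : IsLift f.1 hp hm)
    (α : OneForm X) :
    linObsMap f (Submodule.Quotient.mk α) = Submodule.Quotient.mk (H.pushOne α) := by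
  rw [linObsMap, Submodule.mapQ_apply, IsLift.pushOne_unique _ H]

theorem linObsMap_id (X : Spacetime) (v : LinObs X) : linObsMap (𝟙 X) v = v := by
  obtain ⟨α, rfl⟩ := Submodule.Quotient.mk_surjective _ v
  rw [linObsMap_mk (𝟙 X) (IsLift.refl X), IsLift.pushOne_refl]

theorem linObsMap_comp {X Y Z : Spacetime} (f : X ⟶ Y) (g : Y ⟶ Z) (v : LinObs X) :
    linObsMap (f ≫ g) v = linObsMap g (linObsMap f v) := by
  obtain ⟨α, rfl⟩ := Submodule.Quotient.mk_surjective _ v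
  obtain ⟨hp, hm, H⟩ := f.2
  obtain ⟨kp, km, K⟩ := g.2
  rw [linObsMap_mk f H, linObsMap_mk g K, ← IsLift.pushOne_comp]
  exact linObsMap_mk (f ≫ g) (K.comp H) α

/-! ### Causal propagator and Poisson structure -/

/-- A fundamental domain for the action of the deck group. -/
def Spacetime.fundDom : Spacetime → Set (ℝ × ℝ)
  | .mink => Set.univ
  | .cyl => {x | 0 ≤ x.1 ∧ x.1 < 1}

/-- The integral of (the `2`-form with coefficient) `ρ` over the spacetime `X`. -/
noncomputable def integralOver (X : Spacetime) (ρ : ℝ × ℝ → ℝ) : ℝ := ∫ x in X.fundDom, ρ x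

/-- The retarded Green operator `G⁺` of the wave operator `P = d ∗ d`, for which
`P φ = 2 ∂₋∂₊φ dx⁻ ∧ dx⁺`: the integral of half the source over the causal past. (The product order
on `ℝ × ℝ` is the causal order in light-cone coordinates. On the cylinder the source is integrated
over the causal past in the universal cover.) -/
noncomputable def greenRet (σ : ℝ × ℝ → ℝ) (x : ℝ × ℝ) : ℝ := (1 / 2) * ∫ y in Set.Iic x, σ y

/-- The advanced Green operator `G⁻` of the wave operator: the integral of half the source over the
causal future. -/
noncomputable def greenAdv (σ : ℝ × ℝ → ℝ) (x : ℝ × ℝ) : ℝ := (1 / 2) * ∫ y in Set.Ici x, σ y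

/-- The causal propagator `G = G⁺ - G⁻` of the wave operator. -/
noncomputable def causalProp (σ : ℝ × ℝ → ℝ) (x : ℝ × ℝ) : ℝ := greenRet σ x - greenAdv σ x

theorem Test.bound {X : Spacetime} (φ : Test X) :
    ∃ R, ∀ x : ℝ × ℝ, φ.1 x ≠ 0 → |x.1 + x.2| ≤ R ∧ (X = .mink → ‖x‖ ≤ R) := by
  obtain ⟨K, hK, h⟩ := IsTest.compact φ.2
  obtain ⟨R, hR⟩ := hK.isBounded.exists_norm_le
  refine ⟨R + R, fun x hx => ?_⟩
  obtain ⟨γ, hγ, hx'⟩ := h x hx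
  have h1 := hR _ hx'
  rcases IsLift.deck_cases hγ with ⟨rfl, rfl⟩ | ⟨rfl, n, rfl⟩
  · rw [add_zero] at h1
    have h2 := norm_fst_le x
    have h3 := norm_snd_le x
    have h4 := norm_nonneg x
    refine ⟨(abs_add_le _ _).trans ?_, fun _ => by linarith⟩
    rw [Real.norm_eq_abs] at h2 h3
    linarith
  · refine ⟨?_, fun h => by cases h⟩
    have h2 := norm_fst_le (x + ((n : ℝ), -(n : ℝ)))
    have h3 := norm_snd_le (x + ((n : ℝ), -(n : ℝ)))
    rw [Real.norm_eq_abs] at h2 h3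
    have h4 : x.1 + x.2 = (x + ((n : ℝ), -(n : ℝ))).1 + (x + ((n : ℝ), -(n : ℝ))).2 := by
      simp only [Prod.fst_add, Prod.snd_add]
      ring
    rw [h4]
    refine (abs_add_le _ _).trans ?_
    linarith

/-- Supports of test functions are bounded within the causal past and future of bounded sets. -/
theorem Test.cone_bound {X : Spacetime} (φ : Test X) (r : ℝ) :
    ∃ R, ∀ x y : ℝ × ℝ, ‖x‖ ≤ r → φ.1 y ≠ 0 → (y ≤ x ∨ x ≤ y) → ‖y‖ ≤ R := by
  obtain ⟨R, hR⟩ := Test.bound φ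
  refine ⟨|R| + |r|, fun x y hx hy hxy => ?_⟩
  have h1 := (hR y hy).1
  have h2 := norm_fst_le x
  have h3 := norm_snd_le x
  rw [Real.norm_eq_abs] at h2 h3
  have a1 := abs_le.1 h1
  have a2 := abs_le.1 (h2.trans hx)
  have a3 := abs_le.1 (h3.trans hx)
  have a4 := le_abs_self R
  have a5 := le_abs_self r
  rw [Prod.norm_def, Real.norm_eq_abs, Real.norm_eq_abs]
  rcases hxy with h | h <;> obtain ⟨b1, b2⟩ := Prod.le_def.1 h <;>
  exact max_le (abs_le.2 ⟨by linarith, by linarith⟩) (abs_le.2 ⟨by linarith, by linarith⟩)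

theorem Test.dom_bound {X : Spacetime} (φ : Test X) :
    ∃ R, ∀ x ∈ X.fundDom, φ.1 x ≠ 0 → ‖x‖ ≤ R := by
  obtain ⟨R, hR⟩ := Test.bound φ
  cases X
  · exact ⟨R, fun x _ hx => (hR x hx).2 rfl⟩
  · refine ⟨|R| + 1, fun x hx hx' => ?_⟩
    have a1 := abs_le.1 (hR x hx').1
    have a4 := le_abs_self R
    have a5 := abs_nonneg R
    obtain ⟨b1, b2⟩ := hx
    rw [Prod.norm_def, Real.norm_eq_abs, Real.norm_eq_abs]
    exact max_le (abs_le.2 ⟨by linarith, by linarith⟩) (abs_le.2 ⟨by linarith, by linarith⟩)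

theorem Spacetime.measurableSet_fundDom (X : Spacetime) : MeasurableSet X.fundDom := by
  cases X
  · exact MeasurableSet.univ
  · exact (measurableSet_le measurable_const measurable_fst).inter
      (measurableSet_lt measurable_fst measurable_const)

/-- The kernel of the causal propagator. -/
noncomputable def kernel (x y : ℝ × ℝ) : ℝ :=
  (1 / 2) * ((Set.Iic x).indicator (fun _ => 1) y - (Set.Ici x).indicator (fun _ => 1) y)

theorem kernel_swap (x y : ℝ × ℝ) : kernel y x = -kernel x y := by
  have h1 : (Set.Iic y).indicator (fun _ => (1 : ℝ)) x = (Set.Ici x).indicator (fun _ => 1) y := by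
    simp [Set.indicator]
  have h2 : (Set.Ici y).indicator (fun _ => (1 : ℝ)) x = (Set.Iic x).indicator (fun _ => 1) y := by
    simp [Set.indicator]
  rw [kernel, kernel, h1, h2]
  ring

theorem kernel_add (x y γ : ℝ × ℝ) : kernel (γ + x) (γ + y) = kernel x y := by
  simp [kernel, Set.indicator]

theorem kernel_ne_zero {x y : ℝ × ℝ} (h : kernel x y ≠ 0) : y ≤ x ∨ x ≤ y := by
  by_contra hc
  push Not at hc
  refine h ?_
  simp [kernel, Set.indicator, hc.1, hc.2]

theorem abs_kernel_le (x y : ℝ × ℝ) : |kernel x y| ≤ 1 := by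
  rw [kernel, abs_le]
  simp only [Set.indicator]
  split_ifs <;> norm_num

theorem measurable_kernel : Measurable fun p : (ℝ × ℝ) × (ℝ × ℝ) => kernel p.1 p.2 := by
  have h1 : Measurable fun p : (ℝ × ℝ) × (ℝ × ℝ) =>
      (Set.Iic p.1).indicator (fun _ => (1 : ℝ)) p.2 := by
    have : (fun p : (ℝ × ℝ) × (ℝ × ℝ) => (Set.Iic p.1).indicator (fun _ => (1 : ℝ)) p.2) =
        {p : (ℝ × ℝ) × (ℝ × ℝ) | p.2 ≤ p.1}.indicator fun _ => 1 := by
      funext p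
      simp [Set.indicator]
    rw [this]
    exact measurable_const.indicator (isClosed_le continuous_snd continuous_fst).measurableSet
  have h2 : Measurable fun p : (ℝ × ℝ) × (ℝ × ℝ) =>
      (Set.Ici p.1).indicator (fun _ => (1 : ℝ)) p.2 := by
    have : (fun p : (ℝ × ℝ) × (ℝ × ℝ) => (Set.Ici p.1).indicator (fun _ => (1 : ℝ)) p.2) =
        {p : (ℝ × ℝ) × (ℝ × ℝ) | p.1 ≤ p.2}.indicator fun _ => 1 := by
      funext p
      simp [Set.indicator]
    rw [this]
    exact measurable_const.indicator (isClosed_le continuous_fst continuous_snd).measurableSet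
  exact measurable_const.mul (h1.sub h2)

theorem Test.integrableOn_cone {X : Spacetime} (φ : Test X) (x : ℝ × ℝ) :
    IntegrableOn φ.1 (Set.Iic x) ∧ IntegrableOn φ.1 (Set.Ici x) := by
  obtain ⟨R, hR⟩ := Test.cone_bound φ ‖x‖
  have hB : IntegrableOn φ.1 (Metric.closedBall 0 R) :=
    (IsTest.smooth φ.2).continuous.continuousOn.integrableOn_compact (isCompact_closedBall 0 R)
  constructor
  · refine hB.of_forall_sdiff_eq_zero measurableSet_Iic fun y hy => ?_
    by_contra hy'
    exact hy.2 (mem_closedBall_zero_iff.2 (hR x y le_rfl hy' (Or.inl hy.1)))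
  · refine hB.of_forall_sdiff_eq_zero measurableSet_Ici fun y hy => ?_
    by_contra hy'
    exact hy.2 (mem_closedBall_zero_iff.2 (hR x y le_rfl hy' (Or.inr hy.1)))

theorem kernel_mul (x y : ℝ × ℝ) (c : ℝ) : kernel x y * c =
    (1 / 2) * ((Set.Iic x).indicator (fun _ => c) y - (Set.Ici x).indicator (fun _ => c) y) := by
  simp only [kernel, Set.indicator]
  split_ifs <;> ring

theorem Test.integrable_kernel {X : Spacetime} (σ : Test X) (x : ℝ × ℝ) :
    Integrable fun y => kernel x y * σ.1 y := by
  obtain ⟨h1, h2⟩ := Test.integrableOn_cone σ x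
  have h3 := ((h1.integrable_indicator measurableSet_Iic).sub
    (h2.integrable_indicator measurableSet_Ici)).const_mul (1 / 2)
  refine h3.congr (Filter.Eventually.of_forall fun y => ?_)
  simp only [kernel_mul]
  simp [Set.indicator]

theorem causalProp_eq {X : Spacetime} (σ : Test X) (x : ℝ × ℝ) :
    causalProp σ.1 x = ∫ y, kernel x y * σ.1 y := by
  obtain ⟨h1, h2⟩ := Test.integrableOn_cone σ x
  rw [causalProp, greenRet, greenAdv, ← integral_indicator measurableSet_Iic,
    ← integral_indicator measurableSet_Ici, ← mul_sub,
    ← integral_sub (h1.integrable_indicator measurableSet_Iic)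
      (h2.integrable_indicator measurableSet_Ici), ← integral_const_mul]
  refine integral_congr_ae (Filter.Eventually.of_forall fun y => ?_)
  simp only [kernel_mul]
  simp [Set.indicator]

theorem Test.integrable_prod {X : Spacetime} (ρ σ : Test X) :
    Integrable (fun p : (ℝ × ℝ) × (ℝ × ℝ) => ρ.1 p.1 * (kernel p.1 p.2 * σ.1 p.2))
      ((volume.restrict X.fundDom).prod volume) := by
  obtain ⟨R, hR⟩ := Test.dom_bound ρ
  obtain ⟨S, hS⟩ := Test.cone_bound σ R
  obtain ⟨A, hA⟩ := (isCompact_closedBall (0 : ℝ × ℝ) R).exists_bound_of_continuousOn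
    (IsTest.smooth ρ.2).continuous.continuousOn
  obtain ⟨B, hB⟩ := (isCompact_closedBall (0 : ℝ × ℝ) S).exists_bound_of_continuousOn
    (IsTest.smooth σ.2).continuous.continuousOn
  have hm : Measurable fun p : (ℝ × ℝ) × (ℝ × ℝ) => ρ.1 p.1 * (kernel p.1 p.2 * σ.1 p.2) :=
    ((IsTest.smooth ρ.2).continuous.measurable.comp measurable_fst).mul
      (measurable_kernel.mul ((IsTest.smooth σ.2).continuous.measurable.comp measurable_snd))
  have h1 : ((volume.restrict X.fundDom).prod volume : Measure ((ℝ × ℝ) × (ℝ × ℝ))) =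
      (volume.prod volume).restrict (X.fundDom ×ˢ Set.univ) := by
    rw [← Measure.prod_restrict, Measure.restrict_univ]
  rw [h1]
  change IntegrableOn _ _ _
  have h2 : IntegrableOn (fun p : (ℝ × ℝ) × (ℝ × ℝ) => ρ.1 p.1 * (kernel p.1 p.2 * σ.1 p.2))
      (Metric.closedBall 0 R ×ˢ Metric.closedBall 0 S) (volume.prod volume) := by
    refine Measure.integrableOn_of_bounded (M := A * (1 * B)) ?_ hm.aestronglyMeasurable ?_
    · exact ((isCompact_closedBall (0 : ℝ × ℝ) R).prod
        (isCompact_closedBall (0 : ℝ × ℝ) S)).measure_lt_top.ne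
    · refine (ae_restrict_iff' (measurableSet_closedBall.prod measurableSet_closedBall)).2
        (Filter.Eventually.of_forall fun p hp => ?_)
      rw [norm_mul, norm_mul]
      have b1 := hA p.1 hp.1
      have b2 := hB p.2 hp.2
      have b3 : ‖kernel p.1 p.2‖ ≤ 1 := abs_kernel_le _ _
      gcongr
      exact (norm_nonneg _).trans b1
  refine h2.of_forall_sdiff_eq_zero (X.measurableSet_fundDom.prod MeasurableSet.univ) fun p hp => ?_
  by_contra hc
  have c1 := left_ne_zero_of_mul hc
  have c2 := right_ne_zero_of_mul hc
  have c3 := hR p.1 hp.1.1 c1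
  exact hp.2 ⟨mem_closedBall_zero_iff.2 c3, mem_closedBall_zero_iff.2
    (hS p.1 p.2 c3 (right_ne_zero_of_mul c2) (kernel_ne_zero (left_ne_zero_of_mul c2)))⟩

theorem Test.integrable_mul_causalProp {X : Spacetime} (ρ σ : Test X) :
    IntegrableOn (fun x => ρ.1 x * causalProp σ.1 x) X.fundDom := by
  have h := (Test.integrable_prod ρ σ).integral_prod_left
  refine h.congr (Filter.Eventually.of_forall fun x => ?_)
  simp only
  rw [integral_const_mul, causalProp_eq]

theorem causalProp_add {X : Spacetime} (σ σ' : Test X) (x : ℝ × ℝ) :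
    causalProp (σ + σ').1 x = causalProp σ.1 x + causalProp σ'.1 x := by
  rw [causalProp_eq, causalProp_eq, causalProp_eq,
    ← integral_add (Test.integrable_kernel σ x) (Test.integrable_kernel σ' x)]
  refine integral_congr_ae (Filter.Eventually.of_forall fun y => ?_)
  exact mul_add _ _ _

theorem causalProp_smul {X : Spacetime} (c : ℝ) (σ : Test X) (x : ℝ × ℝ) :
    causalProp (c • σ).1 x = c * causalProp σ.1 x := by
  rw [causalProp_eq, causalProp_eq, ← integral_const_mul]
  refine integral_congr_ae (Filter.Eventually.of_forall fun y => ?_)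
  exact mul_left_comm _ _ _

/-- The bilinear pairing `(ρ, σ) ↦ ∫_X ρ G(σ)` of compactly supported `2`-forms. -/
noncomputable def pairing (X : Spacetime) : TwoForm X →ₗ[ℝ] TwoForm X →ₗ[ℝ] ℝ :=
  LinearMap.mk₂ ℝ (fun ρ σ => integralOver X fun x => ρ.1 x * causalProp σ.1 x)
    (fun ρ ρ' σ => by
      rw [integralOver, integralOver, integralOver, ← integral_add
        (Test.integrable_mul_causalProp ρ σ) (Test.integrable_mul_causalProp ρ' σ)]
      exact integral_congr_ae (Filter.Eventually.of_forall fun x => add_mul _ _ _))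
    (fun c ρ σ => by
      rw [integralOver, integralOver, smul_eq_mul, ← integral_const_mul]
      exact integral_congr_ae (Filter.Eventually.of_forall fun x => mul_assoc _ _ _))
    (fun ρ σ σ' => by
      rw [integralOver, integralOver, integralOver, ← integral_add
        (Test.integrable_mul_causalProp ρ σ) (Test.integrable_mul_causalProp ρ σ')]
      refine integral_congr_ae (Filter.Eventually.of_forall fun x => ?_)
      simp only [causalProp_add]
      exact mul_add _ _ _)
    (fun c ρ σ => by
      rw [integralOver, integralOver, smul_eq_mul, ← integral_const_mul]
      refine integral_congr_ae (Filter.Eventually.of_forall fun x => ?_)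
      simp only [causalProp_smul]
      exact mul_left_comm _ _ _)

theorem pairing_apply {X : Spacetime} (ρ σ : TwoForm X) :
    pairing X ρ σ = ∫ x in X.fundDom, ρ.1 x * causalProp σ.1 x := rfl

instance (X : Spacetime) : Countable X.deck := by
  cases X
  · exact inferInstanceAs (Countable (⊥ : AddSubgroup (ℝ × ℝ)))
  · exact inferInstanceAs (Countable (AddSubgroup.zmultiples ((1, -1) : ℝ × ℝ)))

theorem Spacetime.fundDom_unique (X : Spacetime) (x : ℝ × ℝ) :
    ∃! γ : X.deck, (γ : ℝ × ℝ) + x ∈ X.fundDom := by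
  cases X
  · exact ⟨0, trivial, fun γ _ => Subtype.ext γ.2⟩
  · obtain ⟨n, hn, hu⟩ := existsUnique_add_zsmul_mem_Ico (one_pos : (0 : ℝ) < 1) x.1 0
    refine ⟨⟨((n : ℝ), -(n : ℝ)), IsLift.deck_mem_cyl n⟩, ?_, ?_⟩
    · simp only [zsmul_eq_mul, mul_one, zero_add] at hn
      change 0 ≤ (n : ℝ) + x.1 ∧ (n : ℝ) + x.1 < 1
      rw [add_comm (n : ℝ)]
      exact hn
    · rintro ⟨γ, hγ⟩ h
      rcases IsLift.deck_cases hγ with ⟨h0, -⟩ | ⟨-, m, rfl⟩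
      · cases h0
      · have h1 : m = n := hu m (by
          simp only [zsmul_eq_mul, mul_one, zero_add]
          rw [add_comm]
          exact h)
        subst h1
        rfl

theorem Spacetime.vadd_invariant (X : Spacetime) :
    VAddInvariantMeasure X.deck (ℝ × ℝ) volume :=
  ⟨fun γ s _ => measure_preimage_add volume (γ : ℝ × ℝ) s⟩

theorem pairing_eq_prod {X : Spacetime} (ρ σ : TwoForm X) :
    pairing X ρ σ = ∫ p in X.fundDom ×ˢ (Set.univ : Set (ℝ × ℝ)),
      ρ.1 p.1 * (kernel p.1 p.2 * σ.1 p.2) := by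
  have h1 : (volume.restrict (X.fundDom ×ˢ (Set.univ : Set (ℝ × ℝ))) :
      Measure ((ℝ × ℝ) × (ℝ × ℝ))) = (volume.restrict X.fundDom).prod volume := by
    rw [Measure.volume_eq_prod, ← Measure.prod_restrict, Measure.restrict_univ]
  rw [pairing_apply, h1, integral_prod _ (Test.integrable_prod ρ σ)]
  refine integral_congr_ae (Filter.Eventually.of_forall fun x => ?_)
  simp only
  rw [integral_const_mul, causalProp_eq]

/-- The causal propagator is skew-symmetric. -/
theorem pairing_skew {X : Spacetime} (ρ σ : TwoForm X) : pairing X ρ σ = -pairing X σ ρ := by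
  have hD := X.measurableSet_fundDom
  have hmeas : MeasurableConstVAdd X.deck ((ℝ × ℝ) × (ℝ × ℝ)) :=
    ⟨fun γ => ((measurable_const_add (γ : ℝ × ℝ)).comp measurable_fst).prodMk
      ((measurable_const_add (γ : ℝ × ℝ)).comp measurable_snd)⟩
  have hleft : (volume : Measure ((ℝ × ℝ) × (ℝ × ℝ))).IsAddLeftInvariant :=
    inferInstanceAs ((volume : Measure (ℝ × ℝ)).prod (volume : Measure (ℝ × ℝ))).IsAddLeftInvariant
  have hinv : VAddInvariantMeasure X.deck ((ℝ × ℝ) × (ℝ × ℝ)) volume :=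
    ⟨fun γ s _ => measure_preimage_add volume (((γ : ℝ × ℝ), (γ : ℝ × ℝ))) s⟩
  have f1 : IsAddFundamentalDomain X.deck (X.fundDom ×ˢ (Set.univ : Set (ℝ × ℝ))) volume := by
    refine IsAddFundamentalDomain.mk' (hD.prod MeasurableSet.univ).nullMeasurableSet fun p => ?_
    obtain ⟨γ, h, hu⟩ := X.fundDom_unique p.1
    exact ⟨γ, ⟨h, trivial⟩, fun δ hδ => hu δ hδ.1⟩
  have f2 : IsAddFundamentalDomain X.deck ((Set.univ : Set (ℝ × ℝ)) ×ˢ X.fundDom) volume := by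
    refine IsAddFundamentalDomain.mk' (MeasurableSet.univ.prod hD).nullMeasurableSet fun p => ?_
    obtain ⟨γ, h, hu⟩ := X.fundDom_unique p.2
    exact ⟨γ, ⟨trivial, h⟩, fun δ hδ => hu δ hδ.2⟩
  rw [pairing_eq_prod, pairing_eq_prod, f1.setIntegral_eq f2]
  · have h1 : (fun p : (ℝ × ℝ) × (ℝ × ℝ) => ρ.1 p.1 * (kernel p.1 p.2 * σ.1 p.2)) =
        fun p => -((fun q : (ℝ × ℝ) × (ℝ × ℝ) => σ.1 q.1 * (kernel q.1 q.2 * ρ.1 q.2)) p.swap) := by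
      funext p
      simp only [Prod.fst_swap, Prod.snd_swap]
      rw [kernel_swap p.1 p.2]
      ring
    rw [h1, integral_neg, ← Set.preimage_swap_prod]
    congr 1
    exact (Measure.measurePreserving_swap (μ := (volume : Measure (ℝ × ℝ)))
      (ν := (volume : Measure (ℝ × ℝ)))).setIntegral_preimage_emb
      MeasurableEquiv.prodComm.measurableEmbedding
        (fun q => σ.1 q.1 * (kernel q.1 q.2 * ρ.1 q.2)) (X.fundDom ×ˢ Set.univ)
  · intro γ p
    change ρ.1 ((γ : ℝ × ℝ) + p.1) * (kernel ((γ : ℝ × ℝ) + p.1) ((γ : ℝ × ℝ) + p.2) *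
      σ.1 ((γ : ℝ × ℝ) + p.2)) = _
    rw [kernel_add, add_comm _ p.1, add_comm _ p.2, IsTest.periodic ρ.2 _ γ.2,
      IsTest.periodic σ.2 _ γ.2]

theorem Test.slice_plus {X : Spacetime} (φ : Test X) (b : ℝ) :
    ContDiff ℝ 1 (fun a => φ.1 (a, b)) ∧ HasCompactSupport (fun a => φ.1 (a, b)) ∧
      ∀ a, deriv (fun a => φ.1 (a, b)) a = (pd .plus φ).1 (a, b) := by
  have hs : ContDiff ℝ ∞ φ.1 := IsTest.smooth φ.2
  refine ⟨(hs.of_le (by exact_mod_cast le_top)).comp (contDiff_id.prodMk contDiff_const), ?_,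
    fun a => ?_⟩
  · obtain ⟨R, hR⟩ := Test.bound φ
    refine HasCompactSupport.intro (isCompact_Icc (a := -b - R) (b := -b + R)) fun a ha => ?_
    by_contra h
    have h1 := abs_le.1 (hR _ h).1
    exact ha ⟨by linarith [h1.1], by linarith [h1.2]⟩
  · exact ((hs.differentiable (by simp) (a, b)).hasFDerivAt.comp_hasDerivAt a
      ((hasDerivAt_id a).prodMk (hasDerivAt_const a b))).deriv

theorem Test.slice_minus {X : Spacetime} (φ : Test X) (a : ℝ) :
    ContDiff ℝ 1 (fun b => φ.1 (a, b)) ∧ HasCompactSupport (fun b => φ.1 (a, b)) ∧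
      ∀ b, deriv (fun b => φ.1 (a, b)) b = (pd .minus φ).1 (a, b) := by
  have hs : ContDiff ℝ ∞ φ.1 := IsTest.smooth φ.2
  refine ⟨(hs.of_le (by exact_mod_cast le_top)).comp (contDiff_const.prodMk contDiff_id), ?_,
    fun b => ?_⟩
  · obtain ⟨R, hR⟩ := Test.bound φ
    refine HasCompactSupport.intro (isCompact_Icc (a := -a - R) (b := -a + R)) fun b hb => ?_
    by_contra h
    have h1 := abs_le.1 (hR _ h).1
    exact hb ⟨by linarith [h1.1], by linarith [h1.2]⟩
  · exact ((hs.differentiable (by simp) (a, b)).hasFDerivAt.comp_hasDerivAt b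
      ((hasDerivAt_const b a).prodMk (hasDerivAt_id b))).deriv

/-- The Green operators invert the wave operator. -/
theorem green_wave {X : Spacetime} (φ : Test X) (x : ℝ × ℝ) :
    greenRet (wave φ).1 x = φ.1 x ∧ greenAdv (wave φ).1 x = φ.1 x := by
  have h0 : (wave φ).1 = fun y => 2 * (pd .minus (pd .plus φ)).1 y := by rw [wave_eq]; rfl
  obtain ⟨i1, i2⟩ := Test.integrableOn_cone (pd .minus (pd .plus φ)) x
  rw [greenRet, greenAdv, h0, integral_const_mul, integral_const_mul]
  have p1 : (Set.Iic x) = Set.Iic x.1 ×ˢ Set.Iic x.2 := (Set.Iic_prod_Iic x.1 x.2).symm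
  have p2 : (Set.Ici x) = Set.Ici x.1 ×ˢ Set.Ici x.2 := (Set.Ici_prod_Ici x.1 x.2).symm
  rw [p1] at i1 ⊢
  rw [p2] at i2 ⊢
  rw [Measure.volume_eq_prod] at i1 i2 ⊢
  rw [setIntegral_prod _ i1, setIntegral_prod _ i2]
  obtain ⟨c1, c2, c3⟩ := Test.slice_plus φ x.2
  constructor
  · have h1 : ∀ a, ∫ b in Set.Iic x.2, (pd .minus (pd .plus φ)).1 (a, b) =
        deriv (fun a => φ.1 (a, x.2)) a := by
      intro a
      obtain ⟨d1, d2, d3⟩ := Test.slice_minus (pd .plus φ) a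
      rw [c3]
      simp only [← d3]
      exact d2.integral_Iic_deriv_eq d1 x.2
    simp only [h1]
    rw [c2.integral_Iic_deriv_eq c1]
    ring
  · have h1 : ∀ a, ∫ b in Set.Ici x.2, (pd .minus (pd .plus φ)).1 (a, b) =
        -deriv (fun a => φ.1 (a, x.2)) a := by
      intro a
      obtain ⟨d1, d2, d3⟩ := Test.slice_minus (pd .plus φ) a
      rw [c3]
      simp only [← d3]
      rw [integral_Ici_eq_integral_Ioi]
      exact d2.integral_Ioi_deriv_eq d1 x.2
    simp only [h1]
    rw [integral_neg, integral_Ici_eq_integral_Ioi, c2.integral_Ioi_deriv_eq c1]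
    ring

theorem pairing_wave {X : Spacetime} (ρ : TwoForm X) (φ : Test X) : pairing X ρ (wave φ) = 0 := by
  rw [pairing_apply]
  simp [causalProp, green_wave]

/-- The bilinear form `(α, β) ↦ ∫_X dα G(dβ)` on compactly supported `1`-forms. -/
noncomputable def preTau (X : Spacetime) : OneForm X →ₗ[ℝ] OneForm X →ₗ[ℝ] ℝ :=
  (pairing X).compl₁₂ dOne dOne

theorem preTau_right {X : Spacetime} (α β : OneForm X) (hβ : β ∈ trivialForms X) :
    preTau X α β = 0 := by
  obtain ⟨_, ⟨φ, rfl⟩, _, ⟨ψ, rfl⟩, rfl⟩ := Submodule.mem_sup.1 hβ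
  change pairing X (dOne α) (dOne (dZero φ + hodge (dZero ψ))) = 0
  rw [map_add, dOne_dZero, zero_add]
  exact pairing_wave _ _

theorem preTau_left {X : Spacetime} (α β : OneForm X) (hα : α ∈ trivialForms X) :
    preTau X α β = 0 := by
  have h := preTau_right β α hα
  change pairing X (dOne β) (dOne α) = 0 at h
  change pairing X (dOne α) (dOne β) = 0
  rw [pairing_skew, h, neg_zero]

/-- The Poisson structure `τ([α], [β]) = ∫_X dα G(dβ)` on linear observables. -/
noncomputable def poisson (X : Spacetime) : LinObs X →ₗ[ℝ] LinObs X →ₗ[ℝ] ℝ :=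
  (trivialForms X).liftQ
    (LinearMap.flip ((trivialForms X).liftQ (preTau X).flip fun β hβ =>
      LinearMap.ext fun α => preTau_right α β hβ))
    fun α hα => LinearMap.ext fun v => by
      obtain ⟨β, rfl⟩ := Submodule.Quotient.mk_surjective _ v
      exact preTau_left α β hα

theorem poisson_mk {X : Spacetime} (α β : OneForm X) :
    poisson X (Submodule.Quotient.mk α) (Submodule.Quotient.mk β) =
      integralOver X fun x => (dOne α).1 x * causalProp (dOne β).1 x := rfl

theorem causalProp_periodic {X : Spacetime} (σ : Test X) {γ : ℝ × ℝ} (hγ : γ ∈ X.deck)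
    (x : ℝ × ℝ) : causalProp σ.1 (γ + x) = causalProp σ.1 x := by
  rw [causalProp_eq, causalProp_eq,
    ← integral_add_left_eq_self (fun y => kernel (γ + x) y * σ.1 y) γ]
  refine integral_congr_ae (Filter.Eventually.of_forall fun y => ?_)
  simp only
  rw [kernel_add, add_comm γ y, IsTest.periodic σ.2 γ hγ]

namespace IsLift

variable {X Y : Spacetime} {f : X.Pt → Y.Pt} {hp hm : ℝ → ℝ}

theorem lift_le (H : IsLift f hp hm) (x z : ℝ × ℝ) :
    ((hp x.1, hm x.2) : ℝ × ℝ) ≤ (hp z.1, hm z.2) ↔ x ≤ z := by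
  rw [Prod.mk_le_mk, Prod.le_def, H.embPlus.strictMono.le_iff_le, H.embMinus.strictMono.le_iff_le]

theorem lift_injective (H : IsLift f hp hm) :
    Function.Injective fun x : ℝ × ℝ => (hp x.1, hm x.2) := fun _ _ h =>
  Prod.ext (H.embPlus.strictMono.injective (Prod.mk.inj h).1)
    (H.embMinus.strictMono.injective (Prod.mk.inj h).2)

theorem det_eq (a b : ℝ) : ((a • ContinuousLinearMap.fst ℝ ℝ ℝ).prod
    (b • ContinuousLinearMap.snd ℝ ℝ ℝ)).det = a * b := by
  have h : (((a • ContinuousLinearMap.fst ℝ ℝ ℝ).prod (b • ContinuousLinearMap.snd ℝ ℝ ℝ) :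
      ℝ × ℝ →L[ℝ] ℝ × ℝ) : ℝ × ℝ →ₗ[ℝ] ℝ × ℝ) =
      LinearMap.prodMap (a • LinearMap.id) (b • LinearMap.id) := by
    ext <;> simp
  rw [ContinuousLinearMap.det, h, LinearMap.det_prodMap]
  simp

/-- Change of variables for the pushforward of `2`-forms. -/
theorem integral_image (H : IsLift f hp hm) {s : Set (ℝ × ℝ)} (hs : MeasurableSet s) (ρ : TwoForm X)
    (u : ℝ × ℝ → ℝ) :
    ∫ y in (fun x : ℝ × ℝ => (hp x.1, hm x.2)) '' s, (H.pushTwo ρ).1 y * u y =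
      ∫ x in s, ρ.1 x * u (hp x.1, hm x.2) := by
  rw [integral_image_eq_integral_abs_det_fderiv_smul volume hs
    (fun x _ => (H.hasFDerivAt x).hasFDerivWithinAt) H.lift_injective.injOn]
  refine integral_congr_ae (Filter.Eventually.of_forall fun x => ?_)
  simp only [smul_eq_mul]
  have h1 := H.embPlus.deriv_pos x.1
  have h2 := H.embMinus.deriv_pos x.2
  rw [det_eq, abs_of_pos (mul_pos h1 h2), pushTwo, H.pushTest_apply, weight, weight]
  field_simp

theorem measurableSet_image (H : IsLift f hp hm) {s : Set (ℝ × ℝ)} (hs : MeasurableSet s) :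
    MeasurableSet ((fun x : ℝ × ℝ => (hp x.1, hm x.2)) '' s) :=
  hs.image_of_continuousOn_injOn H.continuous.continuousOn H.lift_injective.injOn

theorem pushTwo_eq_zero (H : IsLift f hp hm) (ρ : TwoForm X) {y : ℝ × ℝ}
    (hy : ¬ ∃ x : ℝ × ℝ, ∃ γ ∈ Y.deck, y = (hp x.1, hm x.2) + γ) : (H.pushTwo ρ).1 y = 0 :=
  (H.pushTest_eventually _ _ ρ hy).eq_of_nhds

/-- The causal propagator is natural. -/
theorem causalProp_push (H : IsLift f hp hm) (σ : TwoForm X) (x : ℝ × ℝ) :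
    causalProp (H.pushTwo σ).1 (hp x.1, hm x.2) = causalProp σ.1 x := by
  have key : ∀ (s t : Set (ℝ × ℝ)), MeasurableSet s → MeasurableSet t →
      (fun z : ℝ × ℝ => (hp z.1, hm z.2)) '' s ⊆ t →
      (∀ z : ℝ × ℝ, ((hp z.1, hm z.2) : ℝ × ℝ) ∈ t → z ∈ s) →
      (∀ (z γ : ℝ × ℝ), γ ∈ Y.deck → (hp z.1, hm z.2) + γ ∈ t →
        ∃ w : ℝ × ℝ, (hp z.1, hm z.2) + γ = (hp w.1, hm w.2)) →
      ∫ y in t, (H.pushTwo σ).1 y = ∫ y in s, σ.1 y := by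
    intro s t hs ht h1 h2 h3
    have h4 := H.integral_image hs σ fun _ => 1
    simp only [mul_one] at h4
    rw [← h4]
    refine setIntegral_eq_of_subset_of_forall_sdiff_eq_zero ht h1 fun y hy => ?_
    refine H.pushTwo_eq_zero σ ?_
    rintro ⟨z, γ, hγ, rfl⟩
    obtain ⟨w, hw⟩ := h3 z γ hγ hy.1
    refine hy.2 ⟨w, h2 w ?_, hw.symm⟩
    rw [← hw]
    exact hy.1
  rw [causalProp, causalProp, greenRet, greenRet, greenAdv, greenAdv]
  congr 2
  · refine key _ _ measurableSet_Iic measurableSet_Iic ?_ (fun z hz => (H.lift_le z x).1 hz)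
      fun z γ hγ hz => H.causal hγ (Or.inl hz)
    rintro _ ⟨z, hz, rfl⟩
    exact (H.lift_le z x).2 hz
  · refine key _ _ measurableSet_Ici measurableSet_Ici ?_ (fun z hz => (H.lift_le x z).1 hz)
      fun z γ hγ hz => H.causal hγ (Or.inr hz)
    rintro _ ⟨z, hz, rfl⟩
    exact (H.lift_le x z).2 hz

theorem map_deck (H : IsLift f hp hm) (x : ℝ × ℝ) {δ : ℝ × ℝ} (hδ : δ ∈ X.deck) :
    ∃ γ ∈ Y.deck, ((hp (δ + x).1, hm (δ + x).2) : ℝ × ℝ) = γ + (hp x.1, hm x.2) := by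
  have h1 : f ((x : ℝ × ℝ) : X.Pt) = f ((δ + x : ℝ × ℝ) : X.Pt) := by
    congr 1
    rw [QuotientAddGroup.eq]
    simpa using hδ
  rw [H.map_coe, H.map_coe, QuotientAddGroup.eq] at h1
  exact ⟨_, h1, by abel⟩

/-- The image of a fundamental domain meets every orbit in the union of the translates of the image
exactly once. -/
theorem image_fundDom_unique (H : IsLift f hp hm) {y : ℝ × ℝ} {γ δ : ℝ × ℝ} (hγ : γ ∈ Y.deck)
    (hδ : δ ∈ Y.deck) (h1 : γ + y ∈ (fun x : ℝ × ℝ => (hp x.1, hm x.2)) '' X.fundDom)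
    (h2 : δ + y ∈ (fun x : ℝ × ℝ => (hp x.1, hm x.2)) '' X.fundDom) : γ = δ := by
  obtain ⟨x, hx, hx'⟩ := h1
  obtain ⟨z, hz, hz'⟩ := h2
  simp only at hx' hz'
  have h3 : ((hp x.1, hm x.2) : ℝ × ℝ) = (hp z.1, hm z.2) + (γ - δ) := by
    rw [hx', hz']
    abel
  rcases H.inj (sub_mem hγ hδ) h3 with ⟨h4, -⟩ | ⟨h4, h5⟩
  · exact sub_eq_zero.1 h4
  · obtain ⟨_, -, hu⟩ := X.fundDom_unique z
    have e1 := hu 0 (by simpa using hz)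
    have e2 := hu ⟨γ - δ, h5⟩ (by
      change γ - δ + z ∈ X.fundDom
      rwa [← h4, sub_add_cancel])
    have e3 := congrArg Subtype.val (e2.trans e1.symm)
    exact sub_eq_zero.1 e3

theorem integral_fundDom (H : IsLift f hp hm) {u : ℝ × ℝ → ℝ}
    (hu : ∀ γ ∈ Y.deck, ∀ y, u (γ + y) = u y)
    (h0 : ∀ y, (¬ ∃ x : ℝ × ℝ, ∃ γ ∈ Y.deck, y = (hp x.1, hm x.2) + γ) → u y = 0) :
    ∫ y in Y.fundDom, u y = ∫ y in (fun x : ℝ × ℝ => (hp x.1, hm x.2)) '' X.fundDom, u y := by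
  set F : ℝ × ℝ → ℝ × ℝ := fun x => (hp x.1, hm x.2) with hF
  set U : Set (ℝ × ℝ) := {y | ∃ x : ℝ × ℝ, ∃ γ ∈ Y.deck, y = (hp x.1, hm x.2) + γ} with hU
  have hUm : MeasurableSet U := by
    have h : U = ⋃ γ : Y.deck, (fun y => (γ : ℝ × ℝ) + y) ⁻¹' (F '' Set.univ) := by
      ext y
      simp only [Set.mem_iUnion, Set.mem_preimage, Set.mem_image, Set.mem_univ, true_and]
      constructor
      · rintro ⟨x, γ, hγ, rfl⟩
        exact ⟨-⟨γ, hγ⟩, x, by simp [hF]⟩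
      · rintro ⟨γ, x, hx⟩
        exact ⟨x, -γ, neg_mem γ.2, by
          change ((hp x.1, hm x.2) : ℝ × ℝ) = γ + y at hx
          rw [hx]
          abel⟩
    rw [h]
    exact MeasurableSet.iUnion fun γ =>
      measurable_const_add (γ : ℝ × ℝ) (H.measurableSet_image MeasurableSet.univ)
  have hUγ : ∀ γ ∈ Y.deck, ∀ y, γ + y ∈ U ↔ y ∈ U := by
    intro γ hγ y
    constructor
    · rintro ⟨x, δ, hδ, h⟩
      exact ⟨x, δ - γ, sub_mem hδ hγ, by rw [← add_sub_assoc, ← h]; abel⟩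
    · rintro ⟨x, δ, hδ, h⟩
      exact ⟨x, γ + δ, add_mem hγ hδ, by rw [h]; abel⟩
  have hFD := H.measurableSet_image X.measurableSet_fundDom
  have hmeas : MeasurableConstVAdd Y.deck (ℝ × ℝ) :=
    ⟨fun γ => measurable_const_add (γ : ℝ × ℝ)⟩
  have hinv : VAddInvariantMeasure Y.deck (ℝ × ℝ) (volume.restrict U) := by
    refine ⟨fun γ s hs => ?_⟩
    have hs' : MeasurableSet ((fun y : ℝ × ℝ => γ +ᵥ y) ⁻¹' s) :=
      measurable_const_add (γ : ℝ × ℝ) hs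
    rw [Measure.restrict_apply hs', Measure.restrict_apply hs,
      ← measure_preimage_add volume (γ : ℝ × ℝ) (s ∩ U)]
    congr 1
    ext y
    exact and_congr_right fun _ => (hUγ γ γ.2 y).symm
  have f1 : IsAddFundamentalDomain Y.deck Y.fundDom (volume.restrict U) :=
    IsAddFundamentalDomain.mk' Y.measurableSet_fundDom.nullMeasurableSet Y.fundDom_unique
  have f2 : IsAddFundamentalDomain Y.deck (F '' X.fundDom) (volume.restrict U) := by
    refine ⟨hFD.nullMeasurableSet, ?_, fun γ δ hγδ => Disjoint.aedisjoint ?_⟩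
    · refine (ae_restrict_iff' hUm).2 (Filter.Eventually.of_forall ?_)
      rintro _ ⟨x, γ, hγ, rfl⟩
      obtain ⟨δ, hδ, -⟩ := X.fundDom_unique x
      obtain ⟨ε, hε, h⟩ := H.map_deck x δ.2
      refine ⟨⟨ε - γ, sub_mem hε hγ⟩, (δ : ℝ × ℝ) + x, hδ, ?_⟩
      change ((hp ((δ : ℝ × ℝ) + x).1, hm ((δ : ℝ × ℝ) + x).2) : ℝ × ℝ) = ε - γ + _
      rw [h]
      abel
    · rw [Set.disjoint_left]
      rintro _ ⟨a, ha, rfl⟩ ⟨b, hb, hab⟩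
      refine hγδ (Subtype.ext (neg_injective ?_))
      change (δ : ℝ × ℝ) + b = (γ : ℝ × ℝ) + a at hab
      refine H.image_fundDom_unique (y := (γ : ℝ × ℝ) + a) (neg_mem γ.2) (neg_mem δ.2) ?_ ?_
      · rw [neg_add_cancel_left]
        exact ha
      · rw [← hab, neg_add_cancel_left]
        exact hb
  have h1 : ∀ s : Set (ℝ × ℝ), MeasurableSet s →
      ∫ y in s, u y ∂(volume.restrict U) = ∫ y in s, u y := by
    intro s hs
    rw [Measure.restrict_restrict hs]
    refine (setIntegral_eq_of_subset_of_forall_sdiff_eq_zero hs Set.inter_subset_left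
      fun y hy => h0 y fun hy' => hy.2 ⟨hy.1, hy'⟩).symm
  rw [← h1 _ Y.measurableSet_fundDom, ← h1 _ hFD]
  exact f1.setIntegral_eq f2 fun γ y => hu γ γ.2 y

theorem pairing_push (H : IsLift f hp hm) (ρ σ : TwoForm X) :
    pairing Y (H.pushTwo ρ) (H.pushTwo σ) = pairing X ρ σ := by
  rw [pairing_apply, H.integral_fundDom, H.integral_image X.measurableSet_fundDom, pairing_apply]
  · simp only [H.causalProp_push]
  · intro γ hγ y
    rw [causalProp_periodic _ hγ, add_comm, IsTest.periodic (H.pushTwo ρ).2 γ hγ]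
  · intro y hy
    rw [H.pushTwo_eq_zero ρ hy, zero_mul]

end IsLift

theorem poisson_natural {X Y : Spacetime} (f : X ⟶ Y) (v w : LinObs X) :
    poisson Y (linObsMap f v) (linObsMap f w) = poisson X v w := by
  obtain ⟨α, rfl⟩ := Submodule.Quotient.mk_surjective _ v
  obtain ⟨β, rfl⟩ := Submodule.Quotient.mk_surjective _ w
  obtain ⟨hp, hm, H⟩ := f.2
  rw [linObsMap_mk f H, linObsMap_mk f H]
  change pairing Y (dOne (H.pushOne α)) (dOne (H.pushOne β)) = pairing X (dOne α) (dOne β)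
  rw [H.dOne_push, H.dOne_push, H.pairing_push]

/-! ### The Abelian current and its chiral subspaces -/

/-- The Abelian current: the CCR quantization of the Poisson vector spaces of linear observables. -/
noncomputable def abelianCurrent : Spacetime ⥤ StarAlg where
  obj X := CCR.obj (poisson X)
  map f := CCR.map (linObsMap f) (poisson_natural f)
  map_id X := CCR.hom_ext fun v => by
    rw [CCR.map_gen, linObsMap_id]
    rfl
  map_comp f g := CCR.hom_ext fun v => by
    rw [CCR.map_gen, linObsMap_comp]
    change _ = CCR.map (linObsMap g) (poisson_natural g)
      (CCR.map (linObsMap f) (poisson_natural f) _)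
    rw [CCR.map_gen, CCR.map_gen]

/-- The sign with which the Hodge operator acts on the `1`-forms associated with a chirality:
anti-self-dual `1`-forms `φ dx⁻` with `+`, self-dual `1`-forms `φ dx⁺` with `-`. -/
def Chirality.hodgeSign : Chirality → ℝ
  | .plus => -1
  | .minus => 1

/-- The compactly supported anti-self-dual (chirality `+`), resp. self-dual (chirality `-`), `1`-forms
on a spacetime. -/
noncomputable def dualForms (X : Spacetime) (s : Chirality) : Submodule ℝ (OneForm X) :=
  LinearMap.ker (hodge - s.hodgeSign • LinearMap.id)

/-- The projection `d^-`, resp. `d^+`, of the de Rham differential of functions onto anti-self-dual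
(chirality `+`), resp. self-dual (chirality `-`), `1`-forms. -/
noncomputable def dualD (X : Spacetime) (s : Chirality) : Test X →ₗ[ℝ] OneForm X :=
  ((1 / 2 : ℝ) • (LinearMap.id + s.hodgeSign • hodge)).comp dZero

/-- The subspace `L^±` of linear observables that are classes of anti-self-dual, resp. self-dual,
`1`-forms. -/
noncomputable def chiralObs (X : Spacetime) (s : Chirality) : Submodule ℝ (LinObs X) :=
  (dualForms X s).map (trivialForms X).mkQ

/-- The restriction of the Poisson structure to the subspace `L^±`. -/
noncomputable def chiralPoisson (X : Spacetime) (s : Chirality) :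
    chiralObs X s →ₗ[ℝ] chiralObs X s →ₗ[ℝ] ℝ :=
  (poisson X).compl₁₂ (chiralObs X s).subtype (chiralObs X s).subtype

/-- The star-homomorphism of CCR algebras induced by the inclusion of `L^±` into the linear
observables. -/
noncomputable def chiralIncl (X : Spacetime) (s : Chirality) :
    CCR (chiralPoisson X s) →⋆ₐ[ℂ] CCR (poisson X) :=
  CCR.map (chiralObs X s).subtype fun _ _ => rfl

/-- The vector space `C_c^∞(ℝ)`. -/
def TestLine : Submodule ℝ (ℝ → ℝ) where
  carrier := {φ | ContDiff ℝ ∞ φ ∧ HasCompactSupport φ}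
  zero_mem' := ⟨contDiff_const, HasCompactSupport.zero⟩
  add_mem' h k := ⟨h.1.add k.1, h.2.add k.2⟩
  smul_mem' c _ h := ⟨contDiff_const.smul h.1, h.2.smul_left (f := fun _ => c)⟩

theorem TestLine.integrable (φ ψ : TestLine) : Integrable fun t => φ.1 t * deriv ψ.1 t :=
  (φ.2.1.continuous.mul (contDiff_infty_iff_deriv.1 ψ.2.1).2.continuous).integrable_of_hasCompactSupport
    (φ.2.2.mul_right)

/-- The Poisson structure `(φ, ψ) ↦ -½ ∫ φ dψ` of the chiral current on the line. -/
noncomputable def lineForm : TestLine →ₗ[ℝ] TestLine →ₗ[ℝ] ℝ :=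
  LinearMap.mk₂ ℝ (fun φ ψ => -(1 / 2) * ∫ t, φ.1 t * deriv ψ.1 t)
    (fun φ φ' ψ => by
      rw [← mul_add, ← integral_add (TestLine.integrable φ ψ) (TestLine.integrable φ' ψ)]
      congr 2
      exact funext fun t => add_mul _ _ _)
    (fun c φ ψ => by
      rw [smul_eq_mul, mul_left_comm, ← integral_const_mul c]
      congr 2
      exact funext fun t => mul_assoc c (φ.1 t) (deriv ψ.1 t))
    (fun φ ψ ψ' => by
      rw [← mul_add, ← integral_add (TestLine.integrable φ ψ) (TestLine.integrable φ ψ')]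
      congr 2
      funext t
      have h : deriv (ψ + ψ').1 t = deriv ψ.1 t + deriv ψ'.1 t :=
        deriv_add (ψ.2.1.differentiable (by simp) t) (ψ'.2.1.differentiable (by simp) t)
      rw [h, mul_add])
    (fun c φ ψ => by
      rw [smul_eq_mul, mul_left_comm, ← integral_const_mul c]
      congr 2
      funext t
      have h : deriv (c • ψ).1 t = c * deriv ψ.1 t :=
        deriv_const_mul c (ψ.2.1.differentiable (by simp) t)
      rw [h]
      ring)

/-- The fibre integral over the fibres of `ℝ × ℝ → ℝ`, `x ↦ x⁺`, of (the `dx⁻`-component of) a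
`1`-form on Minkowski spacetime, and likewise with the two light-cone coordinates exchanged. -/
noncomputable def fibreIntegral (s : Chirality) (α : OneForm .mink) : ℝ → ℝ :=
  match s with
  | .plus => fun t => ∫ u, α.2.1 (t, u)
  | .minus => fun t => ∫ u, α.1.1 (u, t)

/-- The component at Minkowski spacetime of the counit of a right Kan extension of the Abelian
current along a chiral projection: the comparison homomorphism from the chiral component on the line
to the algebra of Minkowski spacetime. -/
def counitMink {s : Chirality} {B : Curve ⥤ StarAlg} (ε : chiralProj s ⋙ B ⟶ abelianCurrent) :
    (B.obj .line).carrier →⋆ₐ[ℂ] CCR (poisson .mink) :=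
  ε.app .mink

end ChiralCurrent

open ChiralCurrent

/-!
The point is that the right Kan extension along a chiral projection `π`, evaluated on the line, is the
subalgebra of invariants of the algebra of Minkowski spacetime `M` under moves along the fibres.

Category theory. Star-algebras have all small limits, namely the subalgebras of compatible families
(`StarAlg.sectionsConeIsLimit`), so the right Kan extension exists and is pointwise, and its value on
the line is a limit over the spacetimes `X` with an embedding `line ⟶ π X`. Each of these receives a
morphism from `M` with its identity projection (`exists_chiralProj_map_eq`), so the limit embeds into
the algebra of `M`, with image the elements on which any two morphisms `M ⟶ X` with the same
projection agree (`mem_range_counitMink_iff`).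

Chiral observables belong to the image. A form with vanishing fibre integrals is a derivative along
the fibres (`Test.exists_pd_other_eq`), so a chiral observable is determined by its fibre integral.
Up to a factor the latter is the causal propagator applied to the differential of the form
(`causalProp_dOne_ofCoeff`), hence natural: the pushforwards of a chiral observable along two
morphisms with the same projection coincide (`linObsMap_eq_of_chiralProj_map_eq`). The same formula
turns the Poisson structure into `-½ ∫ φ dψ` on fibre integrals (`poisson_ofCoeff`) and makes the two
chiralities orthogonal.

Nothing else does. An invariant element `a` equals its translates along the fibres, and far translates
commute with a given observable `w` of the opposite chirality because the supports become disjoint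
(`mem_adjoin_of_currentMap_fibreTranslation`). So `a` commutes with the whole opposite chirality `W`.
As the Poisson structure is nondegenerate on `W`, there are dual families `xᵢ`, `yᵢ` in `W` for the
finitely many generators from `W` occurring in `a`, and the number operator `∑ xᵢ [yᵢ, ·]`, which
multiplies words with `n` letters from `W` by `i n` up to shorter words, annihilates `a`; therefore
`a` has no letters from `W` (`CCR.mem_adjoin_of_commute`).

Finally, the CCR algebra of an orthogonal summand embeds because the CCR algebra of an orthogonal sum
maps to the tensor product (`CCR.map_subtype_injective`), where the other tensor factor is nontrivial
by its representation on polynomials (`CCR.nontrivial_of_skew`).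
-/

namespace ChiralCurrent

/-! ### Algebra of canonical commutation relations -/

namespace CCR

variable {V : Type} [AddCommGroup V] [Module ℝ V] {τ : V →ₗ[ℝ] V →ₗ[ℝ] ℝ}

theorem gen_mul_comm_of_eq_zero {v w : V} (h : τ v w = 0) :
    gen τ v * gen τ w = gen τ w * gen τ v := by
  rw [gen_comm, h]
  simp

theorem gen_zero : gen τ 0 = 0 := by
  simpa using gen_smul τ 0 0

open MvPolynomial in
/-- For skew-symmetric `τ` the CCR algebra is represented on the polynomial algebra over `V`
(written in terms of a basis), with `v` acting as the sum of the multiplication by `v` and of the derivation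
`w ↦ i τ(v, w) / 2`. -/
theorem nontrivial_of_skew (hτ : ∀ v w, τ v w = -τ w v) : Nontrivial (CCR τ) := by
  let b := Module.Basis.ofVectorSpace ℝ V
  let L : V →ₗ[ℝ] MvPolynomial (Module.Basis.ofVectorSpaceIndex ℝ V) ℂ :=
    b.constr ℝ fun i => X i
  let D : V → Derivation ℂ (MvPolynomial (Module.Basis.ofVectorSpaceIndex ℝ V) ℂ)
      (MvPolynomial (Module.Basis.ofVectorSpaceIndex ℝ V) ℂ) := fun v =>
    mkDerivation ℂ fun i => C (Complex.I / 2 * (τ v (b i) : ℂ))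
  have hD : ∀ v w, D v (L w) = C (Complex.I / 2 * (τ v w : ℂ)) := by
    intro v w
    induction b.mem_span w using Submodule.span_induction with
    | mem x hx =>
      obtain ⟨i, rfl⟩ := hx
      simp [L, D, mkDerivation_X]
    | zero => simp
    | add x y _ _ hx hy =>
      rw [map_add, map_add, hx, hy, map_add, ← C_add]
      push_cast
      ring_nf
    | smul r x _ hx =>
      have h1 : r • L x = (r : ℂ) • L x := by
        rw [← Complex.coe_smul]
      rw [map_smul, h1, Derivation.map_smul, hx, map_smul, smul_eq_mul,
        MvPolynomial.smul_eq_C_mul, ← C_mul]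
      push_cast
      ring_nf
  have hadd : ∀ v w, D (v + w) = D v + D w := fun v w => derivation_ext fun i => by
    simp [D, mkDerivation_X, mul_add]
  have hsmul : ∀ (r : ℝ) v, D (r • v) = (r : ℂ) • D v := fun r v => derivation_ext fun i => by
    simp only [D, mkDerivation_X, map_smul, LinearMap.smul_apply, Derivation.smul_apply,
      smul_eq_mul, MvPolynomial.smul_eq_C_mul, ← C_mul]
    push_cast
    ring_nf
  let f : V → Module.End ℂ (MvPolynomial (Module.Basis.ofVectorSpaceIndex ℝ V) ℂ) := fun v =>
    LinearMap.mulLeft ℂ (L v) + (D v : _ →ₗ[ℂ] _)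
  let ρ : CCR τ →ₐ[ℂ] Module.End ℂ (MvPolynomial (Module.Basis.ofVectorSpaceIndex ℝ V) ℂ) :=
    lift f
      (fun v w => LinearMap.ext fun p => by
        simp only [f, hadd, LinearMap.add_apply, LinearMap.mulLeft_apply, map_add,
          Derivation.coeFn_coe, Derivation.add_apply]
        ring)
      (fun r v => LinearMap.ext fun p => by
        have h1 : L (r • v) = (r : ℂ) • L v := by
          rw [map_smul, ← Complex.coe_smul]
        simp only [f, hsmul, h1, LinearMap.add_apply, LinearMap.mulLeft_apply,
          Derivation.coeFn_coe, LinearMap.smul_apply, Derivation.smul_apply, smul_add,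
          smul_mul_assoc])
      (fun v w => by
        have h1 : ⁅D v, D w⁆ = 0 := derivation_ext fun i => by
          rw [Derivation.commutator_apply]
          simp [D, mkDerivation_X]
        refine LinearMap.ext fun p => ?_
        have h2 : D v (D w p) = D w (D v p) := by
          have h3 : ⁅D v, D w⁆ p = 0 := by rw [h1]; rfl
          rw [Derivation.commutator_apply] at h3
          exact sub_eq_zero.1 h3
        have h4 : (algebraMap ℂ (Module.End ℂ (MvPolynomial _ ℂ))
            (Complex.I * (τ v w : ℂ))) p = C (Complex.I / 2 * (τ v w : ℂ)) * p -
              C (Complex.I / 2 * (τ w v : ℂ)) * p := by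
          rw [Module.algebraMap_end_apply, hτ w v, MvPolynomial.smul_eq_C_mul, ← sub_mul, ← C_sub]
          push_cast
          ring_nf
        simp only [f, Module.End.mul_apply, LinearMap.add_apply, LinearMap.mulLeft_apply,
          Derivation.coeFn_coe, map_add, Derivation.leibniz, hD, smul_eq_mul, h2, h4]
        ring)
  refine ⟨0, 1, fun h => ?_⟩
  have h1 : (0 : Module.End ℂ (MvPolynomial (Module.Basis.ofVectorSpaceIndex ℝ V) ℂ)) = 1 := by
    rw [← map_zero ρ, h, map_one]
  exact zero_ne_one h1

open TensorProduct in
/-- The CCR algebra of an orthogonal summand embeds: it is a tensor factor. -/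
theorem map_subtype_injective {U W : Submodule ℝ V} (hUW : IsCompl U W)
    (hτ : ∀ v w, τ v w = -τ w v) (hort : ∀ u ∈ U, ∀ w ∈ W, τ u w = 0)
    {σ : U →ₗ[ℝ] U →ₗ[ℝ] ℝ} (hσ : ∀ u v : U, τ (U.subtype u) (U.subtype v) = σ u v) :
    Function.Injective (map (τ := σ) (σ := τ) U.subtype hσ) := by
  let κ : W →ₗ[ℝ] W →ₗ[ℝ] ℝ := τ.compl₁₂ W.subtype W.subtype
  have hκ : Nontrivial (CCR κ) := nontrivial_of_skew fun v w => hτ _ _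
  let pU := U.projectionOnto W hUW
  let pW := W.projectionOnto U hUW.symm
  have hp : ∀ v : V, (pU v : V) + pW v = v := fun v =>
    Submodule.projection_add_projection_eq_self hUW v
  have hst : ∀ v w, τ v w = σ (pU v) (pU w) + κ (pW v) (pW w) := by
    intro v w
    conv_lhs => rw [← hp v, ← hp w]
    simp only [map_add, LinearMap.add_apply]
    rw [hort _ (pU v).2 _ (pW w).2, hτ (pW v : V) (pU w), hort _ (pU w).2 _ (pW v).2, ← hσ]
    simp [κ]
  let F : CCR τ →ₐ[ℂ] CCR σ ⊗[ℂ] CCR κ :=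
    lift (fun v => gen σ (pU v) ⊗ₜ 1 + 1 ⊗ₜ gen κ (pW v))
      (fun v w => by
        simp only [map_add, gen_add, TensorProduct.add_tmul, TensorProduct.tmul_add]
        abel)
      (fun r v => by
        simp only [map_smul, gen_smul, smul_add, TensorProduct.smul_tmul', TensorProduct.tmul_smul])
      (fun v w => by
        have h1 := gen_comm σ (pU v) (pU w)
        have h2 := gen_comm κ (pW v) (pW w)
        have h3 : algebraMap ℂ (CCR σ ⊗[ℂ] CCR κ) (Complex.I * (τ v w : ℂ)) =
            algebraMap ℂ (CCR σ) (Complex.I * (σ (pU v) (pU w) : ℂ)) ⊗ₜ 1 +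
              1 ⊗ₜ algebraMap ℂ (CCR κ) (Complex.I * (κ (pW v) (pW w) : ℂ)) := by
          rw [hst v w, ← Algebra.TensorProduct.algebraMap_apply,
            ← Algebra.TensorProduct.algebraMap_apply', ← map_add]
          congr 1
          push_cast
          ring
        simp only [mul_add, add_mul, Algebra.TensorProduct.tmul_mul_tmul, one_mul, mul_one, h1, h2,
          h3, TensorProduct.add_tmul, TensorProduct.tmul_add]
        abel)
  have hF : ∀ a, F (map (τ := σ) (σ := τ) U.subtype hσ a) = a ⊗ₜ 1 := by
    intro a
    induction a using CCR.induction with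
    | halg c => rw [AlgHomClass.commutes, AlgHom.commutes]; rfl
    | hgen u =>
      rw [map_gen, lift_gen]
      have h1 : pU (U.subtype u) = u := Submodule.projectionOnto_apply_left hUW u
      have h2 : pW (U.subtype u) = 0 := Submodule.projectionOnto_apply_right hUW.symm u
      simp only [h1, h2, gen_zero, TensorProduct.tmul_zero, add_zero]
    | hadd a b ha hb => rw [map_add, map_add, ha, hb, TensorProduct.add_tmul]
    | hmul a b ha hb =>
      rw [map_mul, map_mul, ha, hb, Algebra.TensorProduct.tmul_mul_tmul, mul_one]
  intro a b hab
  have h1 : (a ⊗ₜ[ℂ] (1 : CCR κ)) = b ⊗ₜ 1 := by rw [← hF, ← hF, hab]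
  exact Algebra.TensorProduct.includeLeft_injective (S := ℂ) (A := CCR σ) (B := CCR κ)
    (algebraMap ℂ (CCR κ)).injective h1


/-- The words in generators from `W`, of length less than `n`, with coefficients in the subalgebra
generated by `U`. The zeroth step is `0`, the first one is the subalgebra itself. -/
noncomputable def wordFiltration (τ : V →ₗ[ℝ] V →ₗ[ℝ] ℝ) (U W : Submodule ℝ V) :
    ℕ → Submodule ℂ (CCR τ)
  | 0 => ⊥
  | n + 1 => Subalgebra.toSubmodule (Algebra.adjoin ℂ (gen τ '' U)) ⊔ wordFiltration τ U W n ⊔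
      Submodule.span ℂ {x | ∃ w ∈ W, ∃ b ∈ wordFiltration τ U W n, gen τ w * b = x}

section wordFiltration

variable {U W : Submodule ℝ V}

theorem adjoin_le_wordFiltration (n : ℕ) :
    Subalgebra.toSubmodule (Algebra.adjoin ℂ (gen τ '' U)) ≤ wordFiltration τ U W (n + 1) :=
  le_sup_left.trans le_sup_left

theorem wordFiltration_mono : Monotone (wordFiltration τ U W) :=
  monotone_nat_of_le_succ fun _ => le_sup_right.trans le_sup_left

theorem gen_mul_mem_wordFiltration {n : ℕ} {w : V} (hw : w ∈ W) {b : CCR τ}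
    (hb : b ∈ wordFiltration τ U W n) : gen τ w * b ∈ wordFiltration τ U W (n + 1) :=
  Submodule.mem_sup_right (Submodule.subset_span ⟨w, hw, b, hb, rfl⟩)

theorem wordFiltration_succ_induction {n : ℕ} {p : CCR τ → Prop}
    (hU : ∀ a ∈ Algebra.adjoin ℂ (gen τ '' U), p a) (hn : ∀ a ∈ wordFiltration τ U W n, p a)
    (hgen : ∀ w ∈ W, ∀ b ∈ wordFiltration τ U W n, p (gen τ w * b))
    (hadd : ∀ a b, p a → p b → p (a + b)) (hsmul : ∀ (c : ℂ) a, p a → p (c • a)) {a : CCR τ}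
    (ha : a ∈ wordFiltration τ U W (n + 1)) : p a := by
  obtain ⟨y, hy, z, hz, rfl⟩ := Submodule.mem_sup.1 ha
  obtain ⟨u, hu, v, hv, rfl⟩ := Submodule.mem_sup.1 hy
  refine hadd _ _ (hadd _ _ (hU u hu) (hn v hv)) ?_
  clear ha
  induction hz using Submodule.span_induction with
  | mem x hx =>
    obtain ⟨w, hw, b, hb, rfl⟩ := hx
    exact hgen w hw b hb
  | zero => exact hn 0 (zero_mem _)
  | add x y _ _ hx hy => exact hadd x y hx hy
  | smul c x _ hx => exact hsmul c x hx

theorem gen_mul_comm_of_mem_adjoin (hort : ∀ w ∈ W, ∀ u ∈ U, τ w u = 0) {w : V} (hw : w ∈ W)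
    {c : CCR τ} (hc : c ∈ Algebra.adjoin ℂ (gen τ '' U)) : gen τ w * c = c * gen τ w := by
  have h : Algebra.adjoin ℂ (gen τ '' U) ≤ Subalgebra.centralizer ℂ {gen τ w} := by
    refine Algebra.adjoin_le ?_
    rintro _ ⟨u, hu, rfl⟩
    rw [SetLike.mem_coe, Subalgebra.mem_centralizer_iff]
    rintro _ rfl
    exact gen_mul_comm_of_eq_zero (hort w hw u hu)
  exact Subalgebra.mem_centralizer_iff ℂ |>.1 (h hc) _ rfl

theorem adjoin_mul_mem_wordFiltration (hort : ∀ w ∈ W, ∀ u ∈ U, τ w u = 0) {c : CCR τ}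
    (hc : c ∈ Algebra.adjoin ℂ (gen τ '' U)) {n : ℕ} {b : CCR τ}
    (hb : b ∈ wordFiltration τ U W n) : c * b ∈ wordFiltration τ U W n := by
  induction n generalizing b with
  | zero => rw [(Submodule.mem_bot ℂ).1 hb, mul_zero]; exact zero_mem _
  | succ n ih =>
    refine wordFiltration_succ_induction
      (fun a ha => adjoin_le_wordFiltration n (Subalgebra.mul_mem _ hc ha))
      (fun a ha => wordFiltration_mono n.le_succ (ih ha)) (fun w hw b hb => ?_)
      (fun a b ha hb => ?_) (fun r a ha => ?_) hb
    · rw [← mul_assoc, ← gen_mul_comm_of_mem_adjoin hort hw hc, mul_assoc]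
      exact gen_mul_mem_wordFiltration hw (ih hb)
    · rw [mul_add]; exact add_mem ha hb
    · rw [mul_smul_comm]; exact Submodule.smul_mem _ r ha

theorem exists_mem_wordFiltration (hort : ∀ w ∈ W, ∀ u ∈ U, τ w u = 0) {a : CCR τ}
    (ha : a ∈ Algebra.adjoin ℂ (gen τ '' (U ∪ W : Set V))) : ∃ n, a ∈ wordFiltration τ U W n := by
  suffices h : ∀ n, ∀ b ∈ wordFiltration τ U W n, ∃ m, a * b ∈ wordFiltration τ U W m by
    obtain ⟨m, hm⟩ := h 1 1 (adjoin_le_wordFiltration 0 (Subalgebra.one_mem _))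
    exact ⟨m, by rwa [mul_one] at hm⟩
  induction ha using Algebra.adjoin_induction with
  | mem x hx =>
    intro n b hb
    obtain ⟨v, hv | hv, rfl⟩ := hx
    · exact ⟨n, adjoin_mul_mem_wordFiltration hort (Algebra.subset_adjoin ⟨v, hv, rfl⟩) hb⟩
    · exact ⟨n + 1, gen_mul_mem_wordFiltration hv hb⟩
  | algebraMap r =>
    intro n b hb
    exact ⟨n, by rw [← Algebra.smul_def]; exact Submodule.smul_mem _ r hb⟩
  | add x y _ _ hx hy =>
    intro n b hb
    obtain ⟨m, hm⟩ := hx n b hb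
    obtain ⟨k, hk⟩ := hy n b hb
    exact ⟨max m k, by
      rw [add_mul]
      exact add_mem (wordFiltration_mono (le_max_left m k) hm)
        (wordFiltration_mono (le_max_right m k) hk)⟩
  | mul x y _ _ hx hy =>
    intro n b hb
    obtain ⟨m, hm⟩ := hy n b hb
    obtain ⟨k, hk⟩ := hx m _ hm
    exact ⟨k, by rwa [mul_assoc]⟩

theorem commutator_gen_mul (v w : V) (b : CCR τ) :
    gen τ v * (gen τ w * b) - gen τ w * b * gen τ v =
      (Complex.I * (τ v w : ℂ)) • b + gen τ w * (gen τ v * b - b * gen τ v) := by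
  rw [← mul_assoc, gen_comm τ v w, add_mul, mul_sub, Algebra.smul_def]
  simp only [mul_assoc]
  abel

/-- Commutators with generators orthogonal to `U` lower the length of words. -/
theorem commutator_mem_wordFiltration {y : V} (hy : ∀ u ∈ U, τ y u = 0) {n : ℕ} {b : CCR τ}
    (hb : b ∈ wordFiltration τ U W (n + 1)) :
    gen τ y * b - b * gen τ y ∈ wordFiltration τ U W n := by
  have hadd : ∀ (n : ℕ) (a b : CCR τ), gen τ y * a - a * gen τ y ∈ wordFiltration τ U W n →
      gen τ y * b - b * gen τ y ∈ wordFiltration τ U W n →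
      gen τ y * (a + b) - (a + b) * gen τ y ∈ wordFiltration τ U W n := fun n a b ha hb => by
    rw [mul_add, add_mul, add_sub_add_comm]; exact add_mem ha hb
  have hsmul : ∀ (n : ℕ) (r : ℂ) (a : CCR τ), gen τ y * a - a * gen τ y ∈ wordFiltration τ U W n →
      gen τ y * (r • a) - (r • a) * gen τ y ∈ wordFiltration τ U W n := fun n r a ha => by
    rw [mul_smul_comm, smul_mul_assoc, ← smul_sub]; exact Submodule.smul_mem _ r ha
  induction n generalizing b with
  | zero =>
    refine wordFiltration_succ_induction (fun a ha => ?_) (fun a ha => ?_) (fun w hw b hb => ?_)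
      (hadd 0) (hsmul 0) hb
    · rw [gen_mul_comm_of_mem_adjoin (W := Submodule.span ℝ {y}) ?_
        (Submodule.mem_span_singleton_self y) ha, sub_self]
      · exact zero_mem _
      · intro w hw u hu
        obtain ⟨r, rfl⟩ := Submodule.mem_span_singleton.1 hw
        rw [map_smul, LinearMap.smul_apply, hy u hu, smul_zero]
    · rw [(Submodule.mem_bot ℂ).1 ha, mul_zero, zero_mul, sub_self]
      exact zero_mem _
    · rw [(Submodule.mem_bot ℂ).1 hb, mul_zero, mul_zero, zero_mul, sub_self]
      exact zero_mem _
  | succ n ih =>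
    refine wordFiltration_succ_induction (fun a ha => ?_) (fun a ha => ?_) (fun w hw b hb => ?_)
      (hadd (n + 1)) (hsmul (n + 1)) hb
    · exact wordFiltration_mono n.le_succ (ih (adjoin_le_wordFiltration n ha))
    · exact wordFiltration_mono n.le_succ (ih ha)
    · rw [commutator_gen_mul]
      exact add_mem (Submodule.smul_mem _ _ hb) (gen_mul_mem_wordFiltration hw (ih hb))

/-- The number operator `∑ xᵢ [yᵢ, ·]` of a pair of dual families acts on words of length `n` as
multiplication by `i n`, up to shorter words. -/
theorem number_sub_mem_wordFiltration {ι : Type} [Fintype ι] {x y : ι → V}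
    (hy : ∀ i, ∀ u ∈ U, τ (y i) u = 0)
    (hxy : ∀ w ∈ W, ∑ i, τ (y i) w • x i = w) {n : ℕ} {b : CCR τ}
    (hb : b ∈ wordFiltration τ U W (n + 1)) :
    ∑ i, gen τ (x i) * (gen τ (y i) * b - b * gen τ (y i)) - (Complex.I * n) • b ∈
      wordFiltration τ U W n := by
  have hgen : ∀ w ∈ W, ∑ i, (τ (y i) w : ℂ) • gen τ (x i) = gen τ w := by
    intro w hw
    conv_rhs => rw [← hxy w hw]
    let g : V →+ CCR τ := AddMonoidHom.mk' (gen τ) (gen_add τ)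
    change _ = g _
    rw [map_sum]
    exact Finset.sum_congr rfl fun i _ => (gen_smul τ _ _).symm
  have hadd : ∀ (n : ℕ) (a b : CCR τ),
      ∑ i, gen τ (x i) * (gen τ (y i) * a - a * gen τ (y i)) - (Complex.I * n) • a ∈
        wordFiltration τ U W n →
      ∑ i, gen τ (x i) * (gen τ (y i) * b - b * gen τ (y i)) - (Complex.I * n) • b ∈
        wordFiltration τ U W n →
      ∑ i, gen τ (x i) * (gen τ (y i) * (a + b) - (a + b) * gen τ (y i)) -
        (Complex.I * n) • (a + b) ∈ wordFiltration τ U W n := by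
    intro n a b ha hb
    have h := add_mem ha hb
    rw [← add_sub_add_comm, ← Finset.sum_add_distrib, ← smul_add] at h
    simpa only [← mul_add, ← add_mul, ← add_sub_add_comm] using h
  have hsmul : ∀ (n : ℕ) (r : ℂ) (a : CCR τ),
      ∑ i, gen τ (x i) * (gen τ (y i) * a - a * gen τ (y i)) - (Complex.I * n) • a ∈
        wordFiltration τ U W n →
      ∑ i, gen τ (x i) * (gen τ (y i) * (r • a) - (r • a) * gen τ (y i)) -
        (Complex.I * n) • (r • a) ∈ wordFiltration τ U W n := by
    intro n r a ha
    have h := Submodule.smul_mem _ r ha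
    rw [smul_sub, Finset.smul_sum, smul_comm r] at h
    simpa only [mul_smul_comm, smul_mul_assoc, ← smul_sub] using h
  have hcomm : ∀ a ∈ Algebra.adjoin ℂ (gen τ '' U),
      ∑ i, gen τ (x i) * (gen τ (y i) * a - a * gen τ (y i)) = 0 := by
    intro a ha
    refine Finset.sum_eq_zero fun i _ => ?_
    have h := commutator_mem_wordFiltration (hy i) (adjoin_le_wordFiltration (W := W) 0 ha)
    rw [(Submodule.mem_bot ℂ).1 h, mul_zero]
  induction n generalizing b with
  | zero =>
    refine wordFiltration_succ_induction (fun a ha => ?_) (fun a ha => ?_) (fun w hw b hb => ?_)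
      (hadd 0) (hsmul 0) hb
    · rw [hcomm a ha]; simp
    · rw [(Submodule.mem_bot ℂ).1 ha]; simp
    · rw [(Submodule.mem_bot ℂ).1 hb]; simp
  | succ n ih =>
    refine wordFiltration_succ_induction (fun a ha => ?_) (fun a ha => ?_) (fun w hw b hb => ?_)
      (hadd (n + 1)) (hsmul (n + 1)) hb
    · rw [hcomm a ha, zero_sub]
      exact neg_mem (Submodule.smul_mem _ _ (adjoin_le_wordFiltration n ha))
    · have h1 := wordFiltration_mono n.le_succ (ih ha)
      have h2 := sub_mem h1 (Submodule.smul_mem _ Complex.I ha)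
      rw [sub_sub, ← add_smul] at h2
      push_cast
      rwa [mul_add, mul_one]
    -- commuting `xᵢ` past the first letter `w` costs terms `τ(xᵢ, w) [yᵢ, b]` with shorter words
    · have h1 : ∑ i, gen τ (x i) * (gen τ (y i) * (gen τ w * b) - gen τ w * b * gen τ (y i)) =
          Complex.I • (gen τ w * b) +
            gen τ w * ∑ i, gen τ (x i) * (gen τ (y i) * b - b * gen τ (y i)) +
            ∑ i, (Complex.I * (τ (x i) w : ℂ)) • (gen τ (y i) * b - b * gen τ (y i)) := by
        conv_rhs => rw [← hgen w hw, Finset.sum_mul, Finset.smul_sum, hgen w hw, Finset.mul_sum]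
        rw [← Finset.sum_add_distrib, ← Finset.sum_add_distrib]
        refine Finset.sum_congr rfl fun i _ => ?_
        rw [commutator_gen_mul, mul_add, ← mul_assoc, gen_comm τ (x i) w, add_mul, mul_smul_comm,
          ← Algebra.smul_def, smul_mul_assoc, smul_smul, mul_assoc, add_assoc]
      have h2 := gen_mul_mem_wordFiltration hw (ih hb)
      rw [mul_sub, mul_smul_comm] at h2
      have h3 : ∑ i, (Complex.I * (τ (x i) w : ℂ)) • (gen τ (y i) * b - b * gen τ (y i)) ∈
          wordFiltration τ U W (n + 1) :=
        sum_mem fun i _ => Submodule.smul_mem _ _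
          (wordFiltration_mono n.le_succ (commutator_mem_wordFiltration (hy i) hb))
      have h4 := add_mem h2 h3
      rw [h1]
      convert! h4 using 1
      push_cast
      rw [mul_add, mul_one, add_smul]
      abel

end wordFiltration

/-- A pair of dual families for a finite-dimensional space of vectors separated by the form. -/
theorem exists_dual_families (τ : V →ₗ[ℝ] V →ₗ[ℝ] ℝ) {W F : Submodule ℝ V} (hF : F ≤ W)
    [FiniteDimensional ℝ F] (hnd : ∀ w ∈ W, (∀ w' ∈ W, τ w' w = 0) → w = 0) :
    ∃ (k : ℕ) (x y : Fin k → V), (∀ i, y i ∈ W) ∧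
      ∀ w ∈ F, ∑ i, τ (y i) w • x i = w := by
  let T : W →ₗ[ℝ] Module.Dual ℝ F := τ.compl₁₂ W.subtype F.subtype
  have hT : LinearMap.range T = ⊤ := by
    rw [← Subspace.dualCoannihilator_dualAnnihilator_eq (W := LinearMap.range T)]
    have h : (LinearMap.range T).dualCoannihilator = ⊥ := by
      refine (Submodule.eq_bot_iff _).2 fun w hw => Subtype.ext (hnd w (hF w.2) fun w' hw' => ?_)
      exact (Submodule.mem_dualCoannihilator w).1 hw _ ⟨⟨w', hw'⟩, rfl⟩
    rw [h, Submodule.dualAnnihilator_bot]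
  let b := Module.finBasis ℝ F
  choose y hy using fun i => LinearMap.range_eq_top.1 hT (b.coord i)
  refine ⟨_, fun i => b i, fun i => y i, fun i => (y i).2, fun w hw => ?_⟩
  have h1 := congrArg (Subtype.val) (b.sum_repr ⟨w, hw⟩)
  rw [Submodule.coe_sum] at h1
  refine Eq.trans (Finset.sum_congr rfl fun i _ => ?_) h1
  have h2 : τ (y i) w = T (y i) ⟨w, hw⟩ := rfl
  rw [h2, hy]
  rfl

/-- Elements commuting with all generators from a nondegenerate summand `W` belong to the subalgebra
generated by the orthogonal summand `U`: the number operator of a finite-dimensional part of `W`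
annihilates them. -/
theorem mem_adjoin_of_commute {U W : Submodule ℝ V} (hUW : U ⊔ W = ⊤)
    (hort : ∀ w ∈ W, ∀ u ∈ U, τ w u = 0) (hnd : ∀ w ∈ W, (∀ w' ∈ W, τ w' w = 0) → w = 0)
    {a : CCR τ} (ha : ∀ w ∈ W, gen τ w * a = a * gen τ w) :
    a ∈ Algebra.adjoin ℂ (gen τ '' U) := by
  -- only finitely many generators from `W` occur in `a`
  obtain ⟨F, hF, hfin, hmem⟩ : ∃ F ≤ W, FiniteDimensional ℝ F ∧
      a ∈ Algebra.adjoin ℂ (gen τ '' (U ∪ F : Set V)) := by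
    clear ha
    have hmono : ∀ {F F' : Submodule ℝ V}, F ≤ F' →
        Algebra.adjoin ℂ (gen τ '' (U ∪ F : Set V)) ≤
          Algebra.adjoin ℂ (gen τ '' (U ∪ F' : Set V)) := fun h =>
      Algebra.adjoin_mono (Set.image_mono (Set.union_subset_union_right _ h))
    induction a using CCR.induction with
    | halg c => exact ⟨⊥, bot_le, inferInstance, Subalgebra.algebraMap_mem _ c⟩
    | hgen v =>
      obtain ⟨u, hu, w, hw, rfl⟩ := Submodule.mem_sup.1 (hUW ▸ Submodule.mem_top : v ∈ U ⊔ W)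
      refine ⟨Submodule.span ℝ {w}, (Submodule.span_singleton_le_iff_mem w W).2 hw,
        inferInstance, ?_⟩
      rw [gen_add]
      exact add_mem (Algebra.subset_adjoin ⟨u, Or.inl hu, rfl⟩)
        (Algebra.subset_adjoin ⟨w, Or.inr (Submodule.mem_span_singleton_self w), rfl⟩)
    | hadd a b ha hb =>
      obtain ⟨F, hF, hfin, ha⟩ := ha
      obtain ⟨F', hF', hfin', hb⟩ := hb
      exact ⟨F ⊔ F', sup_le hF hF', inferInstance,
        add_mem (hmono le_sup_left ha) (hmono le_sup_right hb)⟩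
    | hmul a b ha hb =>
      obtain ⟨F, hF, hfin, ha⟩ := ha
      obtain ⟨F', hF', hfin', hb⟩ := hb
      exact ⟨F ⊔ F', sup_le hF hF', inferInstance,
        mul_mem (hmono le_sup_left ha) (hmono le_sup_right hb)⟩
  obtain ⟨k, x, y, hy, hxy⟩ := exists_dual_families τ hF hnd
  have hortF : ∀ w ∈ F, ∀ u ∈ U, τ w u = 0 := fun w hw => hort w (hF hw)
  obtain ⟨n, hn⟩ := exists_mem_wordFiltration hortF hmem
  induction n with
  | zero => rw [(Submodule.mem_bot ℂ).1 hn]; exact zero_mem _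
  | succ n ih =>
    have h := number_sub_mem_wordFiltration (fun i => hort _ (hy i)) hxy hn
    simp only [ha _ (hy _), sub_self, mul_zero, Finset.sum_const_zero, zero_sub] at h
    rcases n with _ | n
    · refine wordFiltration_succ_induction (p := fun a => a ∈ Algebra.adjoin ℂ (gen τ '' U))
        (fun _ h => h) (fun a ha => ?_) (fun w _ b hb => ?_) (fun _ _ => add_mem)
        (fun r a ha => Subalgebra.smul_mem _ ha r) hn
      · rw [(Submodule.mem_bot ℂ).1 ha]; exact zero_mem _
      · rw [(Submodule.mem_bot ℂ).1 hb, mul_zero]; exact zero_mem _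
    · have h0 : Complex.I * ((n + 1 : ℕ) : ℂ) ≠ 0 :=
        mul_ne_zero Complex.I_ne_zero (Nat.cast_ne_zero.2 n.succ_ne_zero)
      exact ih ((Submodule.smul_mem_iff _ h0).1 (neg_mem_iff.1 h))

end CCR

/-! ### Light-cone coordinates adapted to a chirality -/

/-- The opposite light-cone direction. -/
def Chirality.other : Chirality → Chirality
  | .plus => .minus
  | .minus => .plus

theorem Chirality.other_other (s : Chirality) : s.other.other = s := by cases s <;> rfl

/-- The point with coordinate `t` in the direction `s` and coordinate `u` in the other direction. -/
def Chirality.point : Chirality → ℝ → ℝ → ℝ × ℝ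
  | .plus => fun t u => (t, u)
  | .minus => fun t u => (u, t)

theorem Chirality.coord_point (s : Chirality) (t u : ℝ) : s.coord (s.point t u) = t := by
  cases s <;> rfl

theorem Chirality.other_coord_point (s : Chirality) (t u : ℝ) :
    s.other.coord (s.point t u) = u := by
  cases s <;> rfl

theorem Chirality.point_coord (s : Chirality) (x : ℝ × ℝ) :
    s.point (s.coord x) (s.other.coord x) = x := by
  cases s <;> rfl

theorem Chirality.other_point (s : Chirality) (t u : ℝ) : s.other.point u t = s.point t u := by
  cases s <;> rfl

theorem Chirality.point_add (s : Chirality) (t u t' u' : ℝ) :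
    s.point t u + s.point t' u' = s.point (t + t') (u + u') := by
  cases s <;> rfl

theorem Chirality.point_fst_add_snd (s : Chirality) (t u : ℝ) :
    (s.point t u).1 + (s.point t u).2 = t + u := by
  cases s
  · rfl
  · exact add_comm u t

theorem Chirality.contDiff_point (s : Chirality) :
    ContDiff ℝ ∞ fun q : ℝ × ℝ => s.point q.1 q.2 := by
  cases s
  · exact contDiff_id
  · exact contDiff_snd.prodMk contDiff_fst

theorem Chirality.norm_point (s : Chirality) (t u : ℝ) : ‖s.point t u‖ = max |t| |u| := by
  cases s
  · rfl
  · exact max_comm _ _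

/-- The coefficient of a `1`-form that survives on `dualForms X s`: that of `dx⁻` for the chirality
`+`, and that of `dx⁺` for the chirality `-`. -/
noncomputable def coeff {X : Spacetime} : Chirality → OneForm X →ₗ[ℝ] Test X
  | .plus => LinearMap.snd ℝ _ _
  | .minus => LinearMap.fst ℝ _ _

/-- The `1`-form with a prescribed coefficient in `dualForms X s`. -/
noncomputable def ofCoeff {X : Spacetime} : Chirality → Test X →ₗ[ℝ] OneForm X
  | .plus => LinearMap.inr ℝ _ _
  | .minus => LinearMap.inl ℝ _ _

section forms

variable {X Y : Spacetime} (s : Chirality)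

theorem coeff_ofCoeff (b : Test X) : coeff s (ofCoeff s b) = b := by cases s <;> rfl

theorem coeff_other_ofCoeff (b : Test X) : coeff s.other (ofCoeff s b) = 0 := by cases s <;> rfl

theorem ofCoeff_add_ofCoeff (α : OneForm X) :
    ofCoeff s (coeff s α) + ofCoeff s.other (coeff s.other α) = α := by
  cases s
  · exact Prod.ext (zero_add _) (add_zero _)
  · exact Prod.ext (add_zero _) (zero_add _)

theorem mem_dualForms_iff {α : OneForm X} : α ∈ dualForms X s ↔ coeff s.other α = 0 := by
  obtain ⟨a, b⟩ := α
  have h2 : ∀ c : Test X, c + c = 0 ↔ c = 0 := fun c => by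
    rw [← two_smul ℝ c, smul_eq_zero_iff_right (two_ne_zero' ℝ)]
  rw [dualForms, LinearMap.mem_ker]
  cases s
  · have h : (hodge - Chirality.plus.hodgeSign • LinearMap.id : OneForm X →ₗ[ℝ] OneForm X) (a, b) =
        (a + a, 0) := by
      simp [hodge, Chirality.hodgeSign]
    rw [h, Prod.mk_eq_zero, h2]
    exact and_iff_left rfl
  · have h : (hodge - Chirality.minus.hodgeSign • LinearMap.id : OneForm X →ₗ[ℝ] OneForm X) (a, b) =
        (0, -(b + b)) := by
      simp [hodge, Chirality.hodgeSign, sub_eq_add_neg]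
    rw [h, Prod.mk_eq_zero, neg_eq_zero, h2]
    exact and_iff_right rfl

theorem ofCoeff_mem_dualForms (b : Test X) : ofCoeff s b ∈ dualForms X s :=
  (mem_dualForms_iff s).2 (coeff_other_ofCoeff s b)

theorem eq_ofCoeff_of_mem_dualForms {α : OneForm X} (h : α ∈ dualForms X s) :
    α = ofCoeff s (coeff s α) := by
  conv_lhs => rw [← ofCoeff_add_ofCoeff s α, (mem_dualForms_iff s).1 h, map_zero, add_zero]

theorem dualD_eq (φ : Test X) : dualD X s φ = ofCoeff s (pd s.other φ) := by
  have h2 : ∀ c : Test X, (1 / 2 : ℝ) • (c + c) = c := fun c => by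
    rw [← two_smul ℝ c, smul_smul]; norm_num
  cases s
  · have h : dualD X .plus φ = (0, (1 / 2 : ℝ) • (pd .minus φ + pd .minus φ)) := by
      simp [dualD, hodge, Chirality.hodgeSign, dZero]
    rw [h, h2]; rfl
  · have h : dualD X .minus φ = ((1 / 2 : ℝ) • (pd .plus φ + pd .plus φ), 0) := by
      simp [dualD, hodge, Chirality.hodgeSign, dZero]
    rw [h, h2]; rfl

theorem ofCoeff_pd_mem_trivialForms (φ : Test X) : ofCoeff s (pd s.other φ) ∈ trivialForms X := by
  rw [← dualD_eq]
  refine Submodule.smul_mem _ _ (add_mem (Submodule.mem_sup_left ⟨φ, rfl⟩)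
    (Submodule.smul_mem _ s.hodgeSign (Submodule.mem_sup_right ⟨φ, rfl⟩)))

theorem coeff_of_mem_trivialForms {α : OneForm X} (h : α ∈ trivialForms X) :
    ∃ φ, coeff s α = pd s.other φ := by
  obtain ⟨_, ⟨φ, rfl⟩, _, ⟨ψ, rfl⟩, rfl⟩ := Submodule.mem_sup.1 h
  cases s
  · exact ⟨φ - ψ, by rw [map_sub, sub_eq_add_neg]; rfl⟩
  · exact ⟨φ + ψ, by rw [map_add, map_add]; rfl⟩

theorem mem_trivialForms_of_coeff {α : OneForm X}
    (h : ∀ s, ∃ φ, coeff s α = pd s.other φ) : α ∈ trivialForms X := by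
  obtain ⟨φ, hφ⟩ := h .plus
  obtain ⟨ψ, hψ⟩ := h .minus
  rw [← ofCoeff_add_ofCoeff .plus α]
  exact add_mem (by rw [hφ]; exact ofCoeff_pd_mem_trivialForms _ _)
    (by rw [show Chirality.plus.other = .minus from rfl, hψ]; exact ofCoeff_pd_mem_trivialForms _ _)

theorem fibreIntegral_eq (α : OneForm .mink) (t : ℝ) :
    fibreIntegral s α t = ∫ u, (coeff s α).1 (s.point t u) := by
  cases s <;> rfl

theorem dOne_ofCoeff (b : Test X) (x : ℝ × ℝ) :
    (dOne (ofCoeff s b)).1 x = s.hodgeSign * (pd s b).1 x := by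
  cases s
  · change fderiv ℝ (fun _ => (0 : ℝ)) x _ - (pd .plus b).1 x = -1 * (pd .plus b).1 x
    simp
  · change (pd .minus b).1 x - fderiv ℝ (fun _ => (0 : ℝ)) x _ = 1 * (pd .minus b).1 x
    simp

end forms

/-! ### Fibre integrals and primitives along the fibres -/

namespace Test

variable {X : Spacetime} (s : Chirality) (b : Test X)

theorem contDiff_slice (t : ℝ) : ContDiff ℝ ∞ fun u => b.1 (s.point t u) :=
  (IsTest.smooth b.2).comp (s.contDiff_point.comp (contDiff_const.prodMk contDiff_id))

theorem hasDerivAt_slice (t u : ℝ) :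
    HasDerivAt (fun u => b.1 (s.point t u)) ((pd s.other b).1 (s.point t u)) u := by
  have hb := (((IsTest.smooth b.2).differentiable (by simp)) (s.point t u)).hasFDerivAt
  have hp : HasDerivAt (fun u => s.point t u) s.other.dir u := by
    cases s
    · exact (hasDerivAt_const u t).prodMk (hasDerivAt_id u)
    · exact (hasDerivAt_id u).prodMk (hasDerivAt_const u t)
  exact hb.comp_hasDerivAt u hp

theorem exists_bound : ∃ R, 0 ≤ R ∧ ∀ s : Chirality, ∀ t u, b.1 (s.point t u) ≠ 0 →
    |t + u| ≤ R ∧ (X = .mink → |t| ≤ R ∧ |u| ≤ R) := by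
  obtain ⟨R, hR⟩ := Test.bound b
  refine ⟨|R|, abs_nonneg R, fun s t u h => ?_⟩
  obtain ⟨h1, h2⟩ := hR _ h
  rw [s.point_fst_add_snd] at h1
  rw [s.norm_point] at h2
  exact ⟨h1.trans (le_abs_self R), fun hX => max_le_iff.1 ((h2 hX).trans (le_abs_self R))⟩

theorem hasCompactSupport_slice (t : ℝ) : HasCompactSupport fun u => b.1 (s.point t u) := by
  obtain ⟨R, -, hR⟩ := exists_bound b
  refine HasCompactSupport.intro (isCompact_Icc (a := -t - R) (b := -t + R)) fun u hu => ?_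
  by_contra h
  have h1 := abs_le.1 (hR s t u h).1
  exact hu ⟨by linarith [h1.1], by linarith [h1.2]⟩

theorem integrable_slice (t : ℝ) : Integrable fun u => b.1 (s.point t u) :=
  (contDiff_slice s b t).continuous.integrable_of_hasCompactSupport (hasCompactSupport_slice s b t)

/-- Smooth dependence of convolutions along the fibres on the base point. -/
theorem contDiff_fibre_convolution {f : ℝ → ℝ} (hf : LocallyIntegrable f) :
    ContDiff ℝ ∞ fun q : ℝ × ℝ => ∫ w, f w * b.1 (s.point q.1 (q.2 - w)) := by
  obtain ⟨R, -, hR⟩ := exists_bound b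
  refine contDiff_iff_contDiffAt.2 fun q₀ => ?_
  have h := contDiffOn_convolution_right_with_param (𝕜 := ℝ) (μ := volume) (n := ⊤)
    (ContinuousLinearMap.mul ℝ ℝ) (f := f) (g := fun t u => b.1 (s.point t u))
    (s := Metric.ball q₀.1 1)
    (k := Set.Icc (-(|q₀.1| + 1) - R) ((|q₀.1| + 1) + R)) Metric.isOpen_ball isCompact_Icc
    (fun t u ht hu => by
      by_contra hc
      have h1 := abs_le.1 (hR s t u hc).1
      rw [Metric.mem_ball, Real.dist_eq] at ht
      have h2 := abs_lt.1 ht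
      have h3 := le_abs_self q₀.1
      have h4 := neg_abs_le q₀.1
      exact hu ⟨by linarith [h1.1], by linarith [h1.2]⟩) hf
    ((IsTest.smooth b.2).comp s.contDiff_point).contDiffOn
  exact h.contDiffAt (prod_mem_nhds (Metric.ball_mem_nhds _ one_pos) Filter.univ_mem)

/-- The fibre integral, a function of the coordinate in the direction `s`. -/
noncomputable def fibre (t : ℝ) : ℝ := ∫ u, b.1 (s.point t u)

theorem contDiff_fibre : ContDiff ℝ ∞ (fibre s b) := by
  have h := (contDiff_fibre_convolution s b (f := fun _ => 1)
    (locallyIntegrable_const 1)).comp (contDiff_id.prodMk (contDiff_const (c := (0 : ℝ))))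
  have e : fibre s b = fun t => ∫ w, 1 * b.1 (s.point t (0 - w)) := funext fun t => by
    simp only [one_mul]
    exact (integral_sub_left_eq_self (fun u => b.1 (s.point t u)) volume 0).symm
  rw [e]
  exact h

theorem fibre_pd_other (t : ℝ) : fibre s (pd s.other b) t = 0 := by
  refine integral_eq_zero_of_hasDerivAt_of_integrable (f := fun u => b.1 (s.point t u))
    (hasDerivAt_slice s b t) (integrable_slice s (pd s.other b) t) (integrable_slice s b t)

/-- The primitive along the fibres that vanishes in the past. -/
noncomputable def primitive (x : ℝ × ℝ) : ℝ :=
  ∫ u in Set.Iic (s.other.coord x), b.1 (s.point (s.coord x) u)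

theorem primitive_point (t v : ℝ) :
    primitive s b (s.point t v) = ∫ u in Set.Iic v, b.1 (s.point t u) := by
  rw [primitive, s.coord_point, s.other_coord_point]

theorem contDiff_primitive : ContDiff ℝ ∞ (primitive s b) := by
  have h := (contDiff_fibre_convolution s b (f := (Set.Ici (0 : ℝ)).indicator fun _ => 1)
    ((locallyIntegrable_const 1).indicator measurableSet_Ici)).comp (f := fun x : ℝ × ℝ =>
      (s.coord x, s.other.coord x)) (by
        cases s
        · exact contDiff_id
        · exact contDiff_snd.prodMk contDiff_fst)
  have e : primitive s b = fun x => ∫ w, (Set.Ici (0 : ℝ)).indicator (fun _ => 1) w *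
      b.1 (s.point (s.coord x) (s.other.coord x - w)) := funext fun x => by
    rw [primitive, ← integral_indicator measurableSet_Iic, ← integral_sub_left_eq_self
      (fun w => (Set.Ici (0 : ℝ)).indicator (fun _ => 1) w * _) volume (s.other.coord x)]
    refine integral_congr_ae (Filter.Eventually.of_forall fun u => ?_)
    simp [Set.indicator]
  rw [e]
  exact h

theorem hasDerivAt_primitive (t v : ℝ) :
    HasDerivAt (fun v => primitive s b (s.point t v)) (b.1 (s.point t v)) v := by
  have hc := (contDiff_slice s b t).continuous
  have hi := integrable_slice s b t
  have h1 : (fun v => primitive s b (s.point t v)) = fun v =>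
      (∫ u in (0 : ℝ)..v, b.1 (s.point t u)) + ∫ u in Set.Iic 0, b.1 (s.point t u) := by
    funext v
    rw [primitive_point, ← intervalIntegral.integral_Iic_sub_Iic hi.integrableOn hi.integrableOn]
    ring
  rw [h1]
  exact (hc.integral_hasStrictDerivAt 0 v).hasDerivAt.add_const _

end Test

/-- Smooth periodic functions supported in a bounded neighbourhood of a Cauchy surface, and
supported in a bounded set in the case of Minkowski spacetime, are test functions. -/
theorem isTest_of_bound {X : Spacetime} {φ : ℝ × ℝ → ℝ} (h1 : ContDiff ℝ ∞ φ)
    (h2 : ∀ γ ∈ X.deck, ∀ x, φ (x + γ) = φ x) (s : Chirality) (R : ℝ)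
    (h3 : ∀ t u, φ (s.point t u) ≠ 0 → |t + u| ≤ R ∧ (X = .mink → |t| ≤ R ∧ |u| ≤ R)) :
    IsTest X φ := by
  refine ⟨h1, h2, Metric.closedBall 0 (|R| + 1), isCompact_closedBall _ _, fun x hx => ?_⟩
  have h0 := le_abs_self R
  cases X
  · refine ⟨0, zero_mem _, ?_⟩
    rw [← s.point_coord x] at hx
    have h := (h3 _ _ hx).2 rfl
    rw [add_zero, mem_closedBall_zero_iff, ← s.point_coord x, s.norm_point]
    exact max_le (by linarith [h.1]) (by linarith [h.2])
  · obtain ⟨γ, hγ, -⟩ := Spacetime.fundDom_unique .cyl x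
    obtain ⟨a1, a2⟩ := hγ
    refine ⟨γ, γ.2, ?_⟩
    rw [← h2 γ γ.2, add_comm, ← s.point_coord ((γ : ℝ × ℝ) + x)] at hx
    have h := (h3 _ _ hx).1
    rw [← s.point_fst_add_snd, s.point_coord] at h
    have h5 := abs_le.1 h
    rw [add_comm x, mem_closedBall_zero_iff, Prod.norm_def, Real.norm_eq_abs, Real.norm_eq_abs]
    have h6 := abs_nonneg R
    exact max_le (abs_le.2 ⟨by linarith, by linarith⟩) (abs_le.2 ⟨by linarith, by linarith⟩)

theorem Chirality.eq_point_of_mem_deck {X : Spacetime} (s : Chirality) {γ : ℝ × ℝ}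
    (hγ : γ ∈ X.deck) : ∃ n : ℝ, γ = s.point n (-n) := by
  rcases IsLift.deck_cases hγ with ⟨-, rfl⟩ | ⟨-, n, rfl⟩
  · exact ⟨0, by rw [neg_zero]; cases s <;> rfl⟩
  · cases s
    · exact ⟨n, rfl⟩
    · exact ⟨-n, by simp [Chirality.point]⟩

/-- Test functions with vanishing fibre integrals are derivatives along the fibres. -/
theorem Test.exists_pd_other_eq {X : Spacetime} (s : Chirality) (b : Test X)
    (hb : ∀ t, Test.fibre s b t = 0) : ∃ g : Test X, pd s.other g = b := by
  have hper : ∀ γ ∈ X.deck, ∀ x, Test.primitive s b (x + γ) = Test.primitive s b x := by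
    intro γ hγ x
    obtain ⟨n, hn⟩ := s.eq_point_of_mem_deck hγ
    rw [← s.point_coord x]
    set t := s.coord x
    set v := s.other.coord x
    rw [hn, s.point_add, Test.primitive_point, Test.primitive_point,
      ← integral_indicator measurableSet_Iic, ← integral_indicator measurableSet_Iic, ← integral_add_right_eq_self _ (-n)]
    refine integral_congr_ae (Filter.Eventually.of_forall fun u => ?_)
    have h1 : b.1 (s.point (t + n) (u + -n)) = b.1 (s.point t u) := by
      rw [← s.point_add, ← hn]
      exact IsTest.periodic b.2 γ hγ _
    beta_reduce
    by_cases hu : u ≤ v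
    · rw [Set.indicator_of_mem (Set.mem_Iic.2 hu), Set.indicator_of_mem, h1]
      exact Set.mem_Iic.2 (by linarith)
    · rw [Set.indicator_of_notMem (fun h => hu (Set.mem_Iic.1 h)), Set.indicator_of_notMem]
      exact fun h => hu (by linarith [Set.mem_Iic.1 h])
  obtain ⟨R, hR0, hR⟩ := Test.exists_bound b
  -- where the primitive is nonzero, `b` is nonzero both before and after on the same fibre, as its
  -- integral over the fibre vanishes
  have hsupp : ∀ t v, Test.primitive s b (s.point t v) ≠ 0 →
      |t + v| ≤ R ∧ (X = .mink → |t| ≤ R ∧ |v| ≤ R) := by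
    intro t v h
    obtain ⟨u, hu, hu'⟩ : ∃ u ≤ v, b.1 (s.point t u) ≠ 0 := by
      by_contra! hc
      rw [Test.primitive_point] at h
      exact h (setIntegral_eq_zero_of_forall_eq_zero fun u hu => hc u hu)
    obtain ⟨w, hw, hw'⟩ : ∃ w ≥ v, b.1 (s.point t w) ≠ 0 := by
      by_contra! hc
      rw [Test.primitive_point, setIntegral_eq_integral_of_forall_compl_eq_zero
        (s := Set.Iic v) (fun u hu => hc u (le_of_lt (not_le.1 hu)))] at h
      exact h (hb t)
    obtain ⟨a1, a2⟩ := hR s t u hu'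
    obtain ⟨c1, c2⟩ := hR s t w hw'
    rw [abs_le] at a1 c1
    refine ⟨abs_le.2 ⟨by linarith, by linarith⟩, fun hX => ⟨(a2 hX).1, ?_⟩⟩
    have a3 := abs_le.1 (a2 hX).2
    have c3 := abs_le.1 (c2 hX).2
    exact abs_le.2 ⟨by linarith, by linarith⟩
  refine ⟨⟨Test.primitive s b, isTest_of_bound (Test.contDiff_primitive s b) hper s R hsupp⟩,
    Subtype.ext (funext fun x => ?_)⟩
  rw [← s.point_coord x]
  exact (Test.hasDerivAt_slice s _ _ _).unique (Test.hasDerivAt_primitive s b _ _)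

/-! ### The Poisson structure in terms of fibre integrals -/

theorem Chirality.hodgeSign_mul_self (s : Chirality) : s.hodgeSign * s.hodgeSign = 1 := by
  cases s <;> norm_num [Chirality.hodgeSign]

theorem Chirality.continuous_coord (s : Chirality) : Continuous s.coord := by
  cases s
  · exact continuous_fst
  · exact continuous_snd

/-- Fubini's theorem in the light-cone coordinates adapted to a chirality. -/
theorem setIntegral_point (s : Chirality) {A C : Set ℝ} {F : ℝ × ℝ → ℝ}
    (hF : IntegrableOn F {x | s.coord x ∈ A ∧ s.other.coord x ∈ C}) :
    ∫ x in {x | s.coord x ∈ A ∧ s.other.coord x ∈ C}, F x =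
      ∫ u in C, ∫ t in A, F (s.point t u) := by
  cases s
  · change IntegrableOn F (A ×ˢ C) at hF
    change ∫ x in A ×ˢ C, F x = ∫ u in C, ∫ t in A, F (t, u)
    rw [IntegrableOn, Measure.volume_eq_prod, ← Measure.prod_restrict] at hF
    rw [Measure.volume_eq_prod, ← Measure.prod_restrict, integral_prod_symm _ hF]
  · have h : {x : ℝ × ℝ | Chirality.minus.coord x ∈ A ∧ Chirality.minus.other.coord x ∈ C} =
        C ×ˢ A := Set.ext fun x => and_comm
    rw [h] at hF ⊢
    change _ = ∫ u in C, ∫ t in A, F (u, t)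
    rw [Measure.volume_eq_prod] at hF ⊢
    exact setIntegral_prod _ hF

theorem integral_point (s : Chirality) {F : ℝ × ℝ → ℝ} (hF : Integrable F) :
    ∫ x, F x = ∫ u, ∫ t, F (s.point t u) := by
  have h := setIntegral_point s (A := Set.univ) (C := Set.univ) (F := F) (by
    simpa using hF)
  simpa using h

theorem integral_point' (s : Chirality) {F : ℝ × ℝ → ℝ} (hF : Integrable F) :
    ∫ x, F x = ∫ t, ∫ u, F (s.point t u) := by
  rw [integral_point s.other hF]
  simp only [s.other_point]

namespace Test

variable {X : Spacetime} (s : Chirality) (b : Test X)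

theorem hasDerivAt_slice' (t u : ℝ) :
    HasDerivAt (fun t => b.1 (s.point t u)) ((pd s b).1 (s.point t u)) t := by
  have h := hasDerivAt_slice s.other b u t
  rw [s.other_other] at h
  simpa only [s.other_point] using h

theorem contDiff_slice' (u : ℝ) : ContDiff ℝ ∞ fun t => b.1 (s.point t u) := by
  have h := contDiff_slice s.other b u
  simpa only [s.other_point] using h

theorem hasCompactSupport_slice' (u : ℝ) : HasCompactSupport fun t => b.1 (s.point t u) := by
  have h := hasCompactSupport_slice s.other b u
  simpa only [s.other_point] using h

theorem hasCompactSupport (b : Test .mink) : HasCompactSupport b.1 := by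
  obtain ⟨R, -, hR⟩ := exists_bound b
  refine HasCompactSupport.intro (isCompact_closedBall (0 : ℝ × ℝ) R) fun x hx => ?_
  by_contra h
  have h1 := (hR .plus x.1 x.2 h).2 rfl
  exact hx (mem_closedBall_zero_iff.2 (max_le h1.1 h1.2))

theorem integrable_mul_coord (b : Test .mink) (s : Chirality) {g : ℝ → ℝ} (hg : Continuous g) :
    Integrable fun x => b.1 x * g (s.coord x) :=
  ((IsTest.smooth b.2).continuous.mul (hg.comp s.continuous_coord)).integrable_of_hasCompactSupport
    (hasCompactSupport b).mul_right

theorem integral_Iic_pd (x : ℝ × ℝ) :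
    ∫ y in Set.Iic x, (pd s b).1 y =
      ∫ u in Set.Iic (s.other.coord x), b.1 (s.point (s.coord x) u) := by
  have h : Set.Iic x = {y | s.coord y ∈ Set.Iic (s.coord x) ∧
      s.other.coord y ∈ Set.Iic (s.other.coord x)} := by
    cases s
    · exact Set.ext fun y => Prod.le_def
    · exact Set.ext fun y => Prod.le_def.trans and_comm
  have hi := (Test.integrableOn_cone (pd s b) x).1
  rw [h] at hi ⊢
  rw [setIntegral_point s hi]
  refine integral_congr_ae (Filter.Eventually.of_forall fun u => ?_)
  have hd : deriv (fun t => b.1 (s.point t u)) = fun t => (pd s b).1 (s.point t u) :=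
    funext fun t => (hasDerivAt_slice' s b t u).deriv
  have h1 := (hasCompactSupport_slice' s b u).integral_Iic_deriv_eq
    ((contDiff_slice' s b u).of_le (by exact_mod_cast le_top)) (s.coord x)
  rwa [hd] at h1

theorem integral_Ici_pd (x : ℝ × ℝ) :
    ∫ y in Set.Ici x, (pd s b).1 y =
      -∫ u in Set.Ioi (s.other.coord x), b.1 (s.point (s.coord x) u) := by
  have h : Set.Ici x = {y | s.coord y ∈ Set.Ici (s.coord x) ∧
      s.other.coord y ∈ Set.Ici (s.other.coord x)} := by
    cases s
    · exact Set.ext fun y => Prod.le_def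
    · exact Set.ext fun y => Prod.le_def.trans and_comm
  have hi := (Test.integrableOn_cone (pd s b) x).2
  rw [h] at hi ⊢
  rw [setIntegral_point s hi, integral_Ici_eq_integral_Ioi, ← integral_neg]
  refine integral_congr_ae (Filter.Eventually.of_forall fun u => ?_)
  have hd : deriv (fun t => b.1 (s.point t u)) = fun t => (pd s b).1 (s.point t u) :=
    funext fun t => (hasDerivAt_slice' s b t u).deriv
  have h1 := (hasCompactSupport_slice' s b u).integral_Ioi_deriv_eq
    ((contDiff_slice' s b u).of_le (by exact_mod_cast le_top)) (s.coord x)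
  rw [hd] at h1
  beta_reduce
  rwa [integral_Ici_eq_integral_Ioi]

end Test

/-- The causal propagator applied to the differential of a chiral `1`-form is, up to a factor, the
fibre integral of the form. -/
theorem causalProp_dOne_ofCoeff {X : Spacetime} (s : Chirality) (b : Test X) (x : ℝ × ℝ) :
    causalProp (dOne (ofCoeff s b)).1 x = s.hodgeSign / 2 * Test.fibre s b (s.coord x) := by
  have h0 : (dOne (ofCoeff s b)).1 = fun y => s.hodgeSign * (pd s b).1 y :=
    funext (dOne_ofCoeff s b)
  have hi := Test.integrable_slice s b (s.coord x)
  rw [causalProp, greenRet, greenAdv, h0, integral_const_mul, integral_const_mul,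
    Test.integral_Iic_pd, Test.integral_Ici_pd, Test.fibre,
    ← intervalIntegral.integral_Iic_add_Ioi (b := s.other.coord x) hi.integrableOn hi.integrableOn]
  ring

theorem poisson_mk_ofCoeff (s : Chirality) (α : OneForm .mink) (b : Test .mink) :
    poisson .mink (Submodule.Quotient.mk α) (Submodule.Quotient.mk (ofCoeff s b)) =
      ∫ x, (dOne α).1 x * (s.hodgeSign / 2 * Test.fibre s b (s.coord x)) := by
  rw [poisson_mk, integralOver, Spacetime.fundDom, setIntegral_univ]
  simp only [causalProp_dOne_ofCoeff]

theorem poisson_skew {X : Spacetime} (v w : LinObs X) : poisson X v w = -poisson X w v := by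
  obtain ⟨α, rfl⟩ := Submodule.Quotient.mk_surjective _ v
  obtain ⟨β, rfl⟩ := Submodule.Quotient.mk_surjective _ w
  exact pairing_skew (dOne α) (dOne β)

theorem poisson_ofCoeff_other (s : Chirality) (a b : Test .mink) :
    poisson .mink (Submodule.Quotient.mk (ofCoeff s a))
      (Submodule.Quotient.mk (ofCoeff s.other b)) = 0 := by
  rw [poisson_mk_ofCoeff]
  have h1 : (fun x => (dOne (ofCoeff s a)).1 x *
      (s.other.hodgeSign / 2 * Test.fibre s.other b (s.other.coord x))) = fun x =>
      s.hodgeSign * (s.other.hodgeSign / 2) *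
        ((pd s a).1 x * Test.fibre s.other b (s.other.coord x)) := funext fun x => by
    rw [dOne_ofCoeff]
    ring
  rw [h1, integral_const_mul, integral_point s (Test.integrable_mul_coord (pd s a) s.other
    (Test.contDiff_fibre s.other b).continuous)]
  refine mul_eq_zero_of_right _ ?_
  rw [← integral_zero ℝ ℝ]
  refine integral_congr_ae (Filter.Eventually.of_forall fun u => ?_)
  simp only [s.other_coord_point, integral_mul_const]
  have h2 := Test.fibre_pd_other s.other a u
  rw [s.other_other] at h2
  simp only [Test.fibre, s.other_point] at h2
  rw [h2, zero_mul]

theorem poisson_ofCoeff (s : Chirality) (a b : Test .mink) :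
    poisson .mink (Submodule.Quotient.mk (ofCoeff s a)) (Submodule.Quotient.mk (ofCoeff s b)) =
      -(1 / 2) * ∫ t, Test.fibre s a t * deriv (Test.fibre s b) t := by
  have hψ : ContDiff ℝ ∞ (Test.fibre s b) := Test.contDiff_fibre s b
  have hψ' : Continuous (deriv (Test.fibre s b)) := (contDiff_infty_iff_deriv.1 hψ).2.continuous
  rw [poisson_mk_ofCoeff]
  have h1 : (fun x => (dOne (ofCoeff s a)).1 x *
      (s.hodgeSign / 2 * Test.fibre s b (s.coord x))) = fun x =>
      1 / 2 * ((pd s a).1 x * Test.fibre s b (s.coord x)) := funext fun x => by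
    rw [dOne_ofCoeff]
    linear_combination (1 / 2 * ((pd s a).1 x * Test.fibre s b (s.coord x))) * s.hodgeSign_mul_self
  have h2 : ∫ x, (pd s a).1 x * Test.fibre s b (s.coord x) =
      -∫ x, a.1 x * deriv (Test.fibre s b) (s.coord x) := by
    rw [integral_point s (Test.integrable_mul_coord (pd s a) s hψ.continuous),
      integral_point s (Test.integrable_mul_coord a s hψ'), ← integral_neg]
    refine integral_congr_ae (Filter.Eventually.of_forall fun u => ?_)
    simp only [s.coord_point]
    have hc := (Test.hasCompactSupport_slice' s a u)
    have hc' := (Test.hasCompactSupport_slice' s (pd s a) u)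
    have ha := (Test.contDiff_slice' s a u).continuous
    have ha' := (Test.contDiff_slice' s (pd s a) u).continuous
    have h3 := integral_mul_deriv_eq_deriv_mul_of_integrable (A := ℝ)
      (u := fun t => a.1 (s.point t u)) (v := Test.fibre s b)
      (fun t _ => Test.hasDerivAt_slice' s a t u)
      (fun t _ => (hψ.differentiable (by simp) t).hasDerivAt)
      ((ha.mul hψ').integrable_of_hasCompactSupport hc.mul_right)
      ((ha'.mul hψ.continuous).integrable_of_hasCompactSupport hc'.mul_right)
      ((ha.mul hψ.continuous).integrable_of_hasCompactSupport hc.mul_right)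
    linarith
  rw [h1, integral_const_mul, h2, integral_point' s (Test.integrable_mul_coord a s hψ')]
  simp only [s.coord_point, integral_mul_const, Test.fibre]
  ring

/-! ### Fibre integration of linear observables on Minkowski spacetime -/

theorem TestLine.exists_bound (φ : TestLine) : ∃ R, ∀ t, φ.1 t ≠ 0 → |t| ≤ R := by
  obtain ⟨R, hR⟩ := φ.2.2.isCompact.isBounded.exists_norm_le
  exact ⟨R, fun t ht => hR t (subset_tsupport _ ht)⟩

/-- Fibre integration of test functions on Minkowski spacetime. -/
noncomputable def fibreMap (s : Chirality) : Test .mink →ₗ[ℝ] TestLine where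
  toFun b := ⟨Test.fibre s b, Test.contDiff_fibre s b, by
    obtain ⟨R, -, hR⟩ := Test.exists_bound b
    refine HasCompactSupport.intro (isCompact_Icc (a := -R) (b := R)) fun t ht => ?_
    rw [Test.fibre, ← integral_zero ℝ ℝ]
    congr 1
    funext u
    by_contra h
    exact ht (abs_le.1 ((hR s t u h).2 rfl).1)⟩
  map_add' a b := Subtype.ext (funext fun t =>
    integral_add (Test.integrable_slice s a t) (Test.integrable_slice s b t))
  map_smul' c b := Subtype.ext (funext fun t => integral_const_mul c _)

theorem fibreMap_apply (s : Chirality) (b : Test .mink) : (fibreMap s b).1 = Test.fibre s b := rfl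

theorem fibreMap_surjective (s : Chirality) : Function.Surjective (fibreMap s) := by
  intro φ
  -- multiply by a bump function of integral `1` along the fibres
  let f : ContDiffBump (0 : ℝ) := ⟨1, 2, one_pos, one_lt_two⟩
  let χ : TestLine := ⟨f.normed volume, f.contDiff_normed, f.hasCompactSupport_normed⟩
  have hχ : ∫ u, χ.1 u = 1 := f.integral_normed
  obtain ⟨R, hR⟩ := TestLine.exists_bound φ
  obtain ⟨S, hS⟩ := TestLine.exists_bound χ
  have hcoord : ∀ s : Chirality, ContDiff ℝ ∞ s.coord := by
    rintro (_ | _)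
    · exact contDiff_fst
    · exact contDiff_snd
  refine ⟨⟨fun x => φ.1 (s.coord x) * χ.1 (s.other.coord x), isTest_of_bound
    ((φ.2.1.comp (hcoord s)).mul (χ.2.1.comp (hcoord s.other))) ?_ s (R + S) ?_⟩,
    Subtype.ext (funext fun t => ?_)⟩
  · intro γ hγ x
    rw [(hγ : γ = 0), add_zero]
  · intro t u h
    rw [s.coord_point, s.other_coord_point] at h
    have h1 := hR t (left_ne_zero_of_mul h)
    have h2 := hS u (right_ne_zero_of_mul h)
    have h3 := abs_nonneg t
    have h4 := abs_nonneg u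
    exact ⟨(abs_add_le t u).trans (by linarith), fun _ => ⟨by linarith, by linarith⟩⟩
  · rw [fibreMap_apply, Test.fibre]
    simp only [s.coord_point, s.other_coord_point, integral_const_mul, hχ, mul_one]

/-- Fibre integration of linear observables on Minkowski spacetime; on `chiralObs .mink s.other` it
vanishes. -/
noncomputable def obsFibre (s : Chirality) : LinObs .mink →ₗ[ℝ] TestLine :=
  (trivialForms .mink).liftQ ((fibreMap s).comp (coeff s)) fun α hα => by
    obtain ⟨φ, hφ⟩ := coeff_of_mem_trivialForms s hα
    rw [LinearMap.mem_ker, LinearMap.comp_apply, hφ]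
    exact Subtype.ext (funext fun t => Test.fibre_pd_other s φ t)

theorem obsFibre_mk (s : Chirality) (α : OneForm .mink) :
    obsFibre s (Submodule.Quotient.mk α) = fibreMap s (coeff s α) := rfl

theorem eq_zero_of_obsFibre {v : LinObs .mink} (h : ∀ s, obsFibre s v = 0) : v = 0 := by
  obtain ⟨α, rfl⟩ := Submodule.Quotient.mk_surjective _ v
  refine (Submodule.Quotient.mk_eq_zero _).2 (mem_trivialForms_of_coeff fun s => ?_)
  obtain ⟨g, hg⟩ := Test.exists_pd_other_eq s (coeff s α)
    fun t => congrFun (congrArg Subtype.val (h s)) t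
  exact ⟨g, hg.symm⟩

theorem Chirality.forall_iff (s : Chirality) {p : Chirality → Prop} :
    (∀ s, p s) ↔ p s ∧ p s.other := by
  refine ⟨fun h => ⟨h _, h _⟩, fun ⟨h, h'⟩ s' => ?_⟩
  cases s <;> cases s' <;> assumption

theorem mk_ofCoeff_mem_chiralObs {X : Spacetime} (s : Chirality) (b : Test X) :
    (Submodule.Quotient.mk (ofCoeff s b) : LinObs X) ∈ chiralObs X s :=
  ⟨_, ofCoeff_mem_dualForms s b, rfl⟩

theorem exists_ofCoeff_of_mem_chiralObs {X : Spacetime} {s : Chirality} {v : LinObs X}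
    (hv : v ∈ chiralObs X s) : ∃ b, v = Submodule.Quotient.mk (ofCoeff s b) := by
  obtain ⟨α, hα, rfl⟩ := hv
  exact ⟨coeff s α, congrArg _ (eq_ofCoeff_of_mem_dualForms s hα)⟩

theorem obsFibre_other_of_mem {s : Chirality} {v : LinObs .mink} (hv : v ∈ chiralObs .mink s) :
    obsFibre s.other v = 0 := by
  obtain ⟨b, rfl⟩ := exists_ofCoeff_of_mem_chiralObs hv
  rw [obsFibre_mk, coeff_other_ofCoeff, map_zero]

theorem isCompl_chiralObs (s : Chirality) :
    IsCompl (chiralObs .mink s) (chiralObs .mink s.other) := by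
  constructor
  · refine Submodule.disjoint_def.2 fun v h h' => eq_zero_of_obsFibre (s.forall_iff.2 ⟨?_, ?_⟩)
    · have := obsFibre_other_of_mem h'
      rwa [s.other_other] at this
    · exact obsFibre_other_of_mem h
  · refine codisjoint_iff.2 (eq_top_iff.2 fun v _ => ?_)
    obtain ⟨α, rfl⟩ := Submodule.Quotient.mk_surjective _ v
    rw [← ofCoeff_add_ofCoeff s α]
    exact add_mem (Submodule.mem_sup_left (mk_ofCoeff_mem_chiralObs s _))
      (Submodule.mem_sup_right (mk_ofCoeff_mem_chiralObs s.other _))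

theorem mk_eq_zero_iff_exists_dualD {s : Chirality} {α : OneForm .mink}
    (hα : α ∈ dualForms .mink s) :
    (Submodule.Quotient.mk α : LinObs .mink) = 0 ↔ ∃ φ, dualD .mink s φ = α := by
  rw [Submodule.Quotient.mk_eq_zero]
  constructor
  · intro h
    obtain ⟨φ, hφ⟩ := coeff_of_mem_trivialForms s h
    exact ⟨φ, by rw [dualD_eq, ← hφ, ← eq_ofCoeff_of_mem_dualForms s hα]⟩
  · rintro ⟨φ, rfl⟩
    rw [dualD_eq]
    exact ofCoeff_pd_mem_trivialForms s φ

/-- Fibre integration as an isomorphism from the chiral observables to the test functions on the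
line. -/
noncomputable def chiralEquiv (s : Chirality) : chiralObs .mink s ≃ₗ[ℝ] TestLine :=
  LinearEquiv.ofBijective ((obsFibre s).domRestrict (chiralObs .mink s)) (by
    constructor
    · refine (injective_iff_map_eq_zero _).2 fun v hv => Subtype.ext ?_
      exact eq_zero_of_obsFibre (s.forall_iff.2 ⟨hv, obsFibre_other_of_mem v.2⟩)
    · intro φ
      obtain ⟨b, rfl⟩ := fibreMap_surjective s φ
      refine ⟨⟨_, mk_ofCoeff_mem_chiralObs s b⟩, ?_⟩
      change obsFibre s (Submodule.Quotient.mk (ofCoeff s b)) = _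
      rw [obsFibre_mk, coeff_ofCoeff])

theorem chiralEquiv_apply (s : Chirality) (v : chiralObs .mink s) :
    chiralEquiv s v = obsFibre s v := rfl

theorem lineForm_chiralEquiv (s : Chirality) (u v : chiralObs .mink s) :
    lineForm (chiralEquiv s u) (chiralEquiv s v) = poisson .mink (u : LinObs .mink) v := by
  obtain ⟨a, ha⟩ := exists_ofCoeff_of_mem_chiralObs u.2
  obtain ⟨b, hb⟩ := exists_ofCoeff_of_mem_chiralObs v.2
  rw [chiralEquiv_apply, chiralEquiv_apply, ha, hb, poisson_ofCoeff, obsFibre_mk, obsFibre_mk,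
    coeff_ofCoeff, coeff_ofCoeff]
  rfl

theorem poisson_chiralObs_other {s : Chirality} {v w : LinObs .mink} (hv : v ∈ chiralObs .mink s)
    (hw : w ∈ chiralObs .mink s.other) : poisson .mink v w = 0 := by
  obtain ⟨a, rfl⟩ := exists_ofCoeff_of_mem_chiralObs hv
  obtain ⟨b, rfl⟩ := exists_ofCoeff_of_mem_chiralObs hw
  exact poisson_ofCoeff_other s a b

/-- The Poisson structure `-½ ∫ φ dψ` is nondegenerate: pair `ψ` with its derivative. -/
theorem lineForm_nondegenerate {ψ : TestLine} (h : ∀ φ, lineForm φ ψ = 0) : ψ = 0 := by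
  have hψ : ContDiff ℝ ∞ ψ.1 := ψ.2.1
  have hψ' : ContDiff ℝ ∞ (deriv ψ.1) := (contDiff_infty_iff_deriv.1 hψ).2
  have hc : HasCompactSupport (deriv ψ.1) := HasCompactSupport.deriv ψ.2.2
  have h1 : -(1 / 2) * ∫ t, deriv ψ.1 t * deriv ψ.1 t = 0 := h ⟨deriv ψ.1, hψ', hc⟩
  have h2 : ∫ t, deriv ψ.1 t * deriv ψ.1 t = 0 := by linarith
  have h3 : (fun t => deriv ψ.1 t * deriv ψ.1 t) = 0 := by
    by_contra hne
    obtain ⟨t, ht⟩ := Function.ne_iff.1 hne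
    have hcc : HasCompactSupport fun t => deriv ψ.1 t * deriv ψ.1 t := hc.mul_right
    exact ((hψ'.continuous.mul hψ'.continuous).integral_pos_of_hasCompactSupport_nonneg_nonzero
      hcc (fun t => mul_self_nonneg _) ht).ne' h2
  have h4 : ∀ t, deriv ψ.1 t = 0 := fun t => mul_self_eq_zero.1 (congrFun h3 t)
  refine Subtype.ext (funext fun t => ?_)
  obtain ⟨R, hR⟩ := TestLine.exists_bound ψ
  rw [is_const_of_deriv_eq_zero (hψ.differentiable (by simp)) h4 t (|R| + 1)]
  by_contra hne
  have h5 := (le_abs_self _).trans (hR _ hne)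
  linarith [le_abs_self R]

theorem poisson_chiralObs_nondegenerate {s : Chirality} {v : LinObs .mink}
    (hv : v ∈ chiralObs .mink s) (h : ∀ w ∈ chiralObs .mink s, poisson .mink w v = 0) : v = 0 := by
  have h1 : chiralEquiv s ⟨v, hv⟩ = 0 := lineForm_nondegenerate fun φ => by
    obtain ⟨w, rfl⟩ := (chiralEquiv s).surjective φ
    rw [lineForm_chiralEquiv]
    exact h w w.2
  exact congrArg Subtype.val ((LinearEquiv.map_eq_zero_iff _).1 h1)

/-! ### Embeddings of Minkowski spacetime and their chiral projections -/

/-- The component in the direction `s` of a pair of functions. -/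
def Chirality.liftAt (s : Chirality) (hp hm : ℝ → ℝ) : ℝ → ℝ :=
  match s with
  | .plus => hp
  | .minus => hm

theorem Chirality.coord_lift (s : Chirality) (hp hm : ℝ → ℝ) (x : ℝ × ℝ) :
    s.coord (hp x.1, hm x.2) = s.liftAt hp hm (s.coord x) := by
  cases s <;> rfl

theorem chiralProj_map_apply {X Y : Spacetime} (s : Chirality) (f : X ⟶ Y) {hp hm : ℝ → ℝ}
    (H : IsLift f.1 hp hm) (t : ℝ) :
    ((chiralProj s).map f).1 (t : X.curve.Pt) = (s.liftAt hp hm t : Y.curve.Pt) := by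
  refine (Spacetime.proj_hom s f H t).trans ?_
  cases s <;> rfl

/-- The morphism from Minkowski spacetime with a given lift. -/
noncomputable def homOfLifts {X : Spacetime} {hp hm : ℝ → ℝ} (Hp : IsEmbLift .line X.curve hp)
    (Hm : IsEmbLift .line X.curve hm) : Spacetime.mink ⟶ X :=
  ⟨fun p => ((hp p.out.1, hm p.out.2) : ℝ × ℝ), hp, hm, Hp, Hm, fun x => by
    have h : ((x : Spacetime.mink.Pt).out : Spacetime.mink.Pt) = x := Quotient.out_eq' _
    rw [QuotientAddGroup.eq] at h
    have h' : -(x : Spacetime.mink.Pt).out + x = 0 := h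
    rw [neg_add_eq_zero.1 h']⟩

theorem isLift_homOfLifts {X : Spacetime} {hp hm : ℝ → ℝ} (Hp : IsEmbLift .line X.curve hp)
    (Hm : IsEmbLift .line X.curve hm) : IsLift (homOfLifts Hp Hm).1 hp hm := by
  refine ⟨Hp, Hm, fun x => ?_⟩
  have h : ((x : Spacetime.mink.Pt).out : Spacetime.mink.Pt) = x := Quotient.out_eq' _
  rw [QuotientAddGroup.eq] at h
  have h' : -(x : Spacetime.mink.Pt).out + x = 0 := h
  change (((hp (x : Spacetime.mink.Pt).out.1, hm (x : Spacetime.mink.Pt).out.2) : ℝ × ℝ) : X.Pt) = _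
  rw [neg_add_eq_zero.1 h']

/-- The chiral projections are full on morphisms out of Minkowski spacetime. -/
theorem exists_chiralProj_map_eq (s : Chirality) (X : Spacetime)
    (j : (chiralProj s).obj .mink ⟶ (chiralProj s).obj X) :
    ∃ f : Spacetime.mink ⟶ X, (chiralProj s).map f = j := by
  obtain ⟨h, H, hj⟩ := j.2
  refine ⟨homOfLifts H H, Curve.hom_ext fun t => ?_⟩
  refine (chiralProj_map_apply s _ (isLift_homOfLifts H H) t).trans (Eq.trans ?_ (hj t).symm)
  cases s <;> rfl

theorem isEmbLift_add_const (c : ℝ) : IsEmbLift .line .line fun t => t + c where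
  smooth := contDiff_id.add contDiff_const
  deriv_pos t := by simp
  compat := trivial

/-- The translation of Minkowski spacetime by `c` along the fibres of the projection. -/
noncomputable def fibreTranslation (c : ℝ) : Chirality → (Spacetime.mink ⟶ Spacetime.mink)
  | .plus => homOfLifts (X := .mink) (IsEmbLift.id .line) (isEmbLift_add_const c)
  | .minus => homOfLifts (X := .mink) (isEmbLift_add_const c) (IsEmbLift.id .line)

theorem exists_isLift_fibreTranslation (s : Chirality) (c : ℝ) :
    ∃ hp hm, IsLift (fibreTranslation c s).1 hp hm ∧ (∀ t, s.liftAt hp hm t = t) ∧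
      ∀ y : ℝ × ℝ, ∃ x : ℝ × ℝ, (hp x.1, hm x.2) = y ∧ s.other.coord y = s.other.coord x + c := by
  cases s
  · exact ⟨_, _, isLift_homOfLifts (X := .mink) (IsEmbLift.id .line) (isEmbLift_add_const c),
      fun _ => rfl, fun y => ⟨(y.1, y.2 - c), by simp, (sub_add_cancel y.2 c).symm⟩⟩
  · exact ⟨_, _, isLift_homOfLifts (X := .mink) (isEmbLift_add_const c) (IsEmbLift.id .line),
      fun _ => rfl, fun y => ⟨(y.1 - c, y.2), by simp, (sub_add_cancel y.1 c).symm⟩⟩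

theorem chiralProj_map_fibreTranslation (s : Chirality) (c : ℝ) :
    (chiralProj s).map (fibreTranslation c s) = (chiralProj s).map (𝟙 Spacetime.mink) := by
  obtain ⟨hp, hm, H, h, -⟩ := exists_isLift_fibreTranslation s c
  refine Curve.hom_ext fun t => ?_
  refine (chiralProj_map_apply s _ H t).trans (Eq.trans ?_
    (chiralProj_map_apply s (𝟙 Spacetime.mink) (IsLift.refl .mink) t).symm)
  rw [h]
  cases s <;> rfl

/-! ### Chiral observables under pushforward -/

section push

variable {X Y : Spacetime} {f : X.Pt → Y.Pt} {hp hm : ℝ → ℝ}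

theorem pushOne_ofCoeff (H : IsLift f hp hm) (s : Chirality) (b : Test X) :
    H.pushOne (ofCoeff s b) = ofCoeff s (H.pushCoeff s.other b) := by
  cases s
  · exact Prod.ext (map_zero (H.pushCoeff .plus)) rfl
  · exact Prod.ext rfl (map_zero (H.pushCoeff .minus))

theorem Spacetime.exists_mem_deck_coord (X : Spacetime) (s : Chirality) {n : ℝ}
    (hn : n ∈ X.curve.lattice) : ∃ γ ∈ X.deck, s.coord γ = n := by
  cases X
  · exact ⟨0, zero_mem _, (map_zero _).trans (hn : n = 0).symm⟩
  · obtain ⟨k, rfl⟩ := AddSubgroup.mem_zmultiples_iff.1 hn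
    cases s
    · exact ⟨_, IsLift.deck_mem_cyl k, by simp [Chirality.coord]⟩
    · exact ⟨_, IsLift.deck_mem_cyl (-k), by simp [Chirality.coord]⟩

/-- The fibre integral of a pushforward, over the image of a fibre. Since fibre integrals are values
of the causal propagator this is the naturality of the latter. -/
theorem fibre_pushCoeff (H : IsLift f hp hm) (s : Chirality) (b : Test X) {a t : ℝ}
    (ht : (t : Y.curve.Pt) = (s.liftAt hp hm a : Y.curve.Pt)) :
    Test.fibre s (H.pushCoeff s.other b) t = Test.fibre s b a := by
  rw [eq_comm, QuotientAddGroup.eq] at ht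
  obtain ⟨γ, hγ, hγt⟩ := Y.exists_mem_deck_coord s ht
  -- the second coordinate of the base point is immaterial
  have hx : s.coord (s.point a 0) = a := s.coord_point a 0
  generalize s.point a 0 = x at hx
  have hy : s.coord (γ + (hp x.1, hm x.2)) = t := by
    rw [map_add, s.coord_lift, hγt, hx]
    ring
  have h1 := H.causalProp_push (dOne (ofCoeff s b)) x
  rw [← H.dOne_push, pushOne_ofCoeff, ← causalProp_periodic _ hγ, causalProp_dOne_ofCoeff,
    causalProp_dOne_ofCoeff, hy, hx] at h1
  refine mul_left_cancel₀ ?_ h1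
  cases s <;> norm_num [Chirality.hodgeSign]

theorem fibre_pushCoeff_eq_zero (H : IsLift f hp hm) (s : Chirality) (b : Test X) {t : ℝ}
    (ht : ∀ a, (t : Y.curve.Pt) ≠ (s.liftAt hp hm a : Y.curve.Pt)) :
    Test.fibre s (H.pushCoeff s.other b) t = 0 := by
  rw [Test.fibre, ← integral_zero ℝ ℝ]
  congr 1
  funext u
  refine (H.pushTest_eventually _ _ b ?_).eq_of_nhds
  rintro ⟨x, γ, hγ, h⟩
  refine ht (s.coord x) ?_
  have h1 := congrArg s.coord h
  rw [s.coord_point, map_add, s.coord_lift] at h1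
  rw [eq_comm, QuotientAddGroup.eq, h1, neg_add_cancel_left]
  exact Y.deck_le s hγ

end push

/-- Morphisms with the same projection agree on the chiral observables: the fibre integrals of the
two pushforwards coincide. -/
theorem linObsMap_eq_of_chiralProj_map_eq {s : Chirality} {X Y : Spacetime} {f g : X ⟶ Y}
    (hfg : (chiralProj s).map f = (chiralProj s).map g) {v : LinObs X} (hv : v ∈ chiralObs X s) :
    linObsMap f v = linObsMap g v := by
  obtain ⟨b, rfl⟩ := exists_ofCoeff_of_mem_chiralObs hv
  obtain ⟨hp, hm, H⟩ := f.2
  obtain ⟨kp, km, K⟩ := g.2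
  have hHK : ∀ a : ℝ, (s.liftAt hp hm a : Y.curve.Pt) = (s.liftAt kp km a : Y.curve.Pt) :=
    fun a => by rw [← chiralProj_map_apply s f H, ← chiralProj_map_apply s g K, hfg]
  have hfib : ∀ t, Test.fibre s (H.pushCoeff s.other b) t =
      Test.fibre s (K.pushCoeff s.other b) t := by
    intro t
    by_cases ht : ∃ a, (t : Y.curve.Pt) = (s.liftAt hp hm a : Y.curve.Pt)
    · obtain ⟨a, ha⟩ := ht
      rw [fibre_pushCoeff H s b ha, fibre_pushCoeff K s b (ha.trans (hHK a))]
    · rw [fibre_pushCoeff_eq_zero H s b fun a ha => ht ⟨a, ha⟩,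
        fibre_pushCoeff_eq_zero K s b fun a ha => ht ⟨a, ha.trans (hHK a).symm⟩]
  obtain ⟨φ, hφ⟩ := Test.exists_pd_other_eq s (H.pushCoeff s.other b - K.pushCoeff s.other b)
    fun t => by
      refine (integral_sub (Test.integrable_slice s (H.pushCoeff s.other b) t)
        (Test.integrable_slice s (K.pushCoeff s.other b) t)).trans (sub_eq_zero.2 (hfib t))
  rw [linObsMap_mk f H, linObsMap_mk g K, pushOne_ofCoeff, pushOne_ofCoeff,
    Submodule.Quotient.eq, ← map_sub, ← hφ]
  exact ofCoeff_pd_mem_trivialForms s φ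

/-- Far translates of an observable along the fibres commute with the observables of the opposite
chirality. -/
theorem exists_poisson_fibreTranslation_eq_zero (s : Chirality) (v : LinObs .mink)
    {w : LinObs .mink} (hw : w ∈ chiralObs .mink s.other) :
    ∃ C, ∀ c ≥ C, poisson .mink (linObsMap (fibreTranslation c s) v) w = 0 := by
  obtain ⟨α, rfl⟩ := Submodule.Quotient.mk_surjective _ v
  obtain ⟨b, rfl⟩ := exists_ofCoeff_of_mem_chiralObs hw
  obtain ⟨R, -, hR⟩ := Test.exists_bound (dOne α)
  obtain ⟨S, hS⟩ := TestLine.exists_bound (fibreMap s.other b)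
  refine ⟨R + S + 1, fun c hc => ?_⟩
  obtain ⟨hp, hm, H, -, h⟩ := exists_isLift_fibreTranslation s c
  rw [linObsMap_mk _ H, poisson_mk_ofCoeff, ← integral_zero (ℝ × ℝ) ℝ, H.dOne_push]
  congr 1
  funext y
  obtain ⟨x, rfl, hx⟩ := h y
  rw [IsLift.pushTwo, H.pushTest_apply]
  by_contra hne
  have h1 := left_ne_zero_of_mul (left_ne_zero_of_mul hne)
  have h2 := hS _ (right_ne_zero_of_mul (right_ne_zero_of_mul hne))
  rw [← s.point_coord x] at h1
  have h3 := abs_le.1 ((hR s _ _ h1).2 rfl).2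
  rw [hx] at h2
  linarith [(abs_le.1 h2).2, h3.1]

/-- The action of a morphism of spacetimes on the algebras of the Abelian current. -/
noncomputable abbrev currentMap {X Y : Spacetime} (f : X ⟶ Y) :
    CCR (poisson X) →⋆ₐ[ℂ] CCR (poisson Y) :=
  CCR.map (linObsMap f) (poisson_natural f)

/-- Elements invariant under the translations along the fibres belong to the subalgebra generated by
the chiral observables: being equal to their far translates, they commute with the observables of
the other chirality. -/
theorem mem_adjoin_of_currentMap_fibreTranslation {s : Chirality} {a : CCR (poisson .mink)}
    (ha : ∀ c, currentMap (fibreTranslation c s) a = a) :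
    a ∈ Algebra.adjoin ℂ (CCR.gen (poisson .mink) '' (chiralObs .mink s)) := by
  refine CCR.mem_adjoin_of_commute (W := chiralObs .mink s.other) (isCompl_chiralObs s).sup_eq_top
    (fun w hw u hu => by rw [poisson_skew, poisson_chiralObs_other hu hw, neg_zero])
    (fun w hw => poisson_chiralObs_nondegenerate hw) fun w hw => ?_
  suffices h : ∃ C, ∀ c ≥ C, CCR.gen (poisson .mink) w * currentMap (fibreTranslation c s) a =
      currentMap (fibreTranslation c s) a * CCR.gen (poisson .mink) w by
    obtain ⟨C, hC⟩ := h
    have h1 := hC C le_rfl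
    rwa [ha] at h1
  clear ha
  induction a using CCR.induction with
  | halg r =>
    refine ⟨0, fun c _ => ?_⟩
    rw [AlgHomClass.commutes]
    exact (Algebra.commutes r _).symm
  | hgen v =>
    obtain ⟨C, hC⟩ := exists_poisson_fibreTranslation_eq_zero s v hw
    refine ⟨C, fun c hc => ?_⟩
    rw [CCR.map_gen]
    exact (CCR.gen_mul_comm_of_eq_zero (hC c hc)).symm
  | hadd a b ha hb =>
    obtain ⟨A, hA⟩ := ha
    obtain ⟨B, hB⟩ := hb
    refine ⟨max A B, fun c hc => ?_⟩
    rw [map_add, mul_add, add_mul, hA c ((le_max_left A B).trans hc),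
      hB c ((le_max_right A B).trans hc)]
  | hmul a b ha hb =>
    obtain ⟨A, hA⟩ := ha
    obtain ⟨B, hB⟩ := hb
    refine ⟨max A B, fun c hc => ?_⟩
    rw [map_mul, ← mul_assoc, hA c ((le_max_left A B).trans hc), mul_assoc,
      hB c ((le_max_right A B).trans hc), mul_assoc]

theorem currentMap_eq_of_mem_adjoin {s : Chirality} {X Y : Spacetime} {f g : X ⟶ Y}
    (hfg : (chiralProj s).map f = (chiralProj s).map g) {a : CCR (poisson X)}
    (ha : a ∈ Algebra.adjoin ℂ (CCR.gen (poisson X) '' (chiralObs X s))) :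
    currentMap f a = currentMap g a := by
  induction ha using Algebra.adjoin_induction with
  | mem x hx =>
    obtain ⟨v, hv, rfl⟩ := hx
    rw [CCR.map_gen, CCR.map_gen, linObsMap_eq_of_chiralProj_map_eq hfg hv]
  | algebraMap r => rw [AlgHomClass.commutes, AlgHomClass.commutes]
  | add x y _ _ hx hy => rw [map_add, map_add, hx, hy]
  | mul x y _ _ hx hy => rw [map_mul, map_mul, hx, hy]

/-- The elements of the algebra of Minkowski spacetime on which morphisms with the same projection
agree are those of the subalgebra generated by the chiral observables. -/
theorem mem_adjoin_iff_currentMap_eq {s : Chirality} {a : CCR (poisson .mink)} :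
    a ∈ Algebra.adjoin ℂ (CCR.gen (poisson .mink) '' (chiralObs .mink s)) ↔
      ∀ (X : Spacetime) (f g : Spacetime.mink ⟶ X), (chiralProj s).map f = (chiralProj s).map g →
        currentMap f a = currentMap g a := by
  refine ⟨fun ha X f g hfg => currentMap_eq_of_mem_adjoin hfg ha, fun h => ?_⟩
  refine mem_adjoin_of_currentMap_fibreTranslation fun c => ?_
  rw [h _ _ _ (chiralProj_map_fibreTranslation s c)]
  exact congrArg (fun h : CCR (poisson .mink) →⋆ₐ[ℂ] CCR (poisson .mink) => h a)
    (abelianCurrent.map_id .mink)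

theorem chiralIncl_injective (s : Chirality) : Function.Injective (chiralIncl .mink s) :=
  CCR.map_subtype_injective (isCompl_chiralObs s) poisson_skew
    (fun _ hu _ hw => poisson_chiralObs_other hu hw) _

theorem chiralIncl_gen {X : Spacetime} {s : Chirality} (v : chiralObs X s) :
    chiralIncl X s (CCR.gen _ v) = CCR.gen _ (v : LinObs X) :=
  CCR.map_gen _ _ _

theorem mem_range_chiralIncl_iff {X : Spacetime} {s : Chirality} {a : CCR (poisson X)} :
    a ∈ (chiralIncl X s).range ↔
      a ∈ Algebra.adjoin ℂ (CCR.gen (poisson X) '' (chiralObs X s)) := by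
  constructor
  · rintro ⟨b, rfl⟩
    change chiralIncl X s b ∈ _
    induction b using CCR.induction with
    | halg r => rw [AlgHomClass.commutes]; exact Subalgebra.algebraMap_mem _ r
    | hgen v =>
      rw [chiralIncl_gen]
      exact Algebra.subset_adjoin ⟨v, v.2, rfl⟩
    | hadd a b ha hb => rw [map_add]; exact add_mem ha hb
    | hmul a b ha hb => rw [map_mul]; exact mul_mem ha hb
  · intro ha
    refine Algebra.adjoin_le (S := (chiralIncl X s).range.toSubalgebra) ?_ ha
    rintro _ ⟨v, hv, rfl⟩
    exact ⟨CCR.gen _ ⟨v, hv⟩, chiralIncl_gen ⟨v, hv⟩⟩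

theorem mem_starAlgebra_adjoin_iff {X : Spacetime} {s : Chirality} {a : CCR (poisson X)} :
    a ∈ StarAlgebra.adjoin ℂ (CCR.gen (poisson X) '' (chiralObs X s : Set (LinObs X))) ↔
      a ∈ Algebra.adjoin ℂ (CCR.gen (poisson X) '' (chiralObs X s)) := by
  have h : star (CCR.gen (poisson X) '' (chiralObs X s : Set (LinObs X))) =
      CCR.gen (poisson X) '' (chiralObs X s : Set (LinObs X)) := by
    ext x
    rw [Set.mem_star]
    constructor
    · rintro ⟨v, hv, h⟩
      exact ⟨v, hv, by rw [← star_star x, ← h, CCR.star_gen]⟩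
    · rintro ⟨v, hv, rfl⟩
      exact ⟨v, hv, (CCR.star_gen v).symm⟩
  rw [← StarSubalgebra.mem_toSubalgebra, StarAlgebra.adjoin_toSubalgebra, h, Set.union_self]

/-! ### Limits of star-algebras -/

namespace StarAlg

/-- A morphism in the category of star-algebras, as a homomorphism. -/
def homOf {A B : StarAlg} (f : A ⟶ B) : A.carrier →⋆ₐ[ℂ] B.carrier := f

theorem homOf_comp {A B C : StarAlg} (f : A ⟶ B) (g : B ⟶ C) (a : A.carrier) :
    homOf (f ≫ g) a = homOf g (homOf f a) := rfl

theorem homOf_id (A : StarAlg) (a : A.carrier) : homOf (𝟙 A) a = a := rfl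

theorem hom_ext {A B : StarAlg} {f g : A ⟶ B} (h : ∀ a, homOf f a = homOf g a) : f = g :=
  StarAlgHom.ext h

variable {J : Type} [Category.{0} J] (F : J ⥤ StarAlg)

/-- The star-algebra of compatible families of elements of a diagram. -/
def sections : StarSubalgebra ℂ (∀ j, (F.obj j).carrier) where
  carrier := {x | ∀ ⦃j k : J⦄ (f : j ⟶ k), homOf (F.map f) (x j) = x k}
  mul_mem' hx hy j k f := by rw [Pi.mul_apply, map_mul, hx f, hy f, Pi.mul_apply]
  add_mem' hx hy j k f := by rw [Pi.add_apply, map_add, hx f, hy f, Pi.add_apply]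
  algebraMap_mem' r j k f := AlgHomClass.commutes (homOf (F.map f)) r
  star_mem' hx j k f := by rw [Pi.star_apply, map_star, hx f, Pi.star_apply]

/-- The cone over a diagram whose apex is the star-algebra of compatible families. -/
def sectionsCone : Limits.Cone F where
  pt := ⟨sections F⟩
  π :=
    { app := fun j => ((Pi.evalStarAlgHom ℂ (fun j => (F.obj j).carrier) j).comp
        (sections F).subtype : sections F →⋆ₐ[ℂ] (F.obj j).carrier)
      naturality := fun _ _ f => StarAlgHom.ext fun x => (x.2 f).symm }

variable {F} in
/-- A leg of a cone, as a homomorphism on the star-algebra at the apex. -/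
def leg (c : Limits.Cone F) (j : J) : c.pt.carrier →⋆ₐ[ℂ] (F.obj j).carrier := c.π.app j

/-- The compatible families form a limit. -/
def sectionsConeIsLimit : Limits.IsLimit (sectionsCone F) where
  lift c := StarAlgHom.codRestrict
    { toFun := fun a j => leg c j a
      map_one' := funext fun j => map_one (leg c j)
      map_mul' := fun a b => funext fun j => map_mul (leg c j) a b
      map_zero' := funext fun j => map_zero (leg c j)
      map_add' := fun a b => funext fun j => map_add (leg c j) a b
      commutes' := fun r => funext fun j => AlgHomClass.commutes (leg c j) r
      map_star' := fun a => funext fun j => map_star (leg c j) a }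
    (sections F) fun a j k f => by
      change homOf (F.map f) (leg c j a) = leg c k a
      exact congrArg (fun m : c.pt ⟶ F.obj k => homOf m a) (c.w f)
  fac c j := rfl
  uniq c m hm := hom_ext fun a => Subtype.ext (funext fun j =>
    congrArg (fun m : c.pt ⟶ F.obj j => homOf m a) (hm j))

variable {F} {c : Limits.Cone F}

theorem eq_of_isLimit (hc : Limits.IsLimit c) {a b : c.pt.carrier}
    (h : ∀ j, leg c j a = leg c j b) : a = b := by
  let e := hc.conePointUniqueUpToIso (sectionsConeIsLimit F)
  have he : ∀ a, homOf e.inv (homOf e.hom a) = a := fun a => by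
    rw [← homOf_comp, e.hom_inv_id, homOf_id]
  rw [← he a, ← he b]
  congr 1
  exact Subtype.ext (funext h)

theorem exists_of_isLimit (hc : Limits.IsLimit c) {x : ∀ j, (F.obj j).carrier}
    (hx : x ∈ sections F) : ∃ a : c.pt.carrier, ∀ j, leg c j a = x j := by
  refine ⟨homOf (hc.lift (sectionsCone F)) ⟨x, hx⟩, fun j => ?_⟩
  exact congrArg (fun m : (sectionsCone F).pt ⟶ F.obj j => homOf m ⟨x, hx⟩)
    (hc.fac (sectionsCone F) j)

instance : Limits.HasLimitsOfShape J StarAlg where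
  has_limit F := ⟨⟨⟨sectionsCone F, sectionsConeIsLimit F⟩⟩⟩

end StarAlg

/-! ### The right Kan extension along a chiral projection -/

theorem hasPointwiseRightKanExtension_chiralProj (s : Chirality) :
    (chiralProj s).HasPointwiseRightKanExtension abelianCurrent := fun N =>
  inferInstanceAs (Limits.HasLimit
    (StructuredArrow.proj N (chiralProj s) ⋙ abelianCurrent))

section counit

variable {s : Chirality} {B : Curve ⥤ StarAlg} {ε : chiralProj s ⋙ B ⟶ abelianCurrent}

/-- The value on the line of a right Kan extension is the limit over the spacetimes under the line.
-/
noncomputable def coneAtLineIsLimit (hB : B.IsRightKanExtension ε) :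
    Limits.IsLimit ((Functor.RightExtension.mk B ε).coneAt Curve.line) :=
  haveI := hasPointwiseRightKanExtension_chiralProj s
  Functor.isPointwiseRightKanExtensionOfIsRightKanExtension B ε Curve.line

theorem currentMap_counitMink {X : Spacetime} (f : Spacetime.mink ⟶ X)
    (b : (B.obj .line).carrier) :
    currentMap f (counitMink ε b) =
      StarAlg.homOf (B.map ((chiralProj s).map f) ≫ ε.app X) b := by
  have h := ε.naturality f
  change B.map ((chiralProj s).map f) ≫ ε.app X = ε.app .mink ≫ abelianCurrent.map f at h
  rw [h]
  rfl

theorem counitMink_injective (hB : B.IsRightKanExtension ε) :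
    Function.Injective (counitMink ε) := by
  intro a b hab
  refine StarAlg.eq_of_isLimit (coneAtLineIsLimit hB) fun j => ?_
  obtain ⟨f, hf⟩ := exists_chiralProj_map_eq s j.right j.hom
  change StarAlg.homOf (B.map j.hom ≫ ε.app j.right) a =
    StarAlg.homOf (B.map j.hom ≫ ε.app j.right) b
  rw [← hf]
  exact (currentMap_counitMink f a).symm.trans
    ((congrArg (currentMap f) hab).trans (currentMap_counitMink f b))

/-- Minkowski spacetime is weakly initial among the spacetimes under the line, so that the limit
consists of the elements on which morphisms with the same projection agree. -/
theorem mem_range_counitMink_iff (hB : B.IsRightKanExtension ε) {a : CCR (poisson .mink)} :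
    a ∈ (counitMink ε).range ↔
      ∀ (X : Spacetime) (f g : Spacetime.mink ⟶ X), (chiralProj s).map f = (chiralProj s).map g →
        currentMap f a = currentMap g a := by
  constructor
  · rintro ⟨b, rfl⟩ X f g hfg
    exact (currentMap_counitMink f b).trans
      ((by rw [hfg] : _ = _).trans (currentMap_counitMink g b).symm)
  · intro h
    choose f hf using fun j : StructuredArrow Curve.line (chiralProj s) =>
      exists_chiralProj_map_eq s j.right j.hom
    obtain ⟨b, hb⟩ := StarAlg.exists_of_isLimit (coneAtLineIsLimit hB)
      (x := fun j => currentMap (f j) a) fun j k φ => by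
        change currentMap φ.right (currentMap (f j) a) = currentMap (f k) a
        have h1 : currentMap φ.right (currentMap (f j) a) = currentMap (f j ≫ φ.right) a :=
          (congrArg (fun h : CCR (poisson .mink) →⋆ₐ[ℂ] CCR (poisson k.right) => h a)
            (abelianCurrent.map_comp (f j) φ.right)).symm
        rw [h1]
        refine h _ _ _ ?_
        rw [Functor.map_comp, hf, hf]
        exact StructuredArrow.w φ
    refine ⟨b, ?_⟩
    let j : StructuredArrow Curve.line (chiralProj s) :=
      StructuredArrow.mk (Y := Spacetime.mink) (𝟙 Curve.line)
    have h2 : B.map (𝟙 Curve.line) ≫ ε.app .mink = ε.app .mink := by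
      rw [B.map_id]
      exact Category.id_comp _
    refine (congrArg (fun m : B.obj .line ⟶ abelianCurrent.obj .mink => StarAlg.homOf m b)
      h2).symm.trans ((hb j).trans ?_)
    have h3 : (chiralProj s).map (f j) = (chiralProj s).map (𝟙 Spacetime.mink) := by
      rw [hf, (chiralProj s).map_id]
      rfl
    refine (h _ _ _ h3).trans ?_
    exact congrArg (fun h : CCR (poisson .mink) →⋆ₐ[ℂ] CCR (poisson .mink) => h a)
      (abelianCurrent.map_id .mink)

theorem range_counitMink (hB : B.IsRightKanExtension ε) :
    (counitMink ε).range = (chiralIncl .mink s).range := by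
  ext a
  rw [mem_range_counitMink_iff hB, ← mem_adjoin_iff_currentMap_eq, mem_range_chiralIncl_iff]

end counit

/-- Star-algebras embedded in a third one with the same range are isomorphic. -/
theorem exists_starAlgEquiv_of_range_eq {A B C : Type} [Ring A] [StarRing A] [Algebra ℂ A]
    [Ring B] [StarRing B] [Algebra ℂ B] [Ring C] [StarRing C] [Algebra ℂ C]
    [StarModule ℂ A] [StarModule ℂ B] [StarModule ℂ C]
    {f : A →⋆ₐ[ℂ] C} {g : B →⋆ₐ[ℂ] C} (hf : Function.Injective f) (hg : Function.Injective g)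
    (h : f.range = g.range) : ∃ e : A ≃⋆ₐ[ℂ] B, ∀ b, f (e.symm b) = g b := by
  have hmem : ∀ b, g b ∈ f.range := fun b => h ▸ ⟨b, rfl⟩
  choose k hk using hmem
  have hk' : ∀ b, f (k b) = g b := hk
  let e : B →⋆ₐ[ℂ] A :=
    { toFun := k
      map_one' := hf (by rw [hk', map_one, map_one])
      map_mul' := fun a b => hf (by rw [hk', map_mul, map_mul, hk', hk'])
      map_zero' := hf (by rw [hk', map_zero, map_zero])
      map_add' := fun a b => hf (by rw [hk', map_add, map_add, hk', hk'])
      commutes' := fun r => hf (by rw [hk', AlgHomClass.commutes, AlgHomClass.commutes])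
      map_star' := fun a => hf (by rw [hk', map_star, map_star, hk']) }
  have he : Function.Bijective e := by
    refine ⟨fun a b hab => hg ?_, fun a => ?_⟩
    · rw [← hk' a, ← hk' b]
      exact congrArg f hab
    · obtain ⟨b, hb⟩ : f a ∈ g.range := h ▸ ⟨a, rfl⟩
      exact ⟨b, hf ((hk' b).trans hb)⟩
  refine ⟨(StarAlgEquiv.ofBijective e he).symm, fun b => ?_⟩
  exact hk' b

/-- The CCR algebra of the line, embedded in the algebra of Minkowski spacetime. -/
noncomputable def lineIncl (s : Chirality) : CCR lineForm →⋆ₐ[ℂ] CCR (poisson .mink) :=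
  (chiralIncl .mink s).comp (CCR.map (τ := lineForm) (σ := chiralPoisson .mink s)
    (chiralEquiv s).symm.toLinearMap fun φ ψ => by
      obtain ⟨u, rfl⟩ := (chiralEquiv s).surjective φ
      obtain ⟨v, rfl⟩ := (chiralEquiv s).surjective ψ
      rw [LinearEquiv.coe_coe, LinearEquiv.symm_apply_apply, LinearEquiv.symm_apply_apply,
        lineForm_chiralEquiv]
      rfl)

theorem lineIncl_gen (s : Chirality) (u : chiralObs .mink s) :
    lineIncl s (CCR.gen _ (chiralEquiv s u)) = CCR.gen (poisson .mink) u := by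
  rw [lineIncl, StarAlgHom.comp_apply, CCR.map_gen, chiralIncl_gen, LinearEquiv.coe_coe,
    LinearEquiv.symm_apply_apply]

theorem lineIncl_injective_range (s : Chirality) :
    Function.Injective (lineIncl s) ∧ (lineIncl s).range = (chiralIncl .mink s).range := by
  let r : CCR (chiralPoisson .mink s) →⋆ₐ[ℂ] CCR lineForm :=
    CCR.map (τ := chiralPoisson .mink s) (σ := lineForm) (chiralEquiv s).toLinearMap
      (lineForm_chiralEquiv s)
  have hr : ∀ a, lineIncl s (r a) = chiralIncl .mink s a := fun a => by
    have h : (lineIncl s).comp r = chiralIncl .mink s := CCR.hom_ext fun v => by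
      have hv : r (CCR.gen _ v) = CCR.gen _ (chiralEquiv s v) := CCR.map_gen _ _ _
      rw [StarAlgHom.comp_apply, hv, lineIncl_gen, chiralIncl_gen]
    exact DFunLike.congr_fun h a
  have hsurj : Function.Surjective r := by
    intro b
    induction b using CCR.induction with
    | halg c => exact ⟨algebraMap ℂ _ c, AlgHomClass.commutes r c⟩
    | hgen φ =>
      obtain ⟨u, rfl⟩ := (chiralEquiv s).surjective φ
      exact ⟨CCR.gen _ u, CCR.map_gen _ _ _⟩
    | hadd a b ha hb =>
      obtain ⟨a, rfl⟩ := ha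
      obtain ⟨b, rfl⟩ := hb
      exact ⟨a + b, map_add r a b⟩
    | hmul a b ha hb =>
      obtain ⟨a, rfl⟩ := ha
      obtain ⟨b, rfl⟩ := hb
      exact ⟨a * b, map_mul r a b⟩
  constructor
  · intro a b hab
    obtain ⟨a, rfl⟩ := hsurj a
    obtain ⟨b, rfl⟩ := hsurj b
    rw [hr, hr] at hab
    rw [chiralIncl_injective s hab]
  · ext x
    constructor
    · rintro ⟨b, rfl⟩
      obtain ⟨a, rfl⟩ := hsurj b
      exact ⟨a, (hr a).symm⟩
    · rintro ⟨a, rfl⟩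
      exact ⟨r a, hr a⟩

end ChiralCurrent

theorem proposition6p1 (s : Chirality) :
    -- the linear observables are the direct sum of the two chiral summands
    IsCompl (chiralObs .mink .plus) (chiralObs .mink .minus) ∧
    (∀ α ∈ dualForms .mink s,
      (Submodule.Quotient.mk α : LinObs .mink) = 0 ↔
        ∃ φ, dualD .mink s φ = α) ∧
    -- the inclusion of the summand induces an inclusion of CCR algebras
    Function.Injective (chiralIncl .mink s) ∧
    -- the right Kan extension along the chiral projection exists and is pointwise
    (chiralProj s).HasPointwiseRightKanExtension abelianCurrent ∧
    -- its value on the line is the CCR subalgebra of the chiral summand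
    (∀ (B : Curve ⥤ StarAlg)
      (ε : chiralProj s ⋙ B ⟶ abelianCurrent),
      B.IsRightKanExtension ε →
        Function.Injective (counitMink ε) ∧
        (counitMink ε).range = (chiralIncl .mink s).range ∧
        (counitMink ε).range = StarAlgebra.adjoin ℂ
          (CCR.gen (poisson .mink) ''
            (chiralObs .mink s : Set (LinObs .mink)))) ∧
    -- fibre integration identifies it with the usual chiral current on the line
    ∃ p : chiralObs .mink s ≃ₗ[ℝ] TestLine,
      (∀ α ∈ dualForms .mink s, ∀ u : chiralObs .mink s,
        (u : LinObs .mink) = Submodule.Quotient.mk α →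
          (p u : ℝ → ℝ) = fibreIntegral s α) ∧
      (∀ u v, lineForm (p u) (p v) =
        poisson .mink (u : LinObs .mink) v) ∧
      ∀ (B : Curve ⥤ StarAlg)
        (ε : chiralProj s ⋙ B ⟶ abelianCurrent),
        B.IsRightKanExtension ε →
          ∃ e : (B.obj .line).carrier ≃⋆ₐ[ℂ] CCR lineForm,
            ∀ u, counitMink ε (e.symm (CCR.gen _ (p u))) =
              CCR.gen (poisson .mink) u := by
  refine ⟨isCompl_chiralObs .plus, fun α hα => mk_eq_zero_iff_exists_dualD hα,
    chiralIncl_injective s, hasPointwiseRightKanExtension_chiralProj s, fun B ε hB => ?_,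
    chiralEquiv s, fun α hα u hu => ?_, lineForm_chiralEquiv s, fun B ε hB => ?_⟩
  · refine ⟨counitMink_injective hB, range_counitMink hB, ?_⟩
    ext a
    rw [range_counitMink hB, mem_range_chiralIncl_iff, mem_starAlgebra_adjoin_iff]
  · rw [chiralEquiv_apply, hu, obsFibre_mk, fibreMap_apply]
    exact funext fun t => (fibreIntegral_eq s α t).symm
  · obtain ⟨hinj, hrange⟩ := lineIncl_injective_range s
    obtain ⟨e, he⟩ := exists_starAlgEquiv_of_range_eq (counitMink_injective hB) hinj
      ((range_counitMink hB).trans hrange.symm)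
    exact ⟨e, fun u => (he _).trans (lineIncl_gen s u)⟩
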